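/- Let $L$ be one of the following five $\mathbb{Z}$-Lie algebras, each free of rank $3$ over $\mathbb{Z}$ with basis $e_1,e_2,e_3$ (up to antisymmetry, brackets of basis elements that are not listed are zero): the abelian Lie algebra $\mathbb{Z}^3$; the Heisenberg Lie algebra $H$ with $[e_1,e_2]=e_3$; $\mathrm{sl}_2(\mathbb{Z})$ with $[e_1,e_2]=e_3$, $[e_1,e_3]=-2e_1$, $[e_2,e_3]=2e_2$; $L_1$ with $[e_1,e_2]=e_3$, $[e_1,e_3]=e_2$; and $L_2$ with $[e_1,e_2]=e_3$, $[e_1,e_3]=-e_2$. For a subalgebra $\Lambda\le L$ of finite index there are unique positive integers $\alpha_1,\alpha_2,\alpha_3$ with $\alpha_3\mid\alpha_2\mid\alpha_1$ and $L/\Lambda\cong\mathbb{Z}/\alpha_1\oplus\mathbb{Z}/\alpha_2\oplus\mathbb{Z}/\alpha_3$ as abelian groups; the corank of $\Lambda$ is the largest $i$ with $\alpha_i\neq 1$, and $0$ if $\Lambda=L$. For real $X>1$ let $P_L^{(m)}(X)$ be the number of subalgebras of $L$ of finite index less than $X$ and corank at most $m$, divided by the number of all subalgebras of $L$ of finite index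 less than $X$. Then for each of these $L$ and each $m\in\{1,2\}$ the limit $P_L^{(m)}:=\lim_{X\to\infty}P_L^{(m)}(X)$ exists, and its value rounded to three decimal places (that is, with error less than $0.0005$) is $$\begin{array}{lll} P_{\mathbb{Z}^3}^{(1)}\approx 0.885, & P_{\mathbb{Z}^3}^{(2)}\approx 0.998,\\ P_{H}^{(1)}\approx 0.492, & P_{H}^{(2)}\approx 0.975,\\ P_{\mathrm{sl}_2(\mathbb{Z})}^{(1)}\approx 0.488, & P_{\mathrm{sl}_2(\mathbb{Z})}^{(2)}\approx 0.974,\\ P_{L_1}^{(1)}\approx 0.492, & P_{L_1}^{(2)}\approx 0.975,\\ P_{L_2}^{(1)}\approx 0.482, & P_{L_2}^{(2)}\approx 0.970. \end{array}$$ -/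

import Mathlib

open Filter Topology

namespace CotypeDensity

/-! ### Cotype, corank and the counting functions of a `ℤ`-Lie algebra of rank 3

A subalgebra is a `ℤ`-submodule stable under the bracket, that is, `LieSubalgebra ℤ L`. -/

section Counting

variable {L : Type*} [LieRing L]

/-- The index `|L : Λ|`, i.e. the cardinality of `L / Λ` (and `0` if that is infinite). -/
noncomputable def index (Λ : LieSubalgebra ℤ L) : ℕ :=
  Λ.toSubmodule.toAddSubgroup.index

/-- `α = (α 0, α 1, α 2)` is the cotype of the finite-index subalgebra `Λ` of a Lie algebra of
rank 3: `L / Λ ≅ ℤ/(α 0) ⊕ ℤ/(α 1) ⊕ ℤ/(α 2)` as abelian groups, where all `α i` are positive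
and `α (i + 1)` divides `α i`, i.e. `0 ≠ (α 0) ⊆ (α 1) ⊆ (α 2)` as ideals of `ℤ`. -/
def HasCotype (Λ : LieSubalgebra ℤ L) (α : Fin 3 → ℕ) : Prop :=
  (∀ i, 0 < α i) ∧ α 1 ∣ α 0 ∧ α 2 ∣ α 1 ∧
    Nonempty ((L ⧸ Λ.toSubmodule) ≃+ (∀ i : Fin 3, ZMod (α i)))

/-- The corank of `Λ`: the largest `i ∈ {1, 2, 3}` whose cotype entry (the entry `α (i - 1)`
in the zero-based indexing used here) is not `1`, and `0` if there is no such `i`. -/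
noncomputable def corank (Λ : LieSubalgebra ℤ L) : ℕ :=
  sSup {i : ℕ | ∃ α, HasCotype Λ α ∧ ∃ j : Fin 3, (j : ℕ) + 1 = i ∧ α j ≠ 1}

variable (L)

/-- The number of subalgebras of finite index less than `X` and of corank at most `m`. -/
noncomputable def countCorankLE (m : ℕ) (X : ℝ) : ℕ :=
  {Λ : LieSubalgebra ℤ L | index Λ ≠ 0 ∧ (index Λ : ℝ) < X ∧ corank Λ ≤ m}.ncard

/-- The number of all subalgebras of finite index less than `X`. -/
noncomputable def countAll (X : ℝ) : ℕ :=
  {Λ : LieSubalgebra ℤ L | index Λ ≠ 0 ∧ (index Λ : ℝ) < X}.ncard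

/-- The proportion of subalgebras of corank at most `m` among all subalgebras of finite index
less than `X`. -/
noncomputable def proportion (m : ℕ) (X : ℝ) : ℝ :=
  (countCorankLE L m X : ℝ) / (countAll L X : ℝ)

end Counting

/-- `f X` converges as `X → ∞`, and its limit is equal to `a` when rounded to three decimal
places. -/
def TendstoRounded (f : ℝ → ℝ) (a : ℝ) : Prop :=
  ∃ ℓ : ℝ, Tendsto f atTop (𝓝 ℓ) ∧ |ℓ - a| < 0.0005

/-! ### The five Lie algebras

Each is the module `ℤ³` with standard basis `e₁, e₂, e₃` and the indicated bracket; the values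
on basis vectors are confirmed by the theorems that follow the instances. -/

/-- The abelian Lie algebra `ℤ³`. -/
def Ab : Type := Fin 3 → ℤ

/-- The Heisenberg Lie algebra, `[e₁, e₂] = e₃`. -/
def Heis : Type := Fin 3 → ℤ

/-- The Lie algebra `sl₂(ℤ)`, `[e₁, e₂] = e₃`, `[e₁, e₃] = -2 e₁`, `[e₂, e₃] = 2 e₂`. -/
def Sl2 : Type := Fin 3 → ℤ

/-- The solvable Lie algebra `L₁`, `[e₁, e₂] = e₃`, `[e₁, e₃] = e₂`. -/
def L1 : Type := Fin 3 → ℤ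

/-- The solvable Lie algebra `L₂`, `[e₁, e₂] = e₃`, `[e₁, e₃] = -e₂`. -/
def L2 : Type := Fin 3 → ℤ

instance : AddCommGroup Ab := inferInstanceAs (AddCommGroup (Fin 3 → ℤ))
instance : AddCommGroup Heis := inferInstanceAs (AddCommGroup (Fin 3 → ℤ))
instance : AddCommGroup Sl2 := inferInstanceAs (AddCommGroup (Fin 3 → ℤ))
instance : AddCommGroup L1 := inferInstanceAs (AddCommGroup (Fin 3 → ℤ))
instance : AddCommGroup L2 := inferInstanceAs (AddCommGroup (Fin 3 → ℤ))

/-- The bracket on `ℤ³` with `[e₁, e₂] = e₃`, `[e₁, e₃] = a e₁ + b e₂`, `[e₂, e₃] = c e₂`. -/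
def br (a b c : ℤ) (x y : Fin 3 → ℤ) : Fin 3 → ℤ :=
  ![a * (x 0 * y 2 - x 2 * y 0),
    b * (x 0 * y 2 - x 2 * y 0) + c * (x 1 * y 2 - x 2 * y 1),
    x 0 * y 1 - x 1 * y 0]

theorem br_add_left (a b c : ℤ) (x y z : Fin 3 → ℤ) :
    br a b c (x + y) z = br a b c x z + br a b c y z := by
  ext i; fin_cases i <;> simp [br] <;> ring

theorem br_add_right (a b c : ℤ) (x y z : Fin 3 → ℤ) :
    br a b c x (y + z) = br a b c x y + br a b c x z := by
  ext i; fin_cases i <;> simp [br] <;> ring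

theorem br_self (a b c : ℤ) (x : Fin 3 → ℤ) : br a b c x x = 0 := by
  ext i; fin_cases i <;> simp [br, mul_comm]

theorem br_leibniz (a b c : ℤ) (h : a + c = 0) (x y z : Fin 3 → ℤ) :
    br a b c x (br a b c y z) = br a b c (br a b c x y) z + br a b c y (br a b c x z) := by
  obtain rfl : c = -a := by omega
  ext i; fin_cases i <;> simp [br] <;> ring

instance : LieRing Ab where
  bracket _ _ := 0
  add_lie _ _ _ := (add_zero _).symm
  lie_add _ _ _ := (add_zero _).symm
  lie_self _ := rfl
  leibniz_lie _ _ _ := (add_zero _).symm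

instance : LieRing Heis where
  bracket := br 0 0 0
  add_lie := br_add_left 0 0 0
  lie_add := br_add_right 0 0 0
  lie_self := br_self 0 0 0
  leibniz_lie := br_leibniz 0 0 0 (by norm_num)

instance : LieRing Sl2 where
  bracket := br (-2) 0 2
  add_lie := br_add_left (-2) 0 2
  lie_add := br_add_right (-2) 0 2
  lie_self := br_self (-2) 0 2
  leibniz_lie := br_leibniz (-2) 0 2 (by norm_num)

instance : LieRing L1 where
  bracket := br 0 1 0
  add_lie := br_add_left 0 1 0
  lie_add := br_add_right 0 1 0
  lie_self := br_self 0 1 0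
  leibniz_lie := br_leibniz 0 1 0 (by norm_num)

instance : LieRing L2 where
  bracket := br 0 (-1) 0
  add_lie := br_add_left 0 (-1) 0
  lie_add := br_add_right 0 (-1) 0
  lie_self := br_self 0 (-1) 0
  leibniz_lie := br_leibniz 0 (-1) 0 (by norm_num)

theorem Ab.lie_eq (x y : Ab) : ⁅x, y⁆ = 0 := rfl

theorem Heis.lie_basis (e₁ e₂ e₃ : Heis)
    (h₁ : e₁ = ![1, 0, 0]) (h₂ : e₂ = ![0, 1, 0]) (h₃ : e₃ = ![0, 0, 1]) :
    ⁅e₁, e₂⁆ = e₃ ∧ ⁅e₁, e₃⁆ = 0 ∧ ⁅e₂, e₃⁆ = 0 := by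
  subst h₁ h₂ h₃
  refine ⟨?_, ?_, ?_⟩ <;> change @Eq (Fin 3 → ℤ) _ _ <;> funext i <;> fin_cases i <;> rfl

theorem Sl2.lie_basis (e₁ e₂ e₃ : Sl2)
    (h₁ : e₁ = ![1, 0, 0]) (h₂ : e₂ = ![0, 1, 0]) (h₃ : e₃ = ![0, 0, 1]) :
    ⁅e₁, e₂⁆ = e₃ ∧ ⁅e₁, e₃⁆ = (-2 : ℤ) • e₁ ∧ ⁅e₂, e₃⁆ = (2 : ℤ) • e₂ := by
  subst h₁ h₂ h₃
  refine ⟨?_, ?_, ?_⟩ <;> change @Eq (Fin 3 → ℤ) _ _ <;> funext i <;> fin_cases i <;> rfl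

theorem L1.lie_basis (e₁ e₂ e₃ : L1)
    (h₁ : e₁ = ![1, 0, 0]) (h₂ : e₂ = ![0, 1, 0]) (h₃ : e₃ = ![0, 0, 1]) :
    ⁅e₁, e₂⁆ = e₃ ∧ ⁅e₁, e₃⁆ = e₂ ∧ ⁅e₂, e₃⁆ = 0 := by
  subst h₁ h₂ h₃
  refine ⟨?_, ?_, ?_⟩ <;> change @Eq (Fin 3 → ℤ) _ _ <;> funext i <;> fin_cases i <;> rfl

theorem L2.lie_basis (e₁ e₂ e₃ : L2)
    (h₁ : e₁ = ![1, 0, 0]) (h₂ : e₂ = ![0, 1, 0]) (h₃ : e₃ = ![0, 0, 1]) :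
    ⁅e₁, e₂⁆ = e₃ ∧ ⁅e₁, e₃⁆ = -e₂ ∧ ⁅e₂, e₃⁆ = 0 := by
  subst h₁ h₂ h₃
  refine ⟨?_, ?_, ?_⟩ <;> change @Eq (Fin 3 → ℤ) _ _ <;> funext i <;> fin_cases i <;> rfl

end CotypeDensity

/-! In rank 3 an alternating bracket factors through the cross product: `[x, y] = M (x × y)` for one
integer matrix `M`. Subalgebras of finite index are the sublattices `Λ` of `ℤ³` closed under this
product, and the corank of `Λ` is the largest rank over `𝔽_p` of `ℤ³ / (Λ + p ℤ³)`, taken over all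
primes `p`. A closed sublattice of index `ab` with `a`, `b` coprime splits uniquely as an
intersection of closed ones of index `a` and `b`, so the numbers to be summed are multiplicative in
the index (`closedCount_mul_of_coprime`).

At a prime `p` closed sublattices are sorted by that rank `j`. Rank 1: `Λ` is the kernel of a
primitive linear form `w` modulo `p ^ k`. Cross products of vectors in the kernel are multiples of
`w`, so closedness is the single equation `w · M w = 0` (`rankCount_one`). Rank 2: `N = (Λ : p)` is
again closed, of index smaller by `p ^ 2`, and `Λ` amounts to a line in `N / pN` not inside `p ℤ³`;
every such line is allowed (`rankCount_two`). Rank 3: `Λ = p Λ'` with `Λ'` closed for `p M`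
(`rankCount_three`). Since the rank 1 series of `p M` is affine in that of `M`, all local series are
rational expressions in the rank 1 series of `M`, with coefficients independent of `M`
(`countSeries_two`, `denomSeries_mul_countSeries`). The rank 1 series come from counting zeros
modulo `p ^ k` of `0`, `z²`, `4xy + z²`, `z² - y²` and `z² + y²`.

For the limit, write the rank 1 series as `h p / V p`, where at `p ^ (-r)` (with `r = 3` for `ℤ³`
and `r = 2` otherwise) `h p = 1 + O(p ^ (-2))` and `V p` is the inverse local factor of an explicit
arithmetic function `u`: `n ^ 2`, `n`, or a convolution of `n` with `n`, with `χ₄(n) n`, or with the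
weight `j ^ 3` on squares `j ^ 2`. Each counting function is then `u * g` with `∑ g(n) n ^ (-r)`
absolutely convergent. The summatory function of `u` is asymptotic to `κ N ^ r ℓ(N)` with `ℓ = 1` or
`1 + log N`, by elementary means, and dominated convergence transfers this to `u * g`
(`HasGrowth.mul`). In the quotient `κ N ^ r ℓ(N)` cancels, and the limit is an Euler product of
local densities (`LocalData.tendsto_density`).

Numerically, corank at most 1 has the factor `1 - p ^ (-2)` (or `1 - p ^ (-4)` for `ℤ³`), whose
product is `1 / ζ(2)` (or `1 / ζ(4)`). What remains, and the whole density for corank at most 2, is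
`1 - O(p ^ (-3))`, so finitely many primes and a telescoping tail bound suffice (`density_bounds`).
-/

namespace CotypeDensity

open scoped Matrix

/-! ### Sublattices of `ℤ³` closed under a bracket `(x, y) ↦ M (x × y)` -/

/-- The lattice `ℤ³`. -/
abbrev Vec : Type := Fin 3 → ℤ

/-- `Λ` is closed under the alternating product `(x, y) ↦ M (x × y)`. -/
def IsClosedUnder (M : Matrix (Fin 3) (Fin 3) ℤ) (Λ : AddSubgroup Vec) : Prop :=
  ∀ x ∈ Λ, ∀ y ∈ Λ, M *ᵥ (x ⨯₃ y) ∈ Λ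

/-- The sublattice `n Λ`. -/
def dilate (n : ℕ) (Λ : AddSubgroup Vec) : AddSubgroup Vec :=
  Λ.map (nsmulAddMonoidHom n)

/-- The sublattice of all `v` with `n v ∈ Λ`. -/
def colon (n : ℕ) (Λ : AddSubgroup Vec) : AddSubgroup Vec :=
  Λ.comap (nsmulAddMonoidHom n)

theorem mem_dilate {n : ℕ} {Λ : AddSubgroup Vec} {x : Vec} :
    x ∈ dilate n Λ ↔ ∃ y ∈ Λ, n • y = x := Iff.rfl

theorem mem_dilate_top {n : ℕ} {x : Vec} : x ∈ dilate n ⊤ ↔ ∃ y, n • y = x := by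
  simp [mem_dilate]

theorem nsmul_mem_dilate (n : ℕ) {Λ : AddSubgroup Vec} {x : Vec} (hx : x ∈ Λ) :
    n • x ∈ dilate n Λ := ⟨x, hx, rfl⟩

theorem dilate_mono (n : ℕ) {Λ Λ' : AddSubgroup Vec} (h : Λ ≤ Λ') : dilate n Λ ≤ dilate n Λ' :=
  AddSubgroup.map_mono h

theorem dilate_le (n : ℕ) (Λ : AddSubgroup Vec) : dilate n Λ ≤ Λ := by
  rintro _ ⟨y, hy, rfl⟩
  exact Λ.nsmul_mem hy n

theorem nsmulAddMonoidHom_injective {n : ℕ} (hn : n ≠ 0) :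
    Function.Injective (nsmulAddMonoidHom n : Vec →+ Vec) :=
  fun _ _ h => nsmul_right_injective hn h

theorem dilate_injective {n : ℕ} (hn : n ≠ 0) : Function.Injective (dilate n) :=
  AddSubgroup.map_injective (nsmulAddMonoidHom_injective hn)

theorem dilate_top_eq_pi (n : ℕ) :
    dilate n ⊤ = AddSubgroup.pi Set.univ fun _ => AddSubgroup.zmultiples (n : ℤ) := by
  ext x
  simp only [mem_dilate_top, AddSubgroup.mem_pi, Set.mem_univ, true_imp_iff, Int.mem_zmultiples_iff]
  constructor
  · rintro ⟨y, rfl⟩ i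
    simp
  · intro h
    choose y hy using h
    exact ⟨y, by ext i; simp [hy]⟩

theorem mem_dilate_top_iff {n : ℕ} {x : Vec} : x ∈ dilate n ⊤ ↔ ∀ i, (n : ℤ) ∣ x i := by
  simp [dilate_top_eq_pi, AddSubgroup.mem_pi, Int.mem_zmultiples_iff]

theorem index_dilate_top (n : ℕ) : (dilate n ⊤).index = n ^ 3 := by
  rw [dilate_top_eq_pi, AddSubgroup.index_pi]
  simp

theorem index_dilate {n : ℕ} (hn : n ≠ 0) (Λ : AddSubgroup Vec) :
    (dilate n Λ).index = n ^ 3 * Λ.index := by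
  rw [dilate, AddSubgroup.index_map_of_injective _ (nsmulAddMonoidHom_injective hn),
    AddMonoidHom.range_eq_map, mul_comm]
  congr 1
  exact index_dilate_top n

theorem dilate_top_le_of_index_dvd {Λ : AddSubgroup Vec} {n : ℕ} (h : Λ.index ∣ n) :
    dilate n ⊤ ≤ Λ := by
  rintro _ ⟨y, -, rfl⟩
  obtain ⟨c, rfl⟩ := h
  rw [nsmulAddMonoidHom_apply, mul_comm, mul_nsmul']
  exact Λ.nsmul_mem (Λ.nsmul_index_mem y) c

/-- A sublattice of index `n` contains `n ℤ³`, so it comes from a subgroup of the finite group `ℤ³ /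
n ℤ³`. -/
theorem finite_setOf_index_eq {n : ℕ} (hn : n ≠ 0) : {Λ : AddSubgroup Vec | Λ.index = n}.Finite := by
  have hfin : Finite (Vec ⧸ dilate n ⊤) := by
    rw [← AddSubgroup.index_ne_zero_iff_finite, index_dilate_top]
    positivity
  have : Finite (AddSubgroup (Vec ⧸ dilate n ⊤)) := inferInstance
  refine Set.Finite.subset (Set.finite_range (AddSubgroup.comap (QuotientAddGroup.mk' (dilate n ⊤)))) ?_
  intro Λ (hΛ : Λ.index = n)
  refine ⟨Λ.map (QuotientAddGroup.mk' _), ?_⟩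
  rw [AddSubgroup.comap_map_eq, QuotientAddGroup.ker_mk', sup_eq_left]
  exact dilate_top_le_of_index_dvd hΛ.dvd

/-! ### Splitting sublattices along coprime factors of the index -/

theorem sup_dilate_top_eq_top {Λ : AddSubgroup Vec} {n : ℕ} (h : Nat.Coprime Λ.index n) :
    Λ ⊔ dilate n ⊤ = ⊤ := by
  rw [← AddSubgroup.index_eq_one]
  have h1 := AddSubgroup.index_dvd_of_le (le_sup_left : Λ ≤ Λ ⊔ dilate n ⊤)
  have h2 := AddSubgroup.index_dvd_of_le (le_sup_right : dilate n ⊤ ≤ Λ ⊔ dilate n ⊤)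
  rw [index_dilate_top] at h2
  exact Nat.eq_one_of_dvd_coprimes (h.pow_right 3) h1 h2

/-- The sublattice `n ℤ³` is an ideal for the product: expanding `(x + n u) × (y + n v)`, every term
but `x × y` carries a factor `n`. -/
theorem IsClosedUnder.sup_dilate_top {M : Matrix (Fin 3) (Fin 3) ℤ} {Λ : AddSubgroup Vec}
    (h : IsClosedUnder M Λ) (n : ℕ) : IsClosedUnder M (Λ ⊔ dilate n ⊤) := by
  intro x hx y hy
  obtain ⟨x, hx', _, ⟨u, -, rfl⟩, rfl⟩ := AddSubgroup.mem_sup.1 hx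
  obtain ⟨y, hy', _, ⟨v, -, rfl⟩, rfl⟩ := AddSubgroup.mem_sup.1 hy
  refine AddSubgroup.mem_sup.2 ⟨_, h x hx' y hy', _,
    nsmul_mem_dilate n (AddSubgroup.mem_top (M *ᵥ (x ⨯₃ v + u ⨯₃ y + n • (u ⨯₃ v)))), ?_⟩
  simp only [nsmulAddMonoidHom_apply, map_add, map_nsmul, LinearMap.add_apply,
    LinearMap.smul_apply, Matrix.mulVec_add, Matrix.mulVec_smul, smul_add]
  abel

theorem IsClosedUnder.inf {M : Matrix (Fin 3) (Fin 3) ℤ} {Λ Λ' : AddSubgroup Vec}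
    (h : IsClosedUnder M Λ) (h' : IsClosedUnder M Λ') : IsClosedUnder M (Λ ⊓ Λ') :=
  fun x hx y hy => ⟨h x hx.1 y hy.1, h' x hx.2 y hy.2⟩

/-- The corank of `Λ` is at most `m`, expressed prime by prime. -/
def CorankLE (m : ℕ) (Λ : AddSubgroup Vec) : Prop :=
  ∀ p : ℕ, p.Prime → (Λ ⊔ dilate p ⊤).index ≤ p ^ m

/-- The closed sublattices of index `n` and corank at most `m`. -/
def closedSet (M : Matrix (Fin 3) (Fin 3) ℤ) (m n : ℕ) : Set (AddSubgroup Vec) :=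
  {Λ | Λ.index = n ∧ IsClosedUnder M Λ ∧ CorankLE m Λ}

/-- The number of closed sublattices of index `n` and corank at most `m`. -/
noncomputable def closedCount (M : Matrix (Fin 3) (Fin 3) ℤ) (m n : ℕ) : ℕ :=
  (closedSet M m n).ncard

theorem closedSet_finite (M : Matrix (Fin 3) (Fin 3) ℤ) (m : ℕ) {n : ℕ} (hn : n ≠ 0) :
    (closedSet M m n).Finite :=
  (finite_setOf_index_eq hn).subset fun _ h => h.1

theorem inf_sup_dilate_top {Λ₁ Λ₂ : AddSubgroup Vec} {a b : ℕ} (hab : a.Coprime b)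
    (h₁ : Λ₁.index = a) (h₂ : Λ₂.index = b) : Λ₁ ⊓ Λ₂ ⊔ dilate a ⊤ = Λ₁ := by
  apply le_antisymm
  · exact sup_le inf_le_left (dilate_top_le_of_index_dvd h₁.dvd)
  · intro x hx
    have hz : (b : ℤ) * Nat.gcdB a b + a * Nat.gcdA a b = 1 := by
      have := Nat.gcd_eq_gcd_ab a b
      rw [hab.gcd_eq_one] at this
      push_cast at this
      linarith
    refine AddSubgroup.mem_sup.2 ⟨b • (Nat.gcdB a b • x), ⟨?_, ?_⟩, a • (Nat.gcdA a b • x),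
      nsmul_mem_dilate _ (AddSubgroup.mem_top _), ?_⟩
    · exact Λ₁.nsmul_mem (Λ₁.zsmul_mem hx _) _
    · exact dilate_top_le_of_index_dvd h₂.dvd (nsmul_mem_dilate b (AddSubgroup.mem_top _))
    · rw [← natCast_zsmul, ← natCast_zsmul, ← mul_zsmul', ← mul_zsmul', ← add_zsmul]
      rw [mul_comm _ (b : ℤ), mul_comm _ (a : ℤ), hz, one_zsmul]

theorem index_inf_of_coprime {Λ₁ Λ₂ : AddSubgroup Vec} {a b : ℕ} (hab : a.Coprime b)
    (h₁ : Λ₁.index = a) (h₂ : Λ₂.index = b) (ha : a ≠ 0) (hb : b ≠ 0) :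
    (Λ₁ ⊓ Λ₂).index = a * b := by
  apply le_antisymm
  · rw [← h₁, ← h₂]
    exact AddSubgroup.index_inf_le
  · have h0 : (Λ₁ ⊓ Λ₂).index ≠ 0 :=
      AddSubgroup.index_inf_ne_zero (h₁ ▸ ha) (h₂ ▸ hb)
    refine Nat.le_of_dvd (Nat.pos_of_ne_zero h0) (hab.mul_dvd_of_dvd_of_dvd ?_ ?_)
    · exact h₁ ▸ AddSubgroup.index_dvd_of_le inf_le_left
    · exact h₂ ▸ AddSubgroup.index_dvd_of_le inf_le_right

/-- Because `ab ℤ³ ≤ Λ`, a vector in `Λ + a ℤ³` is sent into `Λ` by `b`, and one in `Λ + b ℤ³` by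
`a`; a Bézout relation recovers the vector itself. -/
theorem sup_inf_sup_dilate_top {Λ : AddSubgroup Vec} {a b : ℕ} (hab : a.Coprime b)
    (h : Λ.index = a * b) : (Λ ⊔ dilate a ⊤) ⊓ (Λ ⊔ dilate b ⊤) = Λ := by
  apply le_antisymm
  · rintro x ⟨h1, h2⟩
    have key : ∀ c d : ℕ, Λ.index = c * d → x ∈ Λ ⊔ dilate c ⊤ → d • x ∈ Λ := by
      intro c d hcd hx
      obtain ⟨y, hy, _, ⟨u, -, rfl⟩, rfl⟩ := AddSubgroup.mem_sup.1 hx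
      rw [smul_add]
      refine Λ.add_mem (Λ.nsmul_mem hy _) (dilate_top_le_of_index_dvd hcd.dvd ?_)
      rw [nsmulAddMonoidHom_apply, ← mul_nsmul]
      exact nsmul_mem_dilate _ (AddSubgroup.mem_top _)
    have hb := key a b h h1
    have ha := key b a (by rw [h, mul_comm]) h2
    have hz : (a : ℤ) * Nat.gcdA a b + b * Nat.gcdB a b = 1 := by
      have := Nat.gcd_eq_gcd_ab a b
      rw [hab.gcd_eq_one] at this
      push_cast at this
      linarith
    have : x = Nat.gcdA a b • (a • x) + Nat.gcdB a b • (b • x) := by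
      rw [← natCast_zsmul, ← natCast_zsmul, ← mul_zsmul', ← mul_zsmul', ← add_zsmul, hz, one_zsmul]
    rw [this]
    exact Λ.add_mem (Λ.zsmul_mem ha _) (Λ.zsmul_mem hb _)
  · exact le_inf le_sup_left le_sup_left

/-- The two indices divide `a` and `b` respectively, and by the intersection formula their product
is `ab`, so both divisibilities are equalities. -/
theorem index_sup_dilate_top {Λ : AddSubgroup Vec} {a b : ℕ} (hab : a.Coprime b)
    (h : Λ.index = a * b) (ha : a ≠ 0) (hb : b ≠ 0) : (Λ ⊔ dilate a ⊤).index = a := by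
  have key : ∀ c d : ℕ, c.Coprime d → Λ.index = c * d → (Λ ⊔ dilate c ⊤).index ∣ c := by
    intro c d hcd h
    have h1 := AddSubgroup.index_dvd_of_le (le_sup_left : Λ ≤ Λ ⊔ dilate c ⊤)
    have h2 := AddSubgroup.index_dvd_of_le (le_sup_right : dilate c ⊤ ≤ Λ ⊔ dilate c ⊤)
    rw [index_dilate_top] at h2
    rw [h] at h1
    exact (Nat.Coprime.coprime_dvd_left h2 (hcd.pow_left 3)).dvd_of_dvd_mul_right h1
  have k1 := key a b hab h
  have k2 := key b a hab.symm (by rw [h, mul_comm])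
  have := index_inf_of_coprime (Λ₁ := Λ ⊔ dilate a ⊤) (Λ₂ := Λ ⊔ dilate b ⊤)
    ((hab.coprime_dvd_left k1).coprime_dvd_right k2) rfl rfl (ne_zero_of_dvd_ne_zero ha k1)
    (ne_zero_of_dvd_ne_zero hb k2)
  rw [sup_inf_sup_dilate_top hab h, h] at this
  have l1 := Nat.le_of_dvd (Nat.pos_of_ne_zero ha) k1
  have l2 := Nat.le_of_dvd (Nat.pos_of_ne_zero hb) k2
  by_contra hne
  have := Nat.mul_lt_mul_of_lt_of_le (lt_of_le_of_ne l1 hne) l2 (Nat.pos_of_ne_zero hb)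
  omega

/-- As `b` is invertible modulo `p` and `ab ℤ³ ≤ Λ`, adding `a ℤ³` to `Λ` has no effect modulo `p`.
Thus the rank at `p` is seen by the part of `Λ` whose index is divisible by `p`. -/
theorem sup_dilate_prime_eq {Λ : AddSubgroup Vec} {a b p : ℕ} (hp : p.Prime)
    (h : Λ.index = a * b) (hpb : ¬ p ∣ b) :
    Λ ⊔ dilate a ⊤ ⊔ dilate p ⊤ = Λ ⊔ dilate p ⊤ := by
  refine le_antisymm (sup_le (sup_le le_sup_left ?_) le_sup_right) (sup_le_sup_right le_sup_left _)
  rintro _ ⟨u, -, rfl⟩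
  have hcop : b.Coprime p := ((Nat.Prime.coprime_iff_not_dvd hp).2 hpb).symm
  have hz : (b : ℤ) * Nat.gcdA b p + p * Nat.gcdB b p = 1 := by
    have := Nat.gcd_eq_gcd_ab b p
    rw [hcop.gcd_eq_one] at this
    push_cast at this
    linarith
  refine AddSubgroup.mem_sup.2 ⟨(a * b) • (Nat.gcdA b p • u), dilate_top_le_of_index_dvd h.dvd
    (nsmul_mem_dilate _ (AddSubgroup.mem_top _)), p • (a • Nat.gcdB b p • u),
    nsmul_mem_dilate _ (AddSubgroup.mem_top _), ?_⟩
  ext i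
  simp only [nsmulAddMonoidHom_apply, Pi.add_apply, Pi.smul_apply, smul_eq_mul, nsmul_eq_mul,
    Pi.mul_apply, Pi.natCast_apply]
  push_cast
  linear_combination ((a : ℤ) * u i) * hz

theorem corankLE_iff_of_coprime {Λ : AddSubgroup Vec} {a b : ℕ} (hab : a.Coprime b)
    (h : Λ.index = a * b) (ha : a ≠ 0) (hb : b ≠ 0) (m : ℕ) :
    CorankLE m Λ ↔ CorankLE m (Λ ⊔ dilate a ⊤) ∧ CorankLE m (Λ ⊔ dilate b ⊤) := by
  have h' : Λ.index = b * a := by rw [h, mul_comm]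
  have key : ∀ c d : ℕ, c.Coprime d → Λ.index = c * d → c ≠ 0 → d ≠ 0 → ∀ p : ℕ, p.Prime →
      ¬ p ∣ c → (Λ ⊔ dilate c ⊤ ⊔ dilate p ⊤).index = 1 := by
    intro c d hcd h hc hd p hp hpc
    rw [AddSubgroup.index_eq_one]
    apply sup_dilate_top_eq_top
    rw [index_sup_dilate_top hcd h hc hd]
    exact ((Nat.Prime.coprime_iff_not_dvd hp).2 hpc).symm
  constructor
  · intro H
    have aux : ∀ c d : ℕ, c.Coprime d → Λ.index = c * d → c ≠ 0 → d ≠ 0 →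
        CorankLE m (Λ ⊔ dilate c ⊤) := by
      intro c d hcd h hc hd p hp
      by_cases hpc : p ∣ c
      · rw [sup_dilate_prime_eq hp h]
        · exact H p hp
        · intro hpd
          exact hp.one_lt.ne' (Nat.eq_one_of_dvd_coprimes hcd hpc hpd)
      · rw [key c d hcd h hc hd p hp hpc]
        exact Nat.one_le_pow _ _ hp.pos
    exact ⟨aux a b hab h ha hb, aux b a hab.symm h' hb ha⟩
  · rintro ⟨H1, H2⟩ p hp
    by_cases hpb : p ∣ b
    · rw [← sup_dilate_prime_eq hp h']
      · exact H2 p hp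
      · intro hpa
        exact hp.one_lt.ne' (Nat.eq_one_of_dvd_coprimes hab hpa hpb)
    · rw [← sup_dilate_prime_eq hp h hpb]
      exact H1 p hp

/-- The bijection is `Λ ↦ (Λ + a ℤ³, Λ + b ℤ³)` with inverse the intersection; closedness and the
corank bound pass in both directions. -/
theorem closedCount_mul_of_coprime (M : Matrix (Fin 3) (Fin 3) ℤ) (m : ℕ) {a b : ℕ}
    (hab : a.Coprime b) (ha : a ≠ 0) (hb : b ≠ 0) :
    closedCount M m (a * b) = closedCount M m a * closedCount M m b := by
  rw [closedCount, closedCount, closedCount, ← Set.ncard_prod]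
  refine Set.ncard_congr (fun Λ _ => (Λ ⊔ dilate a ⊤, Λ ⊔ dilate b ⊤)) ?_ ?_ ?_
  · rintro Λ ⟨h1, h2, h3⟩
    have h1' : Λ.index = b * a := by rw [h1, mul_comm]
    rw [corankLE_iff_of_coprime hab h1 ha hb] at h3
    exact ⟨⟨index_sup_dilate_top hab h1 ha hb, h2.sup_dilate_top a, h3.1⟩,
      ⟨index_sup_dilate_top hab.symm h1' hb ha, h2.sup_dilate_top b, h3.2⟩⟩
  · rintro Λ Λ' ⟨h1, -⟩ ⟨h1', -⟩ h
    rw [Prod.mk.injEq] at h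
    rw [← sup_inf_sup_dilate_top hab h1, ← sup_inf_sup_dilate_top hab h1', h.1, h.2]
  · rintro ⟨Λ₁, Λ₂⟩ ⟨⟨h1, h2, h3⟩, ⟨h1', h2', h3'⟩⟩
    have e1 := inf_sup_dilate_top hab h1 h1'
    have e2 : Λ₁ ⊓ Λ₂ ⊔ dilate b ⊤ = Λ₂ := by
      rw [inf_comm]; exact inf_sup_dilate_top hab.symm h1' h1
    refine ⟨Λ₁ ⊓ Λ₂, ⟨index_inf_of_coprime hab h1 h1' ha hb, h2.inf h2', ?_⟩, ?_⟩
    · rw [corankLE_iff_of_coprime hab (index_inf_of_coprime hab h1 h1' ha hb) ha hb, e1, e2]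
      exact ⟨h3, h3'⟩
    · rw [e1, e2]

end CotypeDensity

namespace CotypeDensity

open scoped Matrix

/-! ### Sublattices of prime power index -/

theorem ncard_eq_mul_of_ncard_fiber {α β : Type*} {S : Set α} {T : Set β} (f : α → β) {c : ℕ}
    (hS : S.Finite) (hT : T.Finite) (hf : ∀ s ∈ S, f s ∈ T)
    (hc : ∀ t ∈ T, {s ∈ S | f s = t}.ncard = c) : S.ncard = T.ncard * c := by
  classical
  rw [Set.ncard_eq_toFinset_card S hS, Set.ncard_eq_toFinset_card T hT,
    Finset.card_eq_sum_card_fiberwise (f := f) (t := hT.toFinset) (by simpa [Set.MapsTo] using hf),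
    Finset.sum_const_nat]
  intro t ht
  rw [← hc t (by simpa using ht), ← Set.ncard_coe_finset]
  congr 1
  ext s
  simp

/-- Counting subgroups of prime order in an elementary abelian group that avoid a subgroup. -/
theorem ncard_prime_order_subgroups {Q : Type*} [AddCommGroup Q] [Finite Q] {p : ℕ}
    (hp : p.Prime) {K N : AddSubgroup Q} (hKN : K ≤ N) (hN : ∀ x ∈ N, p • x = 0) :
    {Λ : AddSubgroup Q | Λ ≤ N ∧ Nat.card Λ = p ∧ ¬ Λ ≤ K}.ncard * (p - 1) + Nat.card K =
      Nat.card N := by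
  have hcard : ∀ H : AddSubgroup Q, Nat.card H = (H : Set Q).ncard := fun H => rfl
  have hord : ∀ x : Q, p • x = 0 → x ≠ 0 → Nat.card (AddSubgroup.zmultiples x) = p := by
    intro x hx hx0
    rw [Nat.card_zmultiples]
    have : Fact p.Prime := ⟨hp⟩
    exact addOrderOf_eq_prime hx hx0
  have hgen : ∀ Λ : AddSubgroup Q, Nat.card Λ = p → ∀ x ∈ Λ, x ≠ 0 →
      AddSubgroup.zmultiples x = Λ := by
    intro Λ hΛ x hx hx0
    have hle : AddSubgroup.zmultiples x ≤ Λ := by simpa using hx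
    apply AddSubgroup.eq_of_le_of_card_ge hle
    rw [hΛ, hord x ?_ hx0]
    have := card_nsmul_eq_zero' (x := (⟨x, hx⟩ : Λ))
    rw [hΛ] at this
    simpa [Subtype.ext_iff] using this
  rw [hcard K, hcard N, ← Set.ncard_sdiff_add_ncard_of_subset (s := (K : Set Q)) (t := N) hKN]
  congr 1
  symm
  -- Elements of `N ∖ K` are sorted by the subgroup they generate. It has order `p` and meets `K`
  -- only in `0`, so all its `p - 1` nonzero elements lie in the same fibre.
  refine ncard_eq_mul_of_ncard_fiber AddSubgroup.zmultiples (Set.toFinite _) (Set.toFinite _) ?_ ?_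
  · rintro x ⟨hxN, hxK⟩
    have hx0 : x ≠ 0 := by rintro rfl; exact hxK K.zero_mem
    refine ⟨by simpa using hxN, hord x (hN x hxN) hx0, ?_⟩
    simpa using hxK
  · rintro Λ ⟨hΛN, hΛp, hΛK⟩
    have : {s ∈ (N : Set Q) \ K | AddSubgroup.zmultiples s = Λ} = (Λ : Set Q) \ {0} := by
      ext x
      constructor
      · rintro ⟨⟨hxN, hxK⟩, rfl⟩
        refine ⟨AddSubgroup.mem_zmultiples x, ?_⟩
        rintro rfl
        exact hxK K.zero_mem
      · rintro ⟨hxΛ, hx0⟩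
        have hz := hgen Λ hΛp x hxΛ hx0
        refine ⟨⟨hΛN hxΛ, fun hxK => hΛK ?_⟩, hz⟩
        rw [← hz]
        simpa using hxK
    rw [this, Set.ncard_sdiff_singleton_of_mem (by simp), ← hcard, hΛp]

/-- The closed sublattices `Λ` of index `p ^ k` with `ℤ³ / (Λ + p ℤ³)` of order `p ^ j`. -/
def rankSet (M : Matrix (Fin 3) (Fin 3) ℤ) (p j k : ℕ) : Set (AddSubgroup Vec) :=
  {Λ | Λ.index = p ^ k ∧ IsClosedUnder M Λ ∧ (Λ ⊔ dilate p ⊤).index = p ^ j}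

/-- The number of elements of `rankSet M p j k`. -/
noncomputable def rankCount (M : Matrix (Fin 3) (Fin 3) ℤ) (p j k : ℕ) : ℕ :=
  (rankSet M p j k).ncard

variable {M : Matrix (Fin 3) (Fin 3) ℤ} {p : ℕ}

theorem rankSet_finite (hp : p.Prime) (j k : ℕ) : (rankSet M p j k).Finite :=
  (finite_setOf_index_eq (pow_ne_zero k hp.ne_zero)).subset fun _ h => h.1

theorem exists_index_sup_dilate (hp : p.Prime) (Λ : AddSubgroup Vec) :
    ∃ j ≤ 3, (Λ ⊔ dilate p ⊤).index = p ^ j := by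
  have := AddSubgroup.index_dvd_of_le (le_sup_right : dilate p ⊤ ≤ Λ ⊔ dilate p ⊤)
  rw [index_dilate_top] at this
  exact (Nat.dvd_prime_pow hp).1 this

theorem corankLE_iff_of_index_eq_prime_pow (hp : p.Prime) {Λ : AddSubgroup Vec} {k : ℕ}
    (h : Λ.index = p ^ k) (m : ℕ) : CorankLE m Λ ↔ (Λ ⊔ dilate p ⊤).index ≤ p ^ m := by
  refine ⟨fun H => H p hp, fun H q hq => ?_⟩
  by_cases hqp : q = p
  · exact hqp ▸ H
  · rw [sup_dilate_top_eq_top, AddSubgroup.index_top]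
    · exact Nat.one_le_pow _ _ hq.pos
    · rw [h]
      exact Nat.Coprime.pow_left k ((Nat.coprime_primes hp hq).2 (Ne.symm hqp))

theorem closedCount_prime_pow (hp : p.Prime) (m k : ℕ) :
    closedCount M m (p ^ k) = ∑ j ∈ Finset.range (m + 1), rankCount M p j k := by
  classical
  have hset : closedSet M m (p ^ k) = ⋃ j ∈ Finset.range (m + 1), rankSet M p j k := by
    ext Λ
    simp only [Set.mem_iUnion, Finset.mem_range, exists_prop]
    constructor
    · rintro ⟨h1, h2, h3⟩
      rw [corankLE_iff_of_index_eq_prime_pow hp h1] at h3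
      obtain ⟨j, -, hj⟩ := exists_index_sup_dilate hp Λ
      refine ⟨j, ?_, h1, h2, hj⟩
      rw [hj] at h3
      exact Nat.lt_succ_of_le ((Nat.pow_le_pow_iff_right hp.one_lt).1 h3)
    · rintro ⟨j, hj, h1, h2, h3⟩
      refine ⟨h1, h2, ?_⟩
      rw [corankLE_iff_of_index_eq_prime_pow hp h1, h3]
      exact Nat.pow_le_pow_right hp.pos (Nat.le_of_lt_succ hj)
  have hdisj : ∀ i j, i ≠ j → Disjoint (rankSet M p i k) (rankSet M p j k) := by
    intro i j hij
    refine Set.disjoint_left.2 fun Λ h h' => hij ?_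
    exact Nat.pow_right_injective hp.two_le (h.2.2.symm.trans h'.2.2)
  have hcoe : (⋃ j ∈ Finset.range (m + 1), rankSet M p j k) =
      ((Finset.range (m + 1)).biUnion fun j => (rankSet_finite (M := M) hp j k).toFinset :
        Finset (AddSubgroup Vec)) := by
    ext Λ
    simp
  rw [closedCount, hset, hcoe, Set.ncard_coe_finset, Finset.card_biUnion]
  · exact Finset.sum_congr rfl fun j _ => (Set.ncard_eq_toFinset_card _ _).symm
  · intro i _ j _ hij
    rw [Function.onFun, Set.Finite.disjoint_toFinset]
    exact hdisj i j hij

/-- Nakayama's lemma by hand: substituting `Λ + p ℤ³ = ℤ³` into itself gives `Λ + p ^ n ℤ³ = ℤ³` for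
all `n`, while `p ^ k ℤ³ ≤ Λ`. -/
theorem eq_top_of_sup_dilate_eq_top {Λ : AddSubgroup Vec} {k : ℕ}
    (h : Λ.index = p ^ k) (h' : Λ ⊔ dilate p ⊤ = ⊤) : Λ = ⊤ := by
  have key : ∀ n : ℕ, Λ ⊔ dilate (p ^ n) ⊤ = ⊤ := by
    intro n
    induction n with
    | zero =>
      rw [eq_top_iff]
      intro x _
      exact AddSubgroup.mem_sup_right (mem_dilate_top.2 ⟨x, by simp⟩)
    | succ n ih =>
      rw [eq_top_iff]
      intro x hx
      rw [← ih] at hx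
      obtain ⟨y, hy, _, ⟨u, -, rfl⟩, rfl⟩ := AddSubgroup.mem_sup.1 hx
      have hu : u ∈ Λ ⊔ dilate p ⊤ := by rw [h']; exact AddSubgroup.mem_top u
      obtain ⟨z, hz, _, ⟨w, -, rfl⟩, rfl⟩ := AddSubgroup.mem_sup.1 hu
      refine AddSubgroup.mem_sup.2 ⟨y + p ^ n • z, Λ.add_mem hy (Λ.nsmul_mem hz _), p ^ (n + 1) • w,
        nsmul_mem_dilate _ (AddSubgroup.mem_top _), ?_⟩
      simp only [nsmulAddMonoidHom_apply, smul_add, smul_smul, pow_succ]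
      abel
  rw [← key k, eq_comm, sup_eq_left]
  exact dilate_top_le_of_index_dvd h.dvd

theorem rankSet_zero_left (hp : p.Prime) {k : ℕ} (hk : k ≠ 0) : rankSet M p 0 k = ∅ := by
  ext Λ
  simp only [Set.mem_empty_iff_false, iff_false]
  rintro ⟨h1, -, h3⟩
  rw [pow_zero, AddSubgroup.index_eq_one] at h3
  rw [eq_top_of_sup_dilate_eq_top h1 h3, AddSubgroup.index_top] at h1
  exact hk (Nat.pow_right_injective hp.two_le (by simpa using h1.symm))

theorem rankSet_eq_empty_of_lt (hp : p.Prime) {j k : ℕ} (hk : k < j) : rankSet M p j k = ∅ := by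
  ext Λ
  simp only [Set.mem_empty_iff_false, iff_false]
  rintro ⟨h1, -, h3⟩
  have := AddSubgroup.index_dvd_of_le (le_sup_left : Λ ≤ Λ ⊔ dilate p ⊤)
  rw [h1, h3, Nat.pow_dvd_pow_iff_le_right hp.one_lt] at this
  omega

theorem isClosedUnder_top : IsClosedUnder M ⊤ := fun _ _ _ _ => AddSubgroup.mem_top _

theorem rankCount_zero_zero : rankCount M p 0 0 = 1 := by
  rw [rankCount, Set.ncard_eq_one]
  refine ⟨⊤, ?_⟩
  ext Λ
  simp only [rankSet, pow_zero, AddSubgroup.index_eq_one, Set.mem_ofPred_eq, Set.mem_singleton_iff]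
  refine ⟨fun h => h.1, ?_⟩
  rintro rfl
  exact ⟨rfl, isClosedUnder_top, top_sup_eq _⟩

theorem rankCount_zero_left (hp : p.Prime) {k : ℕ} (hk : k ≠ 0) : rankCount M p 0 k = 0 := by
  rw [rankCount, rankSet_zero_left hp hk, Set.ncard_empty]

theorem rankCount_eq_zero_of_lt (hp : p.Prime) {j k : ℕ} (hk : k < j) : rankCount M p j k = 0 := by
  rw [rankCount, rankSet_eq_empty_of_lt hp hk, Set.ncard_empty]

/-! ### Dilated sublattices and rank three -/

/-- The product is quadratic, so scaling both arguments by `n` yields `n ^ 2`; one factor scales the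
value and the other is absorbed into `M`. -/
theorem isClosedUnder_dilate {n : ℕ} (hn : n ≠ 0) {Λ : AddSubgroup Vec} :
    IsClosedUnder M (dilate n Λ) ↔ IsClosedUnder (n • M) Λ := by
  have key : ∀ x y : Vec, M *ᵥ ((n • x) ⨯₃ (n • y)) = n • ((n • M) *ᵥ (x ⨯₃ y)) := by
    intro x y
    simp only [map_nsmul, LinearMap.smul_apply, Matrix.mulVec_smul, Matrix.smul_mulVec]
  constructor
  · intro h x hx y hy
    have := h _ (nsmul_mem_dilate n hx) _ (nsmul_mem_dilate n hy)
    rw [key] at this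
    obtain ⟨z, hz, hzz⟩ := this
    exact nsmulAddMonoidHom_injective hn hzz ▸ hz
  · rintro h _ ⟨x, hx, rfl⟩ _ ⟨y, hy, rfl⟩
    rw [nsmulAddMonoidHom_apply, nsmulAddMonoidHom_apply, key]
    exact nsmul_mem_dilate n (h x hx y hy)

theorem index_inf_mul_index_sup (Λ Λ' : AddSubgroup Vec) :
    (Λ ⊓ Λ').index * (Λ ⊔ Λ').index = Λ.index * Λ'.index := by
  rw [← AddSubgroup.relIndex_mul_index (inf_le_left : Λ ⊓ Λ' ≤ Λ), AddSubgroup.inf_relIndex_left,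
    ← AddSubgroup.relIndex_mul_index (le_sup_right : Λ' ≤ Λ ⊔ Λ'), sup_comm,
    AddSubgroup.relIndex_sup_left]
  ring

theorem le_dilate_top_iff (hp : p.Prime) {Λ : AddSubgroup Vec} :
    Λ ≤ dilate p ⊤ ↔ (Λ ⊔ dilate p ⊤).index = p ^ 3 := by
  constructor
  · intro h
    rw [sup_eq_right.2 h, index_dilate_top]
  · intro h
    have := AddSubgroup.relIndex_mul_index (le_sup_right : dilate p ⊤ ≤ Λ ⊔ dilate p ⊤)
    rw [h, index_dilate_top] at this
    have h1 := Nat.eq_of_mul_eq_mul_right (pow_pos hp.pos 3) (this.trans (one_mul _).symm)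
    exact le_sup_left.trans (AddSubgroup.relIndex_eq_one.1 h1)

/-- Rank three means `Λ ≤ p ℤ³`, hence `Λ = p Λ'`; the index drops by `p ^ 3` and `M` becomes `p M`.
The bound `3` on the corank of `Λ'` is no restriction. -/
theorem rankCount_three (hp : p.Prime) (k : ℕ) :
    rankCount M p 3 (k + 3) = closedCount (p • M) 3 (p ^ k) := by
  symm
  refine Set.ncard_congr (fun Λ _ => dilate p Λ) ?_ ?_ ?_
  · rintro Λ ⟨h1, h2, -⟩
    refine ⟨by rw [index_dilate hp.ne_zero, h1]; ring, (isClosedUnder_dilate hp.ne_zero).2 h2, ?_⟩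
    rw [← le_dilate_top_iff hp]
    exact dilate_mono p le_top
  · intro Λ Λ' _ _ h
    exact dilate_injective hp.ne_zero h
  · rintro Λ ⟨h1, h2, h3⟩
    rw [← le_dilate_top_iff hp] at h3
    have : dilate p (colon p Λ) = Λ := by
      ext x
      constructor
      · rintro ⟨y, hy, rfl⟩
        exact hy
      · intro hx
        obtain ⟨y, -, rfl⟩ := h3 hx
        exact ⟨y, hx, rfl⟩
    refine ⟨colon p Λ, ⟨?_, ?_, ?_⟩, this⟩
    · rw [← this, index_dilate hp.ne_zero, pow_add, mul_comm] at h1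
      exact Nat.eq_of_mul_eq_mul_right (pow_pos hp.pos 3) h1
    · rw [← this] at h2
      exact (isClosedUnder_dilate hp.ne_zero).1 h2
    · intro q hq
      obtain ⟨j, hj, h⟩ := exists_index_sup_dilate hq (colon p Λ)
      rw [h]
      exact Nat.pow_le_pow_right hq.pos hj

theorem dilate_colon (n : ℕ) (Λ : AddSubgroup Vec) : dilate n (colon n Λ) = Λ ⊓ dilate n ⊤ := by
  ext x
  constructor
  · rintro ⟨y, hy, rfl⟩
    exact ⟨hy, nsmul_mem_dilate n (AddSubgroup.mem_top y)⟩
  · rintro ⟨hx, ⟨y, -, rfl⟩⟩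
    exact ⟨y, hx, rfl⟩

/-- If `v` has a coordinate prime to the index, closedness need only be tested against `v`. -/
theorem isClosedUnder_of_forall_cross (hp : p.Prime) {N : AddSubgroup Vec} {k : ℕ}
    (hN : N.index = p ^ k) {v : Vec} (hv : v ∈ N) (hvp : v ∉ dilate p ⊤)
    (h : ∀ x ∈ N, M *ᵥ (x ⨯₃ v) ∈ N) : IsClosedUnder M N := by
  intro x hx y hy
  rw [mem_dilate_top_iff, not_forall] at hvp
  obtain ⟨i, hi⟩ := hvp
  -- Cramer's rule: any `z` times the determinant of `v`, `x`, `y` is an integral combination of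
  -- these three vectors, all in `N`.
  have hdet : ∀ z : Vec, (v ⬝ᵥ x ⨯₃ y) • z ∈ N := by
    intro z
    have : (v ⬝ᵥ x ⨯₃ y) • z = (z ⬝ᵥ y ⨯₃ v) • x - (z ⬝ᵥ x ⨯₃ v) • y + (z ⬝ᵥ x ⨯₃ y) • v := by
      ext i
      simp only [cross_apply, dotProduct, Fin.sum_univ_three, Pi.add_apply, Pi.sub_apply,
        Pi.smul_apply, smul_eq_mul, Matrix.cons_val]
      fin_cases i <;> simp only [Fin.zero_eta, Fin.mk_one, Fin.reduceFinMk] <;> ring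
    rw [this]
    exact N.add_mem (N.sub_mem (N.zsmul_mem hx _) (N.zsmul_mem hy _)) (N.zsmul_mem hv _)
  -- This expands `det(v, x, y) eᵢ` in the three cross products and solves for the one without `v`,
  -- at the price of the factor `v i`.
  have hmul : v i • (M *ᵥ (x ⨯₃ y)) ∈ N := by
    have : v i • (M *ᵥ (x ⨯₃ y)) = (v ⬝ᵥ x ⨯₃ y) • (M *ᵥ Pi.single i 1) -
        x i • (M *ᵥ (y ⨯₃ v)) + y i • (M *ᵥ (x ⨯₃ v)) := by
      rw [← Matrix.mulVec_smul, ← Matrix.mulVec_smul, ← Matrix.mulVec_smul, ← Matrix.mulVec_smul,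
        ← Matrix.mulVec_sub, ← Matrix.mulVec_add]
      congr 1
      ext j
      simp only [cross_apply, dotProduct, Fin.sum_univ_three, Pi.add_apply, Pi.sub_apply,
        Pi.smul_apply, smul_eq_mul, Matrix.cons_val]
      fin_cases i <;> fin_cases j <;> simp [-zsmul_eq_mul] <;> ring
    rw [this]
    exact N.add_mem (N.sub_mem (hdet _) (N.zsmul_mem (h y hy) _)) (N.zsmul_mem (h x hx) _)
  have hpk : (p ^ k : ℕ) • (M *ᵥ (x ⨯₃ y)) ∈ N :=
    dilate_top_le_of_index_dvd hN.dvd (nsmul_mem_dilate _ (AddSubgroup.mem_top _))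
  -- The factor `v i` is prime to `p` and `p ^ k` kills `ℤ³ / N`, so `v i` can be divided out.
  have hcop : IsCoprime (v i) ((p ^ k : ℕ) : ℤ) := by
    push_cast
    refine IsCoprime.pow_right ?_
    rw [isCoprime_comm]
    exact (Nat.prime_iff_prime_int.1 hp).coprime_iff_not_dvd.2 hi
  obtain ⟨a, b, hab⟩ := hcop
  have : M *ᵥ (x ⨯₃ y) = a • (v i • (M *ᵥ (x ⨯₃ y))) + b • ((p ^ k : ℕ) • (M *ᵥ (x ⨯₃ y))) := by
    rw [← natCast_zsmul, smul_smul, smul_smul, ← add_smul, hab, one_smul]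
  rw [this]
  exact N.add_mem (N.zsmul_mem hmul _) (N.zsmul_mem hpk _)

end CotypeDensity

namespace CotypeDensity

open scoped Matrix

variable {M : Matrix (Fin 3) (Fin 3) ℤ} {p : ℕ}

/-! ### Sublattices of corank two -/

theorem le_colon (n : ℕ) (Λ : AddSubgroup Vec) : Λ ≤ colon n Λ := fun _ hx => Λ.nsmul_mem hx n

/-- The index follows from `p (Λ : p) = Λ ∩ p ℤ³`. For closedness, rank two supplies `v ∈ Λ` outside
`p ℤ³`; if `p x ∈ Λ` then `M (p x × v) = p M (x × v)` is in `Λ`, so multiplication by `v` preserves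
`(Λ : p)`, and testing against this `v` is enough. -/
theorem colon_props (hp : p.Prime) {Λ : AddSubgroup Vec} {k : ℕ} (h : Λ ∈ rankSet M p 2 (k + 2)) :
    (colon p Λ).index = p ^ k ∧ IsClosedUnder M (colon p Λ) ∧
      ∃ j ≤ 2, (colon p Λ ⊔ dilate p ⊤).index = p ^ j := by
  obtain ⟨h1, h2, h3⟩ := h
  have hidx : (colon p Λ).index = p ^ k := by
    have := index_inf_mul_index_sup Λ (dilate p ⊤)
    rw [h3, h1, index_dilate_top, ← dilate_colon, index_dilate hp.ne_zero] at this
    have hpos : 0 < p ^ 5 := pow_pos hp.pos 5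
    refine Nat.eq_of_mul_eq_mul_left hpos ?_
    calc p ^ 5 * (colon p Λ).index = p ^ 3 * (colon p Λ).index * p ^ 2 := by ring
      _ = p ^ 5 * p ^ k := by rw [this]; ring
  have hv : ∃ v ∈ Λ, v ∉ dilate p ⊤ := by
    by_contra! hcon
    have : Λ ≤ dilate p ⊤ := hcon
    rw [le_dilate_top_iff hp, h3] at this
    exact absurd (Nat.pow_right_injective hp.two_le this) (by norm_num)
  obtain ⟨v, hvΛ, hvp⟩ := hv
  refine ⟨hidx, ?_, ?_⟩
  · refine isClosedUnder_of_forall_cross hp hidx (le_colon p Λ hvΛ) hvp fun x hx => ?_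
    have := h2 _ hx v hvΛ
    rwa [nsmulAddMonoidHom_apply, map_nsmul, LinearMap.smul_apply, Matrix.mulVec_smul] at this
  · have := AddSubgroup.index_dvd_of_le (sup_le_sup_right (le_colon p Λ) (dilate p ⊤))
    rw [h3] at this
    exact (Nat.dvd_prime_pow hp).1 this

/-- Here `Λ / pN` has order `p` and is generated by some `v` outside `p ℤ³`. Since `v × v = 0`, each
term in the product of two elements of `pN + ℤ v` has a factor `p` in front of a product of elements
of `N`, so it lies in `pN`: closedness of `N` alone makes every such `Λ` closed. -/
theorem mem_rankSet_two_iff (hp : p.Prime) {N : AddSubgroup Vec} {k : ℕ} (hN : N.index = p ^ k)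
    (hNM : IsClosedUnder M N) (Λ : AddSubgroup Vec) :
    (Λ ∈ rankSet M p 2 (k + 2) ∧ colon p Λ = N) ↔
      (dilate p N ≤ Λ ∧ Λ ≤ N ∧ Λ.index = p ^ (k + 2) ∧ ¬ Λ ≤ dilate p ⊤) := by
  constructor
  · rintro ⟨h, rfl⟩
    refine ⟨?_, le_colon p Λ, h.1, ?_⟩
    · rw [dilate_colon]; exact inf_le_left
    · rw [le_dilate_top_iff hp, h.2.2]
      intro h'
      exact absurd (Nat.pow_right_injective hp.two_le h') (by norm_num)
  · rintro ⟨h1, h2, h3, h4⟩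
    have hdN : (dilate p N).index = p ^ (k + 3) := by rw [index_dilate hp.ne_zero, hN]; ring
    have hrel : (dilate p N).relIndex Λ = p := by
      have := AddSubgroup.relIndex_mul_index h1
      rw [hdN, h3] at this
      refine Nat.eq_of_mul_eq_mul_right (pow_pos hp.pos (k + 2)) (this.trans ?_)
      ring
    -- a subgroup between `p N` and `Λ` is one of the two
    have hbetween : ∀ Λ' : AddSubgroup Vec, dilate p N ≤ Λ' → Λ' ≤ Λ → ¬ Λ' ≤ dilate p N →
        Λ ≤ Λ' := by
      intro Λ' ha hb hc
      have := AddSubgroup.relIndex_mul_relIndex _ _ _ ha hb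
      rw [hrel] at this
      rcases (Nat.dvd_prime hp).1 (Dvd.intro _ this) with h | h
      · exact absurd (AddSubgroup.relIndex_eq_one.1 h) hc
      · rw [h] at this
        have h5 : Λ'.relIndex Λ = 1 :=
          Nat.eq_of_mul_eq_mul_left hp.pos (this.trans (mul_one p).symm)
        exact AddSubgroup.relIndex_eq_one.1 h5
    -- The intersection lies between `pN` and `Λ`, where nothing is strictly intermediate, and it is
    -- not `Λ`.
    have hinf : Λ ⊓ dilate p ⊤ = dilate p N := by
      apply le_antisymm
      · by_contra hcon
        have := hbetween (Λ ⊓ dilate p ⊤) (le_inf h1 (dilate_mono p le_top)) inf_le_left hcon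
        exact h4 (this.trans inf_le_right)
      · exact le_inf h1 (dilate_mono p le_top)
    have hcol : colon p Λ = N := by
      apply dilate_injective hp.ne_zero
      rw [dilate_colon, hinf]
    refine ⟨⟨h3, ?_, ?_⟩, hcol⟩
    · obtain ⟨v, hvΛ, hvp⟩ := SetLike.not_le_iff_exists.1 h4
      have hvN : v ∉ dilate p N := fun h => hvp (dilate_mono p le_top h)
      have hΛ : Λ ≤ dilate p N ⊔ AddSubgroup.zmultiples v := by
        refine hbetween _ le_sup_left (sup_le h1 (by simpa using hvΛ)) fun h => hvN ?_
        exact h (AddSubgroup.mem_sup_right (AddSubgroup.mem_zmultiples v))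
      intro x hx y hy
      obtain ⟨_, ⟨x, hx', rfl⟩, _, ⟨a, rfl⟩, rfl⟩ := AddSubgroup.mem_sup.1 (hΛ hx)
      obtain ⟨_, ⟨y, hy', rfl⟩, _, ⟨b, rfl⟩, rfl⟩ := AddSubgroup.mem_sup.1 (hΛ hy)
      refine h1 ⟨(p : ℤ) • (M *ᵥ (x ⨯₃ y)) + b • (M *ᵥ (x ⨯₃ v)) + a • (M *ᵥ (v ⨯₃ y)), ?_, ?_⟩
      · have hv := h2 hvΛ
        exact N.add_mem (N.add_mem (N.zsmul_mem (hNM x hx' y hy') _)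
          (N.zsmul_mem (hNM x hx' v hv) _)) (N.zsmul_mem (hNM v hv y hy') _)
      · simp only [nsmulAddMonoidHom_apply, map_add, map_nsmul, LinearMap.add_apply, map_zsmul,
          LinearMap.smul_apply, Matrix.mulVec_add, Matrix.mulVec_smul, smul_add, cross_self,
          smul_zero, add_zero, natCast_zsmul]
        rw [smul_comm b p, smul_comm p a]
        abel
    · have := index_inf_mul_index_sup Λ (dilate p ⊤)
      rw [hinf, hdN, h3, index_dilate_top] at this
      refine Nat.eq_of_mul_eq_mul_left (pow_pos hp.pos (k + 3)) (this.trans ?_)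
      ring

theorem card_map_mk (P H : AddSubgroup Vec) :
    Nat.card (H.map (QuotientAddGroup.mk' P)) = P.relIndex H := by
  rw [← AddSubgroup.relIndex_ker, QuotientAddGroup.ker_mk']

/-- By the previous characterization the fibre is the set of lines of `N / pN ≅ 𝔽_p³` not contained
in `(N ∩ p ℤ³) / pN`, and the latter has order `p ^ j`. -/
theorem ncard_fiber_colon (hp : p.Prime) {N : AddSubgroup Vec} {j k : ℕ}
    (hN : N ∈ rankSet M p j k) :
    {Λ ∈ rankSet M p 2 (k + 2) | colon p Λ = N}.ncard * (p - 1) + p ^ j = p ^ 3 := by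
  obtain ⟨h1, h2, h3⟩ := hN
  have hset : {Λ ∈ rankSet M p 2 (k + 2) | colon p Λ = N} =
      {Λ | dilate p N ≤ Λ ∧ Λ ≤ N ∧ Λ.index = p ^ (k + 2) ∧ ¬ Λ ≤ dilate p ⊤} :=
    Set.ext fun Λ => mem_rankSet_two_iff hp h1 h2 Λ
  have hdN : (dilate p N).index = p ^ (k + 3) := by rw [index_dilate hp.ne_zero, h1]; ring
  set P := dilate p N with hP
  have hfin : Finite (Vec ⧸ P) := by
    rw [← AddSubgroup.index_ne_zero_iff_finite, hdN]
    exact pow_ne_zero _ hp.ne_zero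
  have hPN : P ≤ N := dilate_le p N
  have hPK : P ≤ N ⊓ dilate p ⊤ := le_inf hPN (dilate_mono p le_top)
  have hcN : P.relIndex N = p ^ 3 := by
    have := AddSubgroup.relIndex_mul_index hPN
    rw [hdN, h1] at this
    refine Nat.eq_of_mul_eq_mul_right (pow_pos hp.pos k) (this.trans ?_)
    ring
  have hcK : P.relIndex (N ⊓ dilate p ⊤) = p ^ j := by
    have e1 := AddSubgroup.relIndex_mul_index hPK
    have e2 := index_inf_mul_index_sup N (dilate p ⊤)
    rw [h3, h1, index_dilate_top] at e2
    rw [hdN] at e1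
    have hpos : 0 < p ^ (k + 3) := pow_pos hp.pos _
    refine Nat.eq_of_mul_eq_mul_right hpos ?_
    calc P.relIndex (N ⊓ dilate p ⊤) * p ^ (k + 3)
        = P.relIndex (N ⊓ dilate p ⊤) * (p ^ k * p ^ 3) := by ring
      _ = P.relIndex (N ⊓ dilate p ⊤) * (N ⊓ dilate p ⊤).index * p ^ j := by rw [← e2]; ring
      _ = p ^ j * p ^ (k + 3) := by rw [e1]; ring
  have key := ncard_prime_order_subgroups (Q := Vec ⧸ P) hp
    (K := (N ⊓ dilate p ⊤).map (QuotientAddGroup.mk' P)) (N := N.map (QuotientAddGroup.mk' P))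
    (AddSubgroup.map_mono inf_le_left) (by
      rintro _ ⟨x, hx, rfl⟩
      rw [← map_nsmul, QuotientAddGroup.mk'_apply, QuotientAddGroup.eq_zero_iff]
      exact nsmul_mem_dilate p hx)
  rw [card_map_mk, card_map_mk, hcN, hcK] at key
  rw [← key, hset]
  congr 2
  have hmapcomap : ∀ H : AddSubgroup (Vec ⧸ P),
      (H.comap (QuotientAddGroup.mk' P)).map (QuotientAddGroup.mk' P) = H := fun H =>
    AddSubgroup.map_comap_eq_self_of_surjective (QuotientAddGroup.mk'_surjective P) H
  have hcomapmap : ∀ H : AddSubgroup Vec, P ≤ H →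
      (H.map (QuotientAddGroup.mk' P)).comap (QuotientAddGroup.mk' P) = H := fun H hH => by
    rw [AddSubgroup.comap_map_eq, QuotientAddGroup.ker_mk', sup_eq_left.2 hH]
  have hle : ∀ H H' : AddSubgroup Vec, P ≤ H' →
      (H.map (QuotientAddGroup.mk' P) ≤ H'.map (QuotientAddGroup.mk' P) ↔ H ≤ H') := by
    intro H H' hH'
    rw [AddSubgroup.map_le_iff_le_comap, hcomapmap H' hH']
  have hcard : ∀ H : AddSubgroup Vec, P ≤ H →
      (Nat.card (H.map (QuotientAddGroup.mk' P)) = p ↔ H.index = p ^ (k + 2)) := by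
    intro H hH
    have := AddSubgroup.relIndex_mul_index hH
    rw [card_map_mk]
    rw [hdN] at this
    constructor
    · intro h
      rw [h] at this
      refine Nat.eq_of_mul_eq_mul_left hp.pos (this.trans ?_)
      ring
    · intro h
      rw [h] at this
      refine Nat.eq_of_mul_eq_mul_right (pow_pos hp.pos (k + 2)) (this.trans ?_)
      ring
  refine Set.ncard_congr (fun Λ _ => Λ.map (QuotientAddGroup.mk' P)) ?_ ?_ ?_
  · rintro Λ ⟨a1, a2, a3, a4⟩
    refine ⟨AddSubgroup.map_mono a2, (hcard Λ a1).2 a3, ?_⟩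
    rw [hle _ _ hPK]
    exact fun h => a4 (h.trans inf_le_right)
  · rintro Λ Λ' ⟨a1, -⟩ ⟨b1, -⟩ h
    rw [← hcomapmap Λ a1, ← hcomapmap Λ' b1, h]
  · rintro H ⟨a1, a2, a3⟩
    have hPH : P ≤ H.comap (QuotientAddGroup.mk' P) := by
      conv_lhs => rw [← QuotientAddGroup.ker_mk' P]
      exact AddSubgroup.ker_le_comap _ _
    refine ⟨H.comap (QuotientAddGroup.mk' P), ⟨hPH, ?_, ?_, ?_⟩, hmapcomap H⟩
    · rw [← hle _ _ hPN, hmapcomap]; exact a1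
    · rw [← hcard _ hPH, hmapcomap]; exact a2
    · intro h
      apply a3
      have hHN : H.comap (QuotientAddGroup.mk' P) ≤ N := by
        rw [← hle _ _ hPN, hmapcomap]; exact a1
      have := (hle _ _ hPK).2 (le_inf hHN h)
      rwa [hmapcomap] at this

/-- The coefficients are `(p ^ 3 - p ^ j) / (p - 1)` for `j = 0, 1, 2`. Rank `3` does not occur for
`(Λ : p)`, which contains the rank two lattice `Λ`. -/
theorem rankCount_two (hp : p.Prime) (k : ℕ) :
    rankCount M p 2 (k + 2) = (p ^ 2 + p + 1) * rankCount M p 0 k +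
      (p ^ 2 + p) * rankCount M p 1 k + p ^ 2 * rankCount M p 2 k := by
  have hp1 : 0 < p - 1 := Nat.sub_pos_of_lt hp.one_lt
  have hsplit : rankSet M p 2 (k + 2) =
      {Λ ∈ rankSet M p 2 (k + 2) | colon p Λ ∈ rankSet M p 0 k} ∪
      {Λ ∈ rankSet M p 2 (k + 2) | colon p Λ ∈ rankSet M p 1 k} ∪
      {Λ ∈ rankSet M p 2 (k + 2) | colon p Λ ∈ rankSet M p 2 k} := by
    ext Λ
    simp only [Set.mem_union, Set.mem_ofPred_eq, ← and_or_left]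
    refine ⟨fun h => ⟨h, ?_⟩, fun h => h.1⟩
    obtain ⟨h1, h2, j, hj, h3⟩ := colon_props hp h
    interval_cases j
    · exact Or.inl (Or.inl ⟨h1, h2, h3⟩)
    · exact Or.inl (Or.inr ⟨h1, h2, h3⟩)
    · exact Or.inr ⟨h1, h2, h3⟩
  have hdisj : ∀ i j, i ≠ j → Disjoint {Λ ∈ rankSet M p 2 (k + 2) | colon p Λ ∈ rankSet M p i k}
      {Λ ∈ rankSet M p 2 (k + 2) | colon p Λ ∈ rankSet M p j k} := by
    intro i j hij
    refine Set.disjoint_left.2 fun Λ h h' => hij ?_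
    exact Nat.pow_right_injective hp.two_le (h.2.2.2.symm.trans h'.2.2.2)
  have hfin : ∀ j, {Λ ∈ rankSet M p 2 (k + 2) | colon p Λ ∈ rankSet M p j k}.Finite := fun j =>
    (rankSet_finite hp 2 (k + 2)).subset fun _ h => h.1
  have hcount : ∀ j c, c * (p - 1) + p ^ j = p ^ 3 →
      {Λ ∈ rankSet M p 2 (k + 2) | colon p Λ ∈ rankSet M p j k}.ncard = c * rankCount M p j k := by
    intro j c hc
    rw [mul_comm]
    refine ncard_eq_mul_of_ncard_fiber (colon p) (hfin j) (rankSet_finite hp j k)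
      (fun _ h => h.2) fun N hN => ?_
    have h1 := ncard_fiber_colon hp hN
    have h2 : {s ∈ {Λ ∈ rankSet M p 2 (k + 2) | colon p Λ ∈ rankSet M p j k} | colon p s = N} =
        {Λ ∈ rankSet M p 2 (k + 2) | colon p Λ = N} := by
      ext Λ
      simp only [Set.mem_ofPred_eq]
      constructor
      · rintro ⟨⟨a, -⟩, b⟩; exact ⟨a, b⟩
      · rintro ⟨a, rfl⟩; exact ⟨⟨a, hN⟩, rfl⟩
    rw [h2]
    refine Nat.eq_of_mul_eq_mul_right hp1 ?_
    omega
  have hpp : p = (p - 1) + 1 := (Nat.succ_pred_prime hp).symm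
  conv_lhs => rw [rankCount, hsplit]
  rw [Set.ncard_union_eq _ ((hfin 0).union (hfin 1)) (hfin 2), Set.ncard_union_eq (hdisj 0 1 (by decide))
    (hfin 0) (hfin 1), hcount 0 (p ^ 2 + p + 1) ?_, hcount 1 (p ^ 2 + p) ?_,
    hcount 2 (p ^ 2) ?_]
  · obtain ⟨q, rfl⟩ : ∃ q, p = q + 1 := ⟨p - 1, hpp⟩
    simp only [Nat.add_sub_cancel]; ring
  · obtain ⟨q, rfl⟩ : ∃ q, p = q + 1 := ⟨p - 1, hpp⟩
    simp only [Nat.add_sub_cancel]; ring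
  · obtain ⟨q, rfl⟩ : ∃ q, p = q + 1 := ⟨p - 1, hpp⟩
    simp only [Nat.add_sub_cancel]; ring
  · exact Set.disjoint_union_left.2 ⟨hdisj 0 2 (by decide), hdisj 1 2 (by decide)⟩

end CotypeDensity

namespace CotypeDensity

open scoped Matrix

variable {M : Matrix (Fin 3) (Fin 3) ℤ} {p : ℕ}

/-! ### Cocyclic sublattices -/

/-- The reduction of an integer vector modulo `n`. -/
def redVec (n : ℕ) (x : Vec) : Fin 3 → ZMod n := fun i => (x i : ZMod n)

/-- The linear form `x ↦ w · x` modulo `n`. -/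
def linForm {n : ℕ} (w : Fin 3 → ZMod n) : Vec →+ ZMod n where
  toFun x := w ⬝ᵥ redVec n x
  map_zero' := by simp [redVec, dotProduct]
  map_add' x y := by simp [redVec, dotProduct, mul_add, Finset.sum_add_distrib]

/-- The quadratic form `w ↦ w · M w`. -/
def quad {R : Type*} [CommRing R] (M : Matrix (Fin 3) (Fin 3) ℤ) (w : Fin 3 → R) : R :=
  w ⬝ᵥ (M.map (Int.cast : ℤ → R) *ᵥ w)

/-- The first unit coordinate of `w` exists and equals `1`. -/
def IsNormalized {R : Type*} [CommRing R] (w : Fin 3 → R) : Prop :=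
  w 0 = 1 ∨ (¬ IsUnit (w 0) ∧ w 1 = 1) ∨ (¬ IsUnit (w 0) ∧ ¬ IsUnit (w 1) ∧ w 2 = 1)

theorem IsNormalized.exists_eq_one {R : Type*} [CommRing R] {w : Fin 3 → R}
    (h : IsNormalized w) : ∃ i, w i = 1 := by
  rcases h with h | h | h
  exacts [⟨0, h⟩, ⟨1, h.2⟩, ⟨2, h.2.2⟩]

theorem linForm_apply {n : ℕ} (w : Fin 3 → ZMod n) (x : Vec) :
    linForm w x = w ⬝ᵥ redVec n x := rfl

theorem linForm_single {n : ℕ} (w : Fin 3 → ZMod n) (i : Fin 3) :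
    linForm w (Pi.single i 1) = w i := by
  rw [linForm_apply]
  fin_cases i <;> simp [redVec, dotProduct, Fin.sum_univ_three]

theorem redVec_surjective (n : ℕ) : Function.Surjective (redVec n) := by
  intro y
  choose x hx using fun i => ZMod.intCast_surjective (y i)
  exact ⟨x, funext hx⟩

theorem redVec_cross (n : ℕ) (x y : Vec) : redVec n (x ⨯₃ y) = redVec n x ⨯₃ redVec n y := by
  ext i
  simp only [redVec, cross_apply]
  fin_cases i <;> simp

theorem redVec_mulVec (n : ℕ) (x : Vec) :
    redVec n (M *ᵥ x) = M.map (Int.cast : ℤ → ZMod n) *ᵥ redVec n x := by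
  ext i
  simp only [redVec]
  exact RingHom.map_mulVec (Int.castRingHom (ZMod n)) M x i

theorem linForm_surjective {n : ℕ} {w : Fin 3 → ZMod n} {i : Fin 3} (hi : w i = 1) :
    Function.Surjective (linForm w) := by
  intro y
  obtain ⟨a, rfl⟩ := ZMod.intCast_surjective y
  refine ⟨a • Pi.single i 1, ?_⟩
  rw [map_zsmul, linForm_single, hi, zsmul_one]

theorem index_ker_linForm {n : ℕ} {w : Fin 3 → ZMod n} {i : Fin 3} (hi : w i = 1) :
    (linForm w).ker.index = n := by
  rw [AddSubgroup.index_ker, AddMonoidHom.range_eq_top.2 (linForm_surjective hi)]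
  simp

/-- Modulo `n`, two vectors orthogonal to the primitive vector `w` have a cross product proportional
to `w`, and `w` itself arises in this way. Closedness of the kernel is therefore `w · M w = 0`. -/
theorem isClosedUnder_ker_linForm {n : ℕ} {w : Fin 3 → ZMod n} {i : Fin 3} (hi : w i = 1) :
    IsClosedUnder M (linForm w).ker ↔ quad M w = 0 := by
  constructor
  · intro h
    -- With `w · (a × b) = 1`, the vectors `w × a` and `w × b` lie in the kernel and `(w × a) × (w ×
    -- b) = (w · (a × b)) w = w`.
    obtain ⟨a, b, hab⟩ : ∃ a b : Fin 3 → ZMod n, w ⬝ᵥ (a ⨯₃ b) = 1 := by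
      have hw : ∀ a b : Fin 3 → ZMod n, w ⬝ᵥ (a ⨯₃ b) = w 0 * (a 1 * b 2 - a 2 * b 1) +
          w 1 * (a 2 * b 0 - a 0 * b 2) + w 2 * (a 0 * b 1 - a 1 * b 0) := fun a b => by
        simp only [cross_apply, dotProduct, Fin.sum_univ_three, Matrix.cons_val]
      simp only [hw]
      fin_cases i
      · exact ⟨![0, 1, 0], ![0, 0, 1], by simpa using hi⟩
      · exact ⟨![0, 0, 1], ![1, 0, 0], by simpa using hi⟩
      · exact ⟨![1, 0, 0], ![0, 1, 0], by simpa using hi⟩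
    obtain ⟨x, hx⟩ := redVec_surjective n (w ⨯₃ a)
    obtain ⟨y, hy⟩ := redVec_surjective n (w ⨯₃ b)
    have hxk : x ∈ (linForm w).ker := by
      rw [AddMonoidHom.mem_ker, linForm_apply, hx, dot_self_cross]
    have hyk : y ∈ (linForm w).ker := by
      rw [AddMonoidHom.mem_ker, linForm_apply, hy, dot_self_cross]
    have hc : redVec n (x ⨯₃ y) = w := by
      rw [redVec_cross, hx, hy, cross_cross_eq_smul_sub_smul, dot_self_cross,
        triple_product_permutation a w b, ← cross_anticomm a b, dotProduct_neg, hab]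
      simp
    have := h x hxk y hyk
    rwa [AddMonoidHom.mem_ker, linForm_apply, redVec_mulVec, hc] at this
  · intro h x hx y hy
    rw [AddMonoidHom.mem_ker, linForm_apply] at hx hy
    -- From `w × (x × y) = 0` and `w i = 1`, the factor of proportionality is the coordinate `i` of
    -- `x × y`.
    have hc : redVec n (x ⨯₃ y) = (redVec n (x ⨯₃ y) i) • w := by
      have h0 : w ⨯₃ redVec n (x ⨯₃ y) = 0 := by
        rw [redVec_cross, cross_cross_eq_smul_sub_smul', hy, dotProduct_comm, hx]
        simp
      generalize redVec n (x ⨯₃ y) = c at h0 ⊢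
      have h1 := congrFun h0 0
      have h2 := congrFun h0 1
      have h3 := congrFun h0 2
      simp only [cross_apply, Matrix.cons_val, Pi.zero_apply] at h1 h2 h3
      ext j
      rw [Pi.smul_apply, smul_eq_mul]
      fin_cases i <;> fin_cases j <;>
        simp only [Fin.zero_eta, Fin.mk_one, Fin.reduceFinMk] at hi ⊢ <;> grind
    rw [AddMonoidHom.mem_ker, linForm_apply, redVec_mulVec, hc, Matrix.mulVec_smul,
      dotProduct_smul]
    change _ • quad M w = 0
    rw [h, smul_zero]

theorem isUnit_iff_castHom_ne_zero (hp : p.Prime) {k : ℕ} (hk : k ≠ 0) (u : ZMod (p ^ k)) :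
    IsUnit u ↔ ZMod.castHom (dvd_pow_self p hk) (ZMod p) u ≠ 0 := by
  have : NeZero (p ^ k) := ⟨pow_ne_zero k hp.ne_zero⟩
  obtain ⟨a, rfl⟩ : ∃ a : ℕ, (a : ZMod (p ^ k)) = u := ⟨u.val, ZMod.natCast_zmod_val u⟩
  rw [ZMod.isUnit_iff_coprime, map_natCast, Ne, ZMod.natCast_eq_zero_iff,
    Nat.coprime_pow_right_iff (Nat.pos_of_ne_zero hk), Nat.coprime_comm,
    Nat.Prime.coprime_iff_not_dvd hp]

/-- A surjective form carries `p ℤ³` onto `p ℤ / p ^ k`, which has index `p`. -/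
theorem index_ker_linForm_sup (hp : p.Prime) {k : ℕ} (hk : k ≠ 0) {w : Fin 3 → ZMod (p ^ k)}
    {i : Fin 3} (hi : w i = 1) : ((linForm w).ker ⊔ dilate p ⊤).index = p := by
  have : NeZero (p ^ k) := ⟨pow_ne_zero k hp.ne_zero⟩
  rw [sup_comm, ← AddSubgroup.comap_map_eq,
    AddSubgroup.index_comap_of_surjective _ (linForm_surjective hi)]
  have : (dilate p ⊤).map (linForm w) = AddSubgroup.zmultiples (p : ZMod (p ^ k)) := by
    ext y
    constructor
    · rintro ⟨_, ⟨x, -, rfl⟩, rfl⟩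
      obtain ⟨a, ha⟩ := ZMod.intCast_surjective (linForm w x)
      refine ⟨a, ?_⟩
      change a • (p : ZMod (p ^ k)) = linForm w (p • x)
      rw [map_nsmul, ← ha]
      simp [mul_comm]
    · rintro ⟨a, rfl⟩
      obtain ⟨x, hx⟩ := linForm_surjective hi (a : ZMod (p ^ k))
      refine ⟨p • x, nsmul_mem_dilate p (AddSubgroup.mem_top x), ?_⟩
      change linForm w (p • x) = a • (p : ZMod (p ^ k))
      rw [map_nsmul, hx]
      simp [mul_comm]
  rw [this]
  have h1 := AddSubgroup.index_mul_card (AddSubgroup.zmultiples (p : ZMod (p ^ k)))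
  rw [Nat.card_zmultiples, ZMod.addOrderOf_coe p (NeZero.ne _), Nat.card_zmod,
    Nat.gcd_eq_right (dvd_pow_self p hk)] at h1
  have h2 : p ^ k = p * p ^ (k - 1) := (mul_pow_sub_one hk p).symm
  have h3 : p ^ k / p = p ^ (k - 1) := by rw [h2, Nat.mul_div_cancel_left _ hp.pos]
  rw [h3] at h1
  exact Nat.eq_of_mul_eq_mul_right (pow_pos hp.pos (k - 1)) (h1.trans h2)

/-- Primitive forms with the same kernel differ by a unit; proportional vectors have their units in
the same positions, and the normalization makes the first of these entries `1` in both. -/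
theorem ker_linForm_injOn {n : ℕ} {w w' : Fin 3 → ZMod n} (hw : IsNormalized w)
    (hw' : IsNormalized w') (h : (linForm w).ker = (linForm w').ker) : w = w' := by
  have key : ∀ {w w' : Fin 3 → ZMod n} {i : Fin 3}, w i = 1 →
      (linForm w).ker = (linForm w').ker → ∀ j, w' j = w' i * w j := by
    intro w w' i hi h j
    obtain ⟨a, ha⟩ := ZMod.intCast_surjective (w j)
    -- With `a` lifting `w j` and `w i = 1`, this vector is killed by `w`, hence by `w'`, which
    -- expresses `w' j` through `w' i`.
    have : (Pi.single j 1 - a • Pi.single i 1 : Vec) ∈ (linForm w).ker := by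
      rw [AddMonoidHom.mem_ker, map_sub, map_zsmul, linForm_single, linForm_single, hi, zsmul_one,
        ha, sub_self]
    rw [h, AddMonoidHom.mem_ker, map_sub, map_zsmul, linForm_single, linForm_single,
      zsmul_eq_mul, ha, sub_eq_zero] at this
    rw [this, mul_comm]
  obtain ⟨i, hi⟩ := hw.exists_eq_one
  obtain ⟨i', hi'⟩ := hw'.exists_eq_one
  have k1 := key hi h
  have k2 := key hi' h.symm
  have hu : w' i = 1 := by
    have hunit : w' i * w i' = 1 := by rw [← k1 i', hi']
    have hu1 : IsUnit (w' i) := IsUnit.of_mul_eq_one _ hunit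
    have hu2 : IsUnit (w i') := IsUnit.of_mul_eq_one_right _ hunit
    have huj : ∀ j, IsUnit (w j) ↔ IsUnit (w' j) := by
      intro j
      rw [k1 j]
      exact ⟨fun h => hu1.mul h, fun h => isUnit_of_mul_isUnit_right h⟩
    have hone : ∀ j, w j = 1 → w' j = 1 → w' i = 1 := by
      intro j h h'
      rw [← h', k1 j, h, mul_one]
    have hun : ∀ j, w j = 1 → ¬ IsUnit (w' j) → False := fun j h h' =>
      h' ((huj j).1 (h ▸ isUnit_one))
    have hun' : ∀ j, w' j = 1 → ¬ IsUnit (w j) → False := fun j h h' =>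
      h' ((huj j).2 (h ▸ isUnit_one))
    rcases hw with a | ⟨a, a'⟩ | ⟨a, a', a''⟩ <;> rcases hw' with b | ⟨b, b'⟩ | ⟨b, b', b''⟩
    · exact hone 0 a b
    · exact (hun 0 a b).elim
    · exact (hun 0 a b).elim
    · exact (hun' 0 b a).elim
    · exact hone 1 a' b'
    · exact (hun 1 a' b').elim
    · exact (hun' 0 b a).elim
    · exact (hun' 1 b' a').elim
    · exact hone 2 a'' b''
  ext j
  rw [k1 j, hu, one_mul]

/-- If `ℤ³ / (Λ + p ℤ³)` has order `p`, then `ℤ³ / Λ` is cyclic, and an identification with `ℤ / p ^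
k` is a primitive linear form with kernel `Λ`. Dividing by its first unit coordinate normalizes it.
-/
theorem exists_linForm_of_mem_rankSet (hp : p.Prime) {k : ℕ} (hk : k ≠ 0) {Λ : AddSubgroup Vec}
    (h1 : Λ.index = p ^ k) (h3 : (Λ ⊔ dilate p ⊤).index = p) :
    ∃ w : Fin 3 → ZMod (p ^ k), IsNormalized w ∧ (linForm w).ker = Λ := by
  obtain ⟨v, hv⟩ : ∃ v, v ∉ Λ ⊔ dilate p ⊤ := by
    by_contra! hcon
    rw [(AddSubgroup.eq_top_iff' _).2 hcon, AddSubgroup.index_top] at h3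
    exact hp.one_lt.ne h3
  -- Any `v` outside `Λ + p ℤ³` generates modulo `Λ + p ℤ³`, hence modulo `Λ` by Nakayama.
  have htop : Λ ⊔ AddSubgroup.zmultiples v = ⊤ := by
    obtain ⟨l, -, hl⟩ := (Nat.dvd_prime_pow hp).1 (h1 ▸ AddSubgroup.index_dvd_of_le
      (le_sup_left : Λ ≤ Λ ⊔ AddSubgroup.zmultiples v))
    refine eq_top_of_sup_dilate_eq_top hl ?_
    have hle : Λ ⊔ dilate p ⊤ ≤ Λ ⊔ AddSubgroup.zmultiples v ⊔ dilate p ⊤ :=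
      sup_le_sup_right le_sup_left _
    have hdvd := AddSubgroup.index_dvd_of_le hle
    rw [h3] at hdvd
    rcases (Nat.dvd_prime hp).1 hdvd with h | h
    · exact AddSubgroup.index_eq_one.1 h
    · have := AddSubgroup.relIndex_mul_index hle
      rw [h3, h] at this
      have h5 := Nat.eq_of_mul_eq_mul_right hp.pos (this.trans (one_mul p).symm)
      exact absurd (AddSubgroup.relIndex_eq_one.1 h5 (AddSubgroup.mem_sup_left
        (AddSubgroup.mem_sup_right (AddSubgroup.mem_zmultiples v)))) hv
  have hgen : ∀ x : Vec ⧸ Λ, x ∈ AddSubgroup.zmultiples (QuotientAddGroup.mk' Λ v) := by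
    intro x
    obtain ⟨x, rfl⟩ := QuotientAddGroup.mk'_surjective Λ x
    have hx : x ∈ Λ ⊔ AddSubgroup.zmultiples v := htop ▸ AddSubgroup.mem_top x
    obtain ⟨y, hy, _, ⟨a, rfl⟩, rfl⟩ := AddSubgroup.mem_sup.1 hx
    refine ⟨a, ?_⟩
    have : QuotientAddGroup.mk' Λ y = 0 := by simpa using hy
    simp only [map_add, this, zero_add, map_zsmul]
  let e : ZMod (p ^ k) ≃+ Vec ⧸ Λ := zmodAddEquivOfGenerator hgen h1
  let ψ : Vec →+ ZMod (p ^ k) := (e.symm : (Vec ⧸ Λ) →+ ZMod (p ^ k)).comp (QuotientAddGroup.mk' Λ)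
  have hψs : Function.Surjective ψ := e.symm.surjective.comp (QuotientAddGroup.mk'_surjective Λ)
  have hψk : ∀ x, ψ x = 0 ↔ x ∈ Λ := by
    intro x
    simp [ψ]
  let u : Fin 3 → ZMod (p ^ k) := fun i => ψ (Pi.single i 1)
  have hψ : ∀ x, ψ x = u ⬝ᵥ redVec (p ^ k) x := by
    intro x
    have : x = x 0 • Pi.single 0 1 + x 1 • Pi.single 1 1 + x 2 • Pi.single 2 1 := by
      ext i; fin_cases i <;> simp [-zsmul_eq_mul]
    conv_lhs => rw [this]
    rw [map_add, map_add, map_zsmul, map_zsmul, map_zsmul]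
    simp only [dotProduct, Fin.sum_univ_three, redVec, u, zsmul_eq_mul]
    ring
  have hscale : ∀ i, IsUnit (u i) → ∃ c : ZMod (p ^ k), IsUnit c ∧ c * u i = 1 := by
    rintro i ⟨c, hc⟩
    exact ⟨↑c⁻¹, Units.isUnit _, by rw [← hc, Units.inv_mul]⟩
  have hfin : ∀ c : ZMod (p ^ k), IsUnit c → (linForm (c • u)).ker = Λ := by
    intro c hc
    ext x
    rw [AddMonoidHom.mem_ker, linForm_apply, smul_dotProduct, ← hψ, smul_eq_mul,
      hc.mul_right_eq_zero, hψk]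
  have hnon : ∀ c : ZMod (p ^ k), ∀ j, ¬ IsUnit (u j) → ¬ IsUnit ((c • u) j) := by
    intro c j hj h
    exact hj (isUnit_of_mul_isUnit_right (x := c) h)
  by_cases h0 : IsUnit (u 0)
  · obtain ⟨c, hc, hcu⟩ := hscale 0 h0
    exact ⟨c • u, Or.inl hcu, hfin c hc⟩
  by_cases h1 : IsUnit (u 1)
  · obtain ⟨c, hc, hcu⟩ := hscale 1 h1
    exact ⟨c • u, Or.inr (Or.inl ⟨hnon c 0 h0, hcu⟩), hfin c hc⟩
  by_cases h2 : IsUnit (u 2)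
  · obtain ⟨c, hc, hcu⟩ := hscale 2 h2
    exact ⟨c • u, Or.inr (Or.inr ⟨hnon c 0 h0, hnon c 1 h1, hcu⟩), hfin c hc⟩
  -- If no coordinate were a unit, the form would vanish modulo `p` and miss the value `1`.
  exfalso
  obtain ⟨x, hx⟩ := hψs 1
  rw [isUnit_iff_castHom_ne_zero hp hk, not_not] at h0 h1 h2
  have : ZMod.castHom (dvd_pow_self p hk) (ZMod p) (ψ x) = 0 := by
    rw [hψ, dotProduct, Fin.sum_univ_three, map_add, map_add, map_mul, map_mul, map_mul, h0, h1, h2]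
    simp
  rw [hx, map_one] at this
  have : Fact (1 < p) := ⟨hp.one_lt⟩
  exact one_ne_zero ‹(1 : ZMod p) = 0›

theorem rankCount_one (hp : p.Prime) {k : ℕ} (hk : k ≠ 0) :
    rankCount M p 1 k = {w : Fin 3 → ZMod (p ^ k) | IsNormalized w ∧ quad M w = 0}.ncard := by
  symm
  refine Set.ncard_congr (fun w _ => (linForm w).ker) ?_ ?_ ?_
  · rintro w ⟨hw, hq⟩
    obtain ⟨i, hi⟩ := hw.exists_eq_one
    exact ⟨index_ker_linForm hi, (isClosedUnder_ker_linForm hi).2 hq, by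
      rw [index_ker_linForm_sup hp hk hi, pow_one]⟩
  · rintro w w' ⟨hw, -⟩ ⟨hw', -⟩ h
    exact ker_linForm_injOn hw hw' h
  · rintro Λ ⟨h1, h2, h3⟩
    obtain ⟨w, hw, rfl⟩ := exists_linForm_of_mem_rankSet hp hk h1 (by rw [h3, pow_one])
    obtain ⟨i, hi⟩ := hw.exists_eq_one
    exact ⟨w, ⟨hw, (isClosedUnder_ker_linForm hi).1 h2⟩, rfl⟩

/-- The normalized solutions of `quad M w = 0`, split by the position of the first unit. -/
theorem rankCount_one_eq_charts (hp : p.Prime) {k : ℕ} (hk : k ≠ 0) :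
    rankCount M p 1 k =
      {x : ZMod (p ^ k) × ZMod (p ^ k) | quad M ![1, x.1, x.2] = 0}.ncard +
      {x : ZMod (p ^ k) × ZMod (p ^ k) | ¬ IsUnit x.1 ∧ quad M ![x.1, 1, x.2] = 0}.ncard +
      {x : ZMod (p ^ k) × ZMod (p ^ k) |
        ¬ IsUnit x.1 ∧ ¬ IsUnit x.2 ∧ quad M ![x.1, x.2, 1] = 0}.ncard := by
  have : NeZero (p ^ k) := ⟨pow_ne_zero k hp.ne_zero⟩
  rw [rankCount_one hp hk]
  have i1 : Function.Injective fun x : ZMod (p ^ k) × ZMod (p ^ k) => ![1, x.1, x.2] :=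
    fun x y h => Prod.ext (by simpa using congrFun h 1) (by simpa using congrFun h 2)
  have i2 : Function.Injective fun x : ZMod (p ^ k) × ZMod (p ^ k) => ![x.1, 1, x.2] :=
    fun x y h => Prod.ext (by simpa using congrFun h 0) (by simpa using congrFun h 2)
  have i3 : Function.Injective fun x : ZMod (p ^ k) × ZMod (p ^ k) => ![x.1, x.2, 1] :=
    fun x y h => Prod.ext (by simpa using congrFun h 0) (by simpa using congrFun h 1)
  rw [← Set.ncard_image_of_injective _ i1, ← Set.ncard_image_of_injective _ i2,
    ← Set.ncard_image_of_injective _ i3, ← Set.ncard_union_eq, ← Set.ncard_union_eq]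
  · congr 1
    ext w
    have hw : w = ![w 0, w 1, w 2] := by ext i; fin_cases i <;> rfl
    simp only [Set.mem_union, Set.mem_image, Set.mem_ofPred_eq]
    constructor
    · rintro ⟨h | h | h, hq⟩
      · rw [hw, h] at hq
        exact Or.inl (Or.inl ⟨(w 1, w 2), hq, by rw [← h]; exact hw.symm⟩)
      · rw [hw, h.2] at hq
        exact Or.inl (Or.inr ⟨(w 0, w 2), ⟨h.1, hq⟩, by rw [← h.2]; exact hw.symm⟩)
      · rw [hw, h.2.2] at hq
        exact Or.inr ⟨(w 0, w 1), ⟨h.1, h.2.1, hq⟩, by rw [← h.2.2]; exact hw.symm⟩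
    · rintro ((⟨x, h, rfl⟩ | ⟨x, ⟨h1, h⟩, rfl⟩) | ⟨x, ⟨h1, h2, h⟩, rfl⟩)
      · exact ⟨Or.inl rfl, h⟩
      · exact ⟨Or.inr (Or.inl ⟨h1, rfl⟩), h⟩
      · exact ⟨Or.inr (Or.inr ⟨h1, h2, rfl⟩), h⟩
  · refine Set.disjoint_left.2 ?_
    rintro w (⟨x, -, rfl⟩ | ⟨x, -, rfl⟩) ⟨y, ⟨h1, h2, -⟩, hy⟩
    · exact h1 (by rw [show y.1 = 1 from congrFun hy 0]; exact isUnit_one)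
    · exact h2 (by rw [show y.2 = 1 from congrFun hy 1]; exact isUnit_one)
  · refine Set.disjoint_left.2 ?_
    rintro w ⟨x, -, rfl⟩ ⟨y, ⟨h1, -⟩, hy⟩
    exact h1 (by rw [show y.1 = 1 from congrFun hy 0]; exact isUnit_one)

end CotypeDensity

namespace CotypeDensity

open scoped Matrix

variable {M : Matrix (Fin 3) (Fin 3) ℤ} {p : ℕ}

/-! ### Reduction and multiplication maps between the rings `ℤ / p ^ k` -/

theorem ncard_preimage_of_surjective {A B : Type*} [AddGroup A] [AddGroup B] [Finite A]
    (f : A →+ B) (hf : Function.Surjective f) (S : Set B) {c : ℕ}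
    (hc : Nat.card A = Nat.card B * c) : (f ⁻¹' S).ncard = S.ncard * c := by
  have : Finite B := Finite.of_surjective f hf
  have hker : Nat.card f.ker = c := by
    have h1 := AddSubgroup.index_mul_card f.ker
    rw [AddSubgroup.index_ker, AddMonoidHom.range_eq_top.2 hf, AddSubgroup.card_top, hc] at h1
    exact Nat.eq_of_mul_eq_mul_left Nat.card_pos h1
  refine ncard_eq_mul_of_ncard_fiber f (Set.toFinite _) (Set.toFinite _) (fun _ h => h) ?_
  intro t ht
  obtain ⟨a, rfl⟩ := hf t
  rw [← hker]
  change _ = (f.ker : Set A).ncard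
  rw [← Set.ncard_image_of_injective (f.ker : Set A) (add_right_injective a)]
  congr 1
  ext x
  simp only [Set.mem_ofPred_eq, Set.mem_preimage, Set.mem_image, SetLike.mem_coe,
    AddMonoidHom.mem_ker]
  constructor
  · rintro ⟨-, hx⟩
    exact ⟨-a + x, by simp [hx], by simp⟩
  · rintro ⟨y, hy, rfl⟩
    simpa [hy] using ht

/-- Reduction `ℤ / p ^ (k + j) → ℤ / p ^ k`. -/
def red (p j k : ℕ) : ZMod (p ^ (k + j)) →+* ZMod (p ^ k) :=
  ZMod.castHom (pow_dvd_pow p (Nat.le_add_right k j)) _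

/-- Multiplication by `p ^ j` as a map `ℤ / p ^ k → ℤ / p ^ (k + j)`. -/
def shift (p j k : ℕ) : ZMod (p ^ k) →+ ZMod (p ^ (k + j)) :=
  ZMod.lift (p ^ k) ⟨(AddMonoidHom.mulLeft ((p ^ j : ℕ) : ZMod (p ^ (k + j)))).comp
    (Int.castAddHom _), by
      change ((p ^ j : ℕ) : ZMod (p ^ (k + j))) * (((p ^ k : ℕ) : ℤ) : ZMod (p ^ (k + j))) = 0
      rw [Int.cast_natCast, ← Nat.cast_mul, ← pow_add, add_comm, ZMod.natCast_self]⟩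

theorem shift_intCast (j k : ℕ) (a : ℤ) : shift p j k a = ((p ^ j * a : ℤ) : ZMod (p ^ (k + j))) := by
  rw [shift, ZMod.lift_coe]
  change ((p ^ j : ℕ) : ZMod (p ^ (k + j))) * (a : ZMod (p ^ (k + j))) = _
  push_cast
  rfl

theorem red_intCast (j k : ℕ) (a : ℤ) : red p j k a = a := map_intCast _ _

theorem red_surjective (p j k : ℕ) : Function.Surjective (red p j k) :=
  ZMod.castHom_surjective _

theorem shift_eq_zero_iff (hp : p.Prime) {j k : ℕ} {x : ZMod (p ^ k)} :
    shift p j k x = 0 ↔ x = 0 := by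
  obtain ⟨a, rfl⟩ := ZMod.intCast_surjective x
  rw [shift_intCast, ZMod.intCast_zmod_eq_zero_iff_dvd, ZMod.intCast_zmod_eq_zero_iff_dvd]
  push_cast
  rw [pow_add, mul_comm]
  exact mul_dvd_mul_iff_left (pow_ne_zero j (by exact_mod_cast hp.ne_zero))

theorem shift_injective (hp : p.Prime) (j k : ℕ) : Function.Injective (shift p j k) :=
  (injective_iff_map_eq_zero _).2 fun _ => (shift_eq_zero_iff hp).1

theorem pow_mul_eq_shift_red (j k : ℕ) (x : ZMod (p ^ (k + j))) :
    (p : ZMod (p ^ (k + j))) ^ j * x = shift p j k (red p j k x) := by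
  obtain ⟨a, rfl⟩ := ZMod.intCast_surjective x
  rw [red_intCast, shift_intCast]
  push_cast
  rfl

/-- Modulo `p ^ (k + 2)` the product `(p x)(p y) = p ^ 2 x y` depends only on `x` and `y` modulo `p
^ k`. -/
theorem shift_mul_shift (k : ℕ) (x y : ZMod (p ^ (k + 1))) :
    shift p 1 (k + 1) x * shift p 1 (k + 1) y = shift p 2 k (red p 1 k x * red p 1 k y) := by
  obtain ⟨a, rfl⟩ := ZMod.intCast_surjective x
  obtain ⟨b, rfl⟩ := ZMod.intCast_surjective y
  rw [red_intCast, red_intCast, shift_intCast, shift_intCast, ← Int.cast_mul, ← Int.cast_mul,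
    shift_intCast]
  congr 1
  ring

theorem mul_shift (j k : ℕ) (c : ZMod (p ^ (k + j))) (x : ZMod (p ^ k)) :
    c * shift p j k x = shift p j k (red p j k c * x) := by
  obtain ⟨a, rfl⟩ := ZMod.intCast_surjective x
  obtain ⟨b, rfl⟩ := ZMod.intCast_surjective c
  rw [red_intCast, shift_intCast, ← Int.cast_mul, ← Int.cast_mul, shift_intCast]
  congr 1
  ring

theorem not_isUnit_iff_exists_shift (hp : p.Prime) {k : ℕ} {x : ZMod (p ^ (k + 1))} :
    ¬ IsUnit x ↔ ∃ y, shift p 1 k y = x := by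
  rw [isUnit_iff_castHom_ne_zero hp (Nat.succ_ne_zero k), not_not]
  constructor
  · intro h
    obtain ⟨a, rfl⟩ := ZMod.intCast_surjective x
    rw [map_intCast, ZMod.intCast_zmod_eq_zero_iff_dvd] at h
    obtain ⟨b, rfl⟩ := h
    exact ⟨b, by rw [shift_intCast, pow_one]⟩
  · rintro ⟨y, rfl⟩
    obtain ⟨a, rfl⟩ := ZMod.intCast_surjective y
    rw [shift_intCast, map_intCast, ZMod.intCast_zmod_eq_zero_iff_dvd, pow_one]
    exact dvd_mul_right _ _

theorem isUnit_red_iff (hp : p.Prime) {j k : ℕ} {x : ZMod (p ^ (k + 1 + j))} :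
    IsUnit (red p j (k + 1) x) ↔ IsUnit x := by
  rw [isUnit_iff_castHom_ne_zero hp (Nat.succ_ne_zero k),
    isUnit_iff_castHom_ne_zero hp (by omega : k + 1 + j ≠ 0)]
  obtain ⟨a, rfl⟩ := ZMod.intCast_surjective x
  rw [red_intCast, map_intCast, map_intCast]

theorem ncard_not_isUnit (hp : p.Prime) (k : ℕ) :
    {x : ZMod (p ^ (k + 1)) | ¬ IsUnit x}.ncard = p ^ k := by
  have : {x : ZMod (p ^ (k + 1)) | ¬ IsUnit x} = Set.range (shift p 1 k) :=
    Set.ext fun x => not_isUnit_iff_exists_shift hp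
  rw [this, ← Set.image_univ, Set.ncard_image_of_injective _ (shift_injective hp 1 k),
    Set.ncard_univ, Nat.card_zmod]

theorem ncard_preimage_red_prod (hp : p.Prime) (j k : ℕ)
    (S : Set (ZMod (p ^ k) × ZMod (p ^ k))) :
    {x : ZMod (p ^ (k + j)) × ZMod (p ^ (k + j)) | (red p j k x.1, red p j k x.2) ∈ S}.ncard =
      S.ncard * p ^ (2 * j) := by
  have : NeZero (p ^ (k + j)) := ⟨pow_ne_zero _ hp.ne_zero⟩
  let f : ZMod (p ^ (k + j)) × ZMod (p ^ (k + j)) →+ ZMod (p ^ k) × ZMod (p ^ k) :=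
    AddMonoidHom.prodMap (red p j k).toAddMonoidHom (red p j k).toAddMonoidHom
  refine ncard_preimage_of_surjective f ?_ S ?_
  · exact Function.Surjective.prodMap (red_surjective p j k) (red_surjective p j k)
  · rw [Nat.card_prod, Nat.card_prod, Nat.card_zmod, Nat.card_zmod]
    ring

/-! ### The number of cocyclic closed sublattices -/

/-- The number of closed sublattices of index `p ^ k` with cyclic quotient. -/
noncomputable def cocyclicCount (M : Matrix (Fin 3) (Fin 3) ℤ) (p k : ℕ) : ℕ :=
  closedCount M 1 (p ^ k)

theorem cocyclicCount_eq (hp : p.Prime) (k : ℕ) :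
    cocyclicCount M p k = rankCount M p 0 k + rankCount M p 1 k := by
  rw [cocyclicCount, closedCount_prime_pow hp, Finset.sum_range_succ, Finset.sum_range_one]

theorem cocyclicCount_zero (hp : p.Prime) : cocyclicCount M p 0 = 1 := by
  rw [cocyclicCount_eq hp, rankCount_zero_zero, rankCount_eq_zero_of_lt hp Nat.zero_lt_one]

theorem cocyclicCount_succ (hp : p.Prime) (k : ℕ) :
    cocyclicCount M p (k + 1) =
      {x : ZMod (p ^ (k + 1)) × ZMod (p ^ (k + 1)) | quad M ![1, x.1, x.2] = 0}.ncard +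
      {x : ZMod (p ^ (k + 1)) × ZMod (p ^ (k + 1)) |
        ¬ IsUnit x.1 ∧ quad M ![x.1, 1, x.2] = 0}.ncard +
      {x : ZMod (p ^ (k + 1)) × ZMod (p ^ (k + 1)) |
        ¬ IsUnit x.1 ∧ ¬ IsUnit x.2 ∧ quad M ![x.1, x.2, 1] = 0}.ncard := by
  rw [cocyclicCount_eq hp, rankCount_zero_left hp (Nat.succ_ne_zero k), zero_add,
    rankCount_one_eq_charts hp (Nat.succ_ne_zero k)]

theorem quad_map {R S : Type*} [CommRing R] [CommRing S] (f : R →+* S) (w : Fin 3 → R) :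
    quad M (f ∘ w) = f (quad M w) := by
  rw [quad, quad, RingHom.map_dotProduct]
  congr 1
  ext i
  have := RingHom.map_mulVec f (M.map (Int.cast : ℤ → R)) w i
  rw [Function.comp_apply, this, Matrix.map_map]
  congr 2
  ext a
  simp

theorem quad_smul {R : Type*} [CommRing R] (w : Fin 3 → R) :
    quad (p • M) w = p * quad M w := by
  have h : ∀ i j, (p • M) i j = p * M i j := fun i j => by
    rw [Matrix.smul_apply, nsmul_eq_mul]
  simp only [quad, dotProduct, Matrix.mulVec, Fin.sum_univ_three, Matrix.map_apply, h]
  push_cast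
  ring

theorem quad_smul_eq_zero_iff (hp : p.Prime) {k : ℕ} (w : Fin 3 → ZMod (p ^ (k + 1))) :
    quad (p • M) w = 0 ↔ quad M (red p 1 k ∘ w) = 0 := by
  rw [quad_smul, quad_map]
  have := pow_mul_eq_shift_red 1 k (quad M w)
  rw [pow_one] at this
  rw [this, shift_eq_zero_iff hp]

theorem ncard_prod {α β : Type*} (s : Set α) (t : Set β) :
    {x : α × β | x.1 ∈ s ∧ x.2 ∈ t}.ncard = s.ncard * t.ncard :=
  Set.ncard_prod (s := s) (t := t)

theorem ncard_all (hp : p.Prime) (k : ℕ) :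
    {_x : ZMod (p ^ (k + 1)) × ZMod (p ^ (k + 1)) | True}.ncard = p ^ (2 * k + 2) := by
  have : NeZero (p ^ (k + 1)) := ⟨pow_ne_zero _ hp.ne_zero⟩
  have := ncard_prod (Set.univ : Set (ZMod (p ^ (k + 1)))) (Set.univ : Set (ZMod (p ^ (k + 1))))
  rw [Set.ncard_univ, Nat.card_zmod] at this
  simp only [Set.mem_univ, and_true] at this
  rw [this]; ring

theorem ncard_not_isUnit_fst (hp : p.Prime) (k : ℕ) :
    {x : ZMod (p ^ (k + 1)) × ZMod (p ^ (k + 1)) | ¬ IsUnit x.1}.ncard = p ^ (2 * k + 1) := by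
  have := ncard_prod {x : ZMod (p ^ (k + 1)) | ¬ IsUnit x} (Set.univ : Set (ZMod (p ^ (k + 1))))
  rw [ncard_not_isUnit hp, Set.ncard_univ, Nat.card_zmod] at this
  simp only [Set.mem_univ, and_true, Set.mem_ofPred_eq] at this
  rw [this]; ring

theorem ncard_not_isUnit_both (hp : p.Prime) (k : ℕ) :
    {x : ZMod (p ^ (k + 1)) × ZMod (p ^ (k + 1)) | ¬ IsUnit x.1 ∧ ¬ IsUnit x.2}.ncard =
      p ^ (2 * k) := by
  have := ncard_prod {x : ZMod (p ^ (k + 1)) | ¬ IsUnit x} {x : ZMod (p ^ (k + 1)) | ¬ IsUnit x}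
  rw [ncard_not_isUnit hp] at this
  simp only [Set.mem_ofPred_eq] at this
  rw [this]; ring

theorem cocyclicCount_succ_of_quad_eq_zero (hp : p.Prime) {k : ℕ}
    (h : ∀ w : Fin 3 → ZMod (p ^ (k + 1)), quad M w = 0) :
    cocyclicCount M p (k + 1) = (p ^ 2 + p + 1) * p ^ (2 * k) := by
  rw [cocyclicCount_succ hp]
  simp only [h, and_true]
  rw [ncard_all hp, ncard_not_isUnit_fst hp, ncard_not_isUnit_both hp]
  ring

theorem cocyclicCount_smul_one (hp : p.Prime) : cocyclicCount (p • M) p 1 = p ^ 2 + p + 1 := by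
  have := cocyclicCount_succ_of_quad_eq_zero (M := p • M) (k := 0) hp fun w => by
    rw [quad_smul_eq_zero_iff hp]
    have : Subsingleton (ZMod (p ^ 0)) := by rw [pow_zero]; infer_instance
    exact Subsingleton.elim _ _
  simpa using this

/-- The equation `p Q(w) = 0` modulo `p ^ (k + 2)` says `Q(w) = 0` modulo `p ^ (k + 1)`, and each
normalized solution has `p ^ 2` lifts, one factor `p` per free coordinate. -/
theorem cocyclicCount_smul (hp : p.Prime) (k : ℕ) :
    cocyclicCount (p • M) p (k + 2) = p ^ 2 * cocyclicCount M p (k + 1) := by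
  rw [cocyclicCount_succ hp (k + 1), cocyclicCount_succ hp k, mul_add, mul_add]
  have hcomp : ∀ a b c : ZMod (p ^ (k + 1 + 1)), red p 1 (k + 1) ∘ ![a, b, c] =
      ![red p 1 (k + 1) a, red p 1 (k + 1) b, red p 1 (k + 1) c] := by
    intro a b c
    ext i; fin_cases i <;> rfl
  have key := ncard_preimage_red_prod hp 1 (k + 1)
  simp only [quad_smul_eq_zero_iff hp, hcomp, map_one, ← isUnit_red_iff (j := 1) hp]
  rw [mul_comm (p ^ 2), mul_comm (p ^ 2), mul_comm (p ^ 2)]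
  congr 1
  · congr 1
    · exact key {x | quad M ![1, x.1, x.2] = 0}
    · exact key {x | ¬ IsUnit x.1 ∧ quad M ![x.1, 1, x.2] = 0}
  · exact key {x | ¬ IsUnit x.1 ∧ ¬ IsUnit x.2 ∧ quad M ![x.1, x.2, 1] = 0}

end CotypeDensity

namespace CotypeDensity

open scoped Matrix

variable {p : ℕ}

/-! ### Cocyclic counts for the five Lie algebras -/

/-- The matrix `M` with `br a b c x y = M (x × y)`. -/
def brMatrix (a b c : ℤ) : Matrix (Fin 3) (Fin 3) ℤ := !![0, -a, 0; c, -b, 0; 0, 0, 1]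

theorem br_eq_mulVec (a b c : ℤ) (x y : Vec) : br a b c x y = brMatrix a b c *ᵥ (x ⨯₃ y) := by
  ext i
  fin_cases i <;>
    simp [br, brMatrix, cross_apply, Matrix.mulVec, dotProduct, Fin.sum_univ_three] <;> ring

/-- This is where the algebras differ: the form is `z²` for Heisenberg, `4xy + z²` for `sl₂`, and
`z² - ε y²` with `ε = 1` for `L₁` and `ε = -1` for `L₂`. -/
theorem quad_brMatrix {R : Type*} [CommRing R] (a b c : ℤ) (x y z : R) :
    quad (brMatrix a b c) ![x, y, z] = ((c - a : ℤ) : R) * (x * y) - (b : R) * y ^ 2 + z ^ 2 := by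
  simp [quad, brMatrix, Matrix.mulVec, dotProduct, Fin.sum_univ_three]
  ring

theorem cocyclicCount_zero_matrix (hp : p.Prime) (k : ℕ) :
    cocyclicCount 0 p (k + 1) = (p ^ 2 + p + 1) * p ^ (2 * k) :=
  cocyclicCount_succ_of_quad_eq_zero hp fun w => by simp [quad]

theorem nontrivial_zmod_pow (hp : p.Prime) (k : ℕ) : Nontrivial (ZMod (p ^ (k + 1))) := by
  have : Fact (1 < p ^ (k + 1)) := ⟨Nat.one_lt_pow (Nat.succ_ne_zero k) hp.one_lt⟩
  infer_instance

/-! ### Square roots and the cone `y² = ε x²` modulo prime powers -/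

/-- The number of square roots of `ε` modulo `p ^ k`. -/
noncomputable def sqrtCount (p : ℕ) (ε : ℤ) (k : ℕ) : ℕ :=
  {y : ZMod (p ^ k) | y ^ 2 = (ε : ZMod (p ^ k))}.ncard

/-- The number of solutions of `y² = ε x²` modulo `p ^ k`. -/
noncomputable def coneCount (p : ℕ) (ε : ℤ) (k : ℕ) : ℕ :=
  {x : ZMod (p ^ k) × ZMod (p ^ k) | x.2 ^ 2 = (ε : ZMod (p ^ k)) * x.1 ^ 2}.ncard

theorem subsingleton_zmod_pow_zero (p : ℕ) : Subsingleton (ZMod (p ^ 0)) := by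
  rw [pow_zero]; infer_instance

theorem sqrtCount_zero_right (ε : ℤ) : sqrtCount p ε 0 = 1 := by
  have := subsingleton_zmod_pow_zero p
  rw [sqrtCount, Set.ncard_eq_one]
  refine ⟨0, Set.ext fun x => ?_⟩
  simp only [Set.mem_ofPred_eq, Set.mem_singleton_iff]
  exact ⟨fun _ => Subsingleton.elim _ _, fun _ => Subsingleton.elim _ _⟩

theorem coneCount_zero_right (ε : ℤ) : coneCount p ε 0 = 1 := by
  have := subsingleton_zmod_pow_zero p
  rw [coneCount, Set.ncard_eq_one]
  refine ⟨0, Set.ext fun x => ?_⟩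
  simp only [Set.mem_ofPred_eq, Set.mem_singleton_iff]
  exact ⟨fun _ => Subsingleton.elim _ _, fun _ => Subsingleton.elim _ _⟩

theorem not_isUnit_of_sq_eq_zero (hp : p.Prime) {k : ℕ} {y : ZMod (p ^ (k + 1))}
    (h : y ^ 2 = 0) : ¬ IsUnit y := by
  have := nontrivial_zmod_pow hp k
  intro hy
  exact not_isUnit_zero (h ▸ hy.pow 2)

theorem sqrtCount_zero_one (hp : p.Prime) : sqrtCount p 0 1 = 1 := by
  rw [sqrtCount, Set.ncard_eq_one]
  refine ⟨0, Set.ext fun y => ?_⟩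
  simp only [Set.mem_ofPred_eq, Set.mem_singleton_iff, Int.cast_zero]
  refine ⟨fun h => ?_, fun h => by rw [h]; ring⟩
  obtain ⟨z, rfl⟩ := (not_isUnit_iff_exists_shift (k := 0) hp).1 (not_isUnit_of_sq_eq_zero hp h)
  have := subsingleton_zmod_pow_zero p
  rw [Subsingleton.elim z 0, map_zero]

/-- A root is `p z` with `z` modulo `p ^ (k + 1)` and `z² = 0` modulo `p ^ k`; the factor `p` counts
the lifts of `z` from `p ^ k` to `p ^ (k + 1)`. -/
theorem sqrtCount_zero_add_two (hp : p.Prime) (k : ℕ) :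
    sqrtCount p 0 (k + 2) = sqrtCount p 0 k * p := by
  have : NeZero (p ^ (k + 1)) := ⟨pow_ne_zero _ hp.ne_zero⟩
  have key := ncard_preimage_of_surjective (red p 1 k).toAddMonoidHom (red_surjective p 1 k)
    {y : ZMod (p ^ k) | y ^ 2 = ((0 : ℤ) : ZMod (p ^ k))} (c := p)
    (by rw [Nat.card_zmod, Nat.card_zmod]; ring)
  rw [sqrtCount, sqrtCount, ← key, ← Set.ncard_image_of_injective _ (shift_injective hp 1 (k + 1))]
  congr 1
  ext y
  simp only [Set.mem_ofPred_eq, Set.mem_image, Set.mem_preimage, Int.cast_zero]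
  have hiff : ∀ z : ZMod (p ^ (k + 1)), shift p 1 (k + 1) z ^ 2 = 0 ↔ red p 1 k z ^ 2 = 0 := by
    intro z
    rw [sq, sq, shift_mul_shift]
    exact shift_eq_zero_iff hp
  constructor
  · intro h
    obtain ⟨z, rfl⟩ := (not_isUnit_iff_exists_shift (k := k + 1) hp).1
      (not_isUnit_of_sq_eq_zero (k := k + 1) hp h)
    exact ⟨z, (hiff z).1 h, rfl⟩
  · rintro ⟨z, hz, rfl⟩
    exact (hiff z).2 hz

/-- In the first two charts the equation `z² = 0` leaves the other coordinate free; the third chart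
has `z = 1` and contributes nothing. -/
theorem cocyclicCount_heis (hp : p.Prime) (k : ℕ) :
    cocyclicCount (brMatrix 0 0 0) p (k + 1) = (p ^ (k + 1) + p ^ k) * sqrtCount p 0 (k + 1) := by
  have := nontrivial_zmod_pow hp k
  have : NeZero (p ^ (k + 1)) := ⟨pow_ne_zero _ hp.ne_zero⟩
  rw [cocyclicCount_succ hp]
  simp only [quad_brMatrix, sub_self, Int.cast_zero, zero_mul, zero_add]
  have h1 := ncard_prod (Set.univ : Set (ZMod (p ^ (k + 1)))) {y : ZMod (p ^ (k + 1)) | y ^ 2 = 0}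
  have h2 := ncard_prod {x : ZMod (p ^ (k + 1)) | ¬ IsUnit x} {y : ZMod (p ^ (k + 1)) | y ^ 2 = 0}
  simp only [Set.mem_univ, true_and, Set.mem_ofPred_eq] at h1 h2
  rw [h1, h2, ncard_not_isUnit hp, Set.ncard_univ, Nat.card_zmod, sqrtCount]
  simp only [one_pow, one_ne_zero, and_false, Set.ofPred_false, Set.ncard_empty, Int.cast_zero]
  ring

theorem ncard_cone_units (hp : p.Prime) (ε : ℤ) (k : ℕ) :
    {x : ZMod (p ^ (k + 1)) × ZMod (p ^ (k + 1)) | IsUnit x.1 ∧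
      x.2 ^ 2 = (ε : ZMod (p ^ (k + 1))) * x.1 ^ 2}.ncard =
      (p ^ (k + 1) - p ^ k) * sqrtCount p ε (k + 1) := by
  have : NeZero (p ^ (k + 1)) := ⟨pow_ne_zero _ hp.ne_zero⟩
  have hunits : {x : ZMod (p ^ (k + 1)) | IsUnit x}.ncard = p ^ (k + 1) - p ^ k := by
    have h1 := Set.ncard_add_ncard_compl {x : ZMod (p ^ (k + 1)) | IsUnit x}
    have h2 : {x : ZMod (p ^ (k + 1)) | IsUnit x}ᶜ.ncard = p ^ k := ncard_not_isUnit hp k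
    rw [Nat.card_zmod] at h1
    omega
  rw [sqrtCount, ← hunits, ← ncard_prod]
  symm
  refine Set.ncard_congr (fun x _ => (x.1, x.1 * x.2)) ?_ ?_ ?_
  · rintro ⟨x, y⟩ ⟨hx, hy⟩
    refine ⟨hx, ?_⟩
    change (x * y) ^ 2 = _ * x ^ 2
    rw [mul_pow, show y ^ 2 = _ from hy, mul_comm]
  · rintro ⟨x, y⟩ ⟨x', y'⟩ ⟨hx, -⟩ - h
    simp only [Prod.mk.injEq] at h
    obtain ⟨rfl, h⟩ := h
    rw [hx.mul_left_cancel h]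
  · rintro ⟨x, y⟩ ⟨⟨u, rfl⟩, hy⟩
    refine ⟨(↑u, ↑u⁻¹ * y), ⟨u.isUnit, ?_⟩, ?_⟩
    · change (↑u⁻¹ * y) ^ 2 = _
      rw [mul_pow, show y ^ 2 = _ from hy, mul_left_comm, ← mul_pow, Units.inv_mul, one_pow, mul_one]
    · simp

/-- If `x` is a unit, `y / x` is a square root of `ε`. Otherwise, `ε` being a unit, `y` is a nonunit
too and both coordinates are divisible by `p`. -/
theorem coneCount_split (hp : p.Prime) {ε : ℤ} (hε : IsUnit ε) (k : ℕ) :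
    coneCount p ε (k + 1) = (p ^ (k + 1) - p ^ k) * sqrtCount p ε (k + 1) +
      {x : ZMod (p ^ k) × ZMod (p ^ k) | shift p 1 k x.2 ^ 2 =
        (ε : ZMod (p ^ (k + 1))) * shift p 1 k x.1 ^ 2}.ncard := by
  have : NeZero (p ^ (k + 1)) := ⟨pow_ne_zero _ hp.ne_zero⟩
  have hinj : Function.Injective (Prod.map (shift p 1 k) (shift p 1 k)) :=
    (shift_injective hp 1 k).prodMap (shift_injective hp 1 k)
  have hεu : IsUnit (ε : ZMod (p ^ (k + 1))) := hε.map (Int.castRingHom _)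
  rw [← ncard_cone_units hp, coneCount, ← Set.ncard_image_of_injective _ hinj,
    ← Set.ncard_union_eq]
  · congr 1
    ext ⟨x, y⟩
    simp only [Set.mem_ofPred_eq, Set.mem_union, Set.mem_image, Prod.exists, Prod.map_apply,
      Prod.mk.injEq]
    constructor
    · intro h
      by_cases hx : IsUnit x
      · exact Or.inl ⟨hx, h⟩
      · have hy : ¬ IsUnit y := by
          intro hy
          have := hy.pow 2
          rw [h] at this
          exact hx ((isUnit_pow_iff two_ne_zero).1 (isUnit_of_mul_isUnit_right this))
        obtain ⟨a, rfl⟩ := (not_isUnit_iff_exists_shift hp).1 hx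
        obtain ⟨b, rfl⟩ := (not_isUnit_iff_exists_shift hp).1 hy
        exact Or.inr ⟨a, b, h, rfl, rfl⟩
    · rintro (⟨-, h⟩ | ⟨a, b, h, rfl, rfl⟩)
      · exact h
      · exact h
  · refine Set.disjoint_left.2 ?_
    rintro _ ⟨h, -⟩ ⟨⟨a, b⟩, -, rfl⟩
    exact (not_isUnit_iff_exists_shift hp).2 ⟨a, rfl⟩ h

theorem coneCount_one (hp : p.Prime) {ε : ℤ} (hε : IsUnit ε) :
    coneCount p ε 1 = (p - 1) * sqrtCount p ε 1 + 1 := by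
  have h := coneCount_split hp hε 0
  have := subsingleton_zmod_pow_zero p
  refine h.trans ?_
  rw [show p ^ (0 + 1) - p ^ 0 = p - 1 by simp]
  congr 1
  rw [Set.ncard_eq_one]
  refine ⟨0, Set.ext fun x => ?_⟩
  simp only [Set.mem_ofPred_eq, Set.mem_singleton_iff, Subsingleton.elim x 0, Prod.snd_zero,
    Prod.fst_zero, map_zero, iff_true]
  ring

/-- For `x = p a`, `y = p b` the equation reads `b² = ε a²` modulo `p ^ k`, while `a` and `b` live
modulo `p ^ (k + 1)`, whence `p ^ 2` lifts. -/
theorem coneCount_add_two (hp : p.Prime) {ε : ℤ} (hε : IsUnit ε) (k : ℕ) :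
    coneCount p ε (k + 2) = (p ^ (k + 2) - p ^ (k + 1)) * sqrtCount p ε (k + 2) +
      p ^ 2 * coneCount p ε k := by
  rw [coneCount_split hp hε (k + 1), mul_comm (p ^ 2)]
  congr 1
  rw [coneCount]
  rw [← ncard_preimage_red_prod hp 1 k]
  congr 1
  ext ⟨x, y⟩
  simp only [Set.mem_ofPred_eq]
  have h1 : (ε : ZMod (p ^ (k + 1 + 1))) * shift p 1 (k + 1) x ^ 2 =
      shift p 2 k ((ε : ZMod (p ^ k)) * red p 1 k x ^ 2) := by
    rw [sq, shift_mul_shift, sq]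
    have := mul_shift (p := p) 2 k (ε : ZMod (p ^ (k + 2))) (red p 1 k x * red p 1 k x)
    rw [red_intCast] at this
    exact this
  rw [h1, sq, shift_mul_shift, ← sq]
  exact (shift_injective hp 2 k).eq_iff

/-- The first chart is the whole cone. The second is a free nonunit `x` together with a square root
of `ε`. In the third, `ε y² = 1` contradicts `y` being a nonunit. -/
theorem cocyclicCount_cone (hp : p.Prime) (ε : ℤ) (k : ℕ) :
    cocyclicCount (brMatrix 0 ε 0) p (k + 1) =
      coneCount p ε (k + 1) + p ^ k * sqrtCount p ε (k + 1) := by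
  have : NeZero (p ^ (k + 1)) := ⟨pow_ne_zero _ hp.ne_zero⟩
  rw [cocyclicCount_succ hp]
  simp only [quad_brMatrix, sub_self, Int.cast_zero, zero_mul, zero_sub]
  have h2 := ncard_prod {x : ZMod (p ^ (k + 1)) | ¬ IsUnit x}
    {y : ZMod (p ^ (k + 1)) | y ^ 2 = (ε : ZMod (p ^ (k + 1)))}
  simp only [Set.mem_ofPred_eq, ncard_not_isUnit hp] at h2
  have h3 : {x : ZMod (p ^ (k + 1)) × ZMod (p ^ (k + 1)) | ¬ IsUnit x.1 ∧ ¬ IsUnit x.2 ∧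
      -((ε : ZMod (p ^ (k + 1))) * x.2 ^ 2) + 1 ^ 2 = 0} = ∅ := by
    ext x
    simp only [Set.mem_ofPred_eq, Set.mem_empty_iff_false, iff_false]
    rintro ⟨-, hx, h⟩
    refine hx (IsUnit.of_mul_eq_one (ε * x.2) ?_)
    linear_combination -h
  rw [h3, Set.ncard_empty, add_zero, sqrtCount, ← h2, coneCount]
  simp only [neg_add_eq_zero, one_pow, mul_one, eq_comm]

/-- For two roots, `(z - y)(z + y) = 0`. The factors differ by the unit `2y`, so they are not both
divisible by `p`; one of them is a unit and the other vanishes. -/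
theorem sqrtCount_eq_two (hp : p.Prime) (hp2 : p ≠ 2) {ε : ℤ} (hε : IsUnit ε) (k : ℕ)
    (h : ∃ y : ZMod (p ^ (k + 1)), y ^ 2 = ε) : sqrtCount p ε (k + 1) = 2 := by
  have := nontrivial_zmod_pow hp k
  obtain ⟨y, hy⟩ := h
  have hεu : IsUnit (ε : ZMod (p ^ (k + 1))) := hε.map (Int.castRingHom _)
  have hyu : IsUnit y := (isUnit_pow_iff two_ne_zero).1 (hy ▸ hεu)
  have h2 : IsUnit (2 : ZMod (p ^ (k + 1))) := by
    have := (ZMod.isUnit_iff_coprime 2 (p ^ (k + 1))).2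
      (Nat.Coprime.pow_right _ ((Nat.coprime_primes Nat.prime_two hp).2 hp2.symm))
    exact_mod_cast this
  have h2y : IsUnit (2 * y) := h2.mul hyu
  rw [sqrtCount, Set.ncard_eq_two]
  refine ⟨y, -y, ?_, ?_⟩
  · intro hyy
    have : 2 * y = 0 := by linear_combination hyy
    exact not_isUnit_zero (this ▸ h2y)
  · ext z
    simp only [Set.mem_ofPred_eq, Set.mem_insert_iff, Set.mem_singleton_iff]
    constructor
    · intro hz
      have hprod : (z - y) * (z + y) = 0 := by linear_combination hz - hy
      by_cases hu : IsUnit (z - y)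
      · right
        exact eq_neg_of_add_eq_zero_left ((hu.mul_right_eq_zero).1 hprod)
      · by_cases hv : IsUnit (z + y)
        · left
          exact sub_eq_zero.1 ((hv.mul_left_eq_zero).1 hprod)
        · exfalso
          rw [isUnit_iff_castHom_ne_zero hp (Nat.succ_ne_zero k), not_not] at hu hv
          rw [isUnit_iff_castHom_ne_zero hp (Nat.succ_ne_zero k)] at h2y
          apply h2y
          rw [show 2 * y = (z + y) - (z - y) by ring, map_sub, hu, hv, sub_zero]
    · rintro (rfl | rfl)
      · exact hy
      · rw [neg_sq, hy]

theorem sqrtCount_one_of_odd (hp : p.Prime) (hp2 : p ≠ 2) (k : ℕ) : sqrtCount p 1 (k + 1) = 2 :=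
  sqrtCount_eq_two hp hp2 isUnit_one k ⟨1, by simp⟩

theorem sqrtCount_neg_one_of_mod_four_eq_one (hp : p.Prime) (hp4 : p % 4 = 1) (k : ℕ) :
    sqrtCount p (-1) (k + 1) = 2 := by
  have : Fact p.Prime := ⟨hp⟩
  refine sqrtCount_eq_two hp (by rintro rfl; norm_num at hp4) isUnit_one.neg k ?_
  obtain ⟨x, hx⟩ := (ZMod.exists_sq_eq_neg_one_iff (p := p)).2 (by omega)
  obtain ⟨a, rfl⟩ := ZMod.intCast_surjective x
  have hdvd : (p : ℤ) ∣ a ^ 2 - (-1) := by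
    rw [← ZMod.intCast_zmod_eq_zero_iff_dvd]
    push_cast
    rw [hx]; ring
  -- Instead of Hensel lifting: `a² ≡ -1` modulo `p` gives `a ^ (2 p ^ k) ≡ (-1) ^ (p ^ k) = -1`
  -- modulo `p ^ (k + 1)`, so `a ^ (p ^ k)` is a root.
  have h := dvd_sub_pow_of_dvd_sub hdvd k
  have hodd : Odd (p ^ k) := (hp.odd_of_ne_two (by rintro rfl; norm_num at hp4)).pow
  rw [hodd.neg_one_pow] at h
  refine ⟨((a ^ p ^ k : ℤ) : ZMod (p ^ (k + 1))), ?_⟩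
  rw [← Int.cast_pow, ← sub_eq_zero, ← Int.cast_sub, ZMod.intCast_zmod_eq_zero_iff_dvd]
  push_cast
  rwa [← pow_mul, mul_comm, pow_mul]

theorem sqrtCount_neg_one_of_mod_four_eq_three (hp : p.Prime) (hp4 : p % 4 = 3) (k : ℕ) :
    sqrtCount p (-1) (k + 1) = 0 := by
  have : Fact p.Prime := ⟨hp⟩
  have : NeZero (p ^ (k + 1)) := ⟨pow_ne_zero _ hp.ne_zero⟩
  rw [sqrtCount, Set.ncard_eq_zero]
  ext y
  simp only [Set.mem_ofPred_eq, Set.mem_empty_iff_false, iff_false]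
  intro hy
  have h := congrArg (ZMod.castHom (dvd_pow_self p (Nat.succ_ne_zero k)) (ZMod p)) hy
  rw [map_pow, map_intCast] at h
  exact ZMod.mod_four_ne_three_of_sq_eq_neg_one (h.trans (by simp)) hp4

theorem sqrtCount_two_neg_one (k : ℕ) : sqrtCount 2 (-1) (k + 2) = 0 := by
  have : NeZero (2 ^ (k + 2)) := ⟨by positivity⟩
  rw [sqrtCount, Set.ncard_eq_zero]
  ext y
  simp only [Set.mem_ofPred_eq, Set.mem_empty_iff_false, iff_false]
  intro hy
  have h := congrArg (ZMod.castHom (pow_dvd_pow 2 (Nat.le_add_left 2 k)) (ZMod (2 ^ 2))) hy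
  rw [map_pow, map_intCast] at h
  revert h
  generalize (ZMod.castHom (pow_dvd_pow 2 (Nat.le_add_left 2 k)) (ZMod (2 ^ 2))) y = z
  revert z
  decide

theorem sqrtCount_two_neg_one_one : sqrtCount 2 (-1) 1 = 1 := by
  rw [sqrtCount, Set.ncard_eq_one]
  exact ⟨1, by ext y; revert y; simp only [Set.mem_ofPred_eq, Set.mem_singleton_iff]; decide⟩

theorem sqrtCount_two_one_one : sqrtCount 2 1 1 = 1 := by
  rw [sqrtCount, Set.ncard_eq_one]
  exact ⟨1, by ext y; revert y; simp only [Set.mem_ofPred_eq, Set.mem_singleton_iff]; decide⟩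

theorem sqrtCount_two_one_two : sqrtCount 2 1 2 = 2 := by
  rw [sqrtCount, Set.ncard_eq_two]
  exact ⟨1, 3, by decide, by
    ext y; revert y
    simp only [Set.mem_ofPred_eq, Set.mem_insert_iff, Set.mem_singleton_iff]; decide⟩

/-- A root is odd, `a = 2t + 1`, and the equation becomes `2 ^ (k + 1) ∣ t (t + 1)`. As `t` and `t +
1` have opposite parity, one of them takes the whole power; this leaves `± 1` and `± 1 + 2 ^ (k +
2)`. -/
theorem sqrtCount_two_one (k : ℕ) : sqrtCount 2 1 (k + 3) = 4 := by
  have hset : {y : ZMod (2 ^ (k + 3)) | y ^ 2 = ((1 : ℤ) : ZMod (2 ^ (k + 3)))} =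
      (({((1 : ℤ) : ZMod (2 ^ (k + 3))), ((-1 : ℤ) : ZMod (2 ^ (k + 3))),
        ((1 + 2 ^ (k + 2) : ℤ) : ZMod (2 ^ (k + 3))),
        ((-1 + 2 ^ (k + 2) : ℤ) : ZMod (2 ^ (k + 3)))} : Finset (ZMod (2 ^ (k + 3)))) :
        Set (ZMod (2 ^ (k + 3)))) := by
    ext y
    obtain ⟨a, rfl⟩ := ZMod.intCast_surjective y
    simp only [Set.mem_ofPred_eq, Finset.coe_insert, Finset.coe_singleton, Set.mem_insert_iff,
      Set.mem_singleton_iff, ← Int.cast_pow, ZMod.intCast_eq_intCast_iff_dvd_sub]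
    push_cast
    constructor
    · intro h
      have hodd : Odd a := by
        rw [← Int.not_even_iff_odd]
        rintro ⟨t, rfl⟩
        have h2 : (2 : ℤ) ∣ 2 ^ (k + 3) := dvd_pow_self 2 (by omega)
        have h3 := h2.trans h
        have h4 : (t + t) ^ 2 = 2 * (2 * (t * t)) := by ring
        omega
      obtain ⟨t, rfl⟩ := hodd
      have ht : (2 : ℤ) ^ (k + 1) ∣ t * (t + 1) := by
        have h4 : (4 : ℤ) * 2 ^ (k + 1) ∣ 4 * (t * (t + 1)) := by
          have e1 : (4 : ℤ) * 2 ^ (k + 1) = 2 ^ (k + 3) := by ring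
          have e2 : -(4 * (t * (t + 1))) = 1 - (2 * t + 1) ^ 2 := by ring
          rwa [← dvd_neg, e1, e2]
        exact (mul_dvd_mul_iff_left (by norm_num)).1 h4
      have hsplit : (2 : ℤ) ^ (k + 1) ∣ t ∨ (2 : ℤ) ^ (k + 1) ∣ t + 1 := by
        rcases Int.even_or_odd t with ht2 | ht2
        · left
          have : IsCoprime ((2 : ℤ) ^ (k + 1)) (t + 1) :=
            (Int.isCoprime_two_left.2 ht2.add_one).pow_left
          exact this.dvd_of_dvd_mul_right ht
        · right
          have : IsCoprime ((2 : ℤ) ^ (k + 1)) t :=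
            (Int.isCoprime_two_left.2 ht2).pow_left
          exact this.dvd_of_dvd_mul_left ht
      rcases hsplit with ⟨s, rfl⟩ | ⟨s, hs⟩
      · rcases Int.even_or_odd s with ⟨r, rfl⟩ | ⟨r, rfl⟩
        · exact Or.inl ⟨-r, by ring⟩
        · exact Or.inr (Or.inr (Or.inl ⟨-r, by ring⟩))
      · obtain rfl : t = 2 ^ (k + 1) * s - 1 := by linarith
        rcases Int.even_or_odd s with ⟨r, rfl⟩ | ⟨r, rfl⟩
        · exact Or.inr (Or.inl ⟨-r, by ring⟩)
        · exact Or.inr (Or.inr (Or.inr ⟨-r, by ring⟩))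
    · rintro (⟨c, hc⟩ | ⟨c, hc⟩ | ⟨c, hc⟩ | ⟨c, hc⟩)
      · obtain rfl : a = 1 - 2 ^ (k + 3) * c := by linarith
        exact ⟨2 * c - 2 ^ (k + 3) * c ^ 2, by ring⟩
      · obtain rfl : a = -1 - 2 ^ (k + 3) * c := by linarith
        exact ⟨-2 * c - 2 ^ (k + 3) * c ^ 2, by ring⟩
      · obtain rfl : a = 1 + 2 ^ (k + 2) - 2 ^ (k + 3) * c := by linarith
        exact ⟨-1 - 2 ^ (k + 1) + 2 * c * (1 + 2 ^ (k + 2)) - 2 ^ (k + 3) * c ^ 2, by ring⟩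
      · obtain rfl : a = -1 + 2 ^ (k + 2) - 2 ^ (k + 3) * c := by linarith
        exact ⟨1 - 2 ^ (k + 1) + 2 * c * (-1 + 2 ^ (k + 2)) - 2 ^ (k + 3) * c ^ 2, by ring⟩
  -- The modulus is `8 * 2 ^ k`. The pairwise differences of the four roots are either not divisible
  -- by `4` or equal to `4 * 2 ^ k`, so none is a multiple of it.
  have hne : ∀ a b : ℤ, (∀ c : ℤ, b - a ≠ 8 * 2 ^ k * c) →
      (a : ZMod (2 ^ (k + 3))) ≠ (b : ZMod (2 ^ (k + 3))) := by
    intro a b h heq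
    rw [ZMod.intCast_eq_intCast_iff_dvd_sub] at heq
    obtain ⟨c, hc⟩ := heq
    exact h c (by rw [hc]; push_cast; ring)
  have hpos : (0 : ℤ) < 2 ^ k := by positivity
  have e2 : (2 : ℤ) ^ (k + 2) = 4 * 2 ^ k := by ring
  have hmul : ∀ c : ℤ, 8 * 2 ^ k * c = 4 * (2 * (2 ^ k * c)) := fun c => by ring
  have hself : ∀ c : ℤ, (4 : ℤ) * 2 ^ k ≠ 8 * 2 ^ k * c := by
    intro c hc
    have : (4 * 2 ^ k : ℤ) * 1 = (4 * 2 ^ k) * (2 * c) := by linear_combination hc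
    have := mul_left_cancel₀ (by positivity) this
    omega
  rw [sqrtCount, hset, Set.ncard_coe_finset, Finset.card_insert_of_notMem,
    Finset.card_insert_of_notMem, Finset.card_insert_of_notMem, Finset.card_singleton]
  · rw [Finset.mem_singleton]
    refine hne _ _ fun c => ?_
    rw [hmul]; omega
  · rw [Finset.mem_insert, Finset.mem_singleton, not_or]
    refine ⟨hne _ _ fun c => ?_, hne _ _ fun c => ?_⟩
    · rw [hmul, e2]; omega
    · have := hself c
      intro h; apply this; rw [← h, e2]; ring
  · rw [Finset.mem_insert, Finset.mem_insert, Finset.mem_singleton, not_or, not_or]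
    refine ⟨hne _ _ fun c => ?_, hne _ _ fun c => ?_, hne _ _ fun c => ?_⟩
    · rw [hmul]; omega
    · have := hself c
      intro h; apply this; rw [← h, e2]; ring
    · rw [hmul, e2]; omega

/-! ### The conic `4xy + z² = 0` of `sl₂` -/

theorem cocyclicCount_sl2_of_odd (hp : p.Prime) (hp2 : p ≠ 2) (k : ℕ) :
    cocyclicCount (brMatrix (-2) 0 2) p (k + 1) = p ^ (k + 1) + p ^ k := by
  have : NeZero (p ^ (k + 1)) := ⟨pow_ne_zero _ hp.ne_zero⟩
  have h4 : IsUnit (4 : ZMod (p ^ (k + 1))) := by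
    have := (ZMod.isUnit_iff_coprime 2 (p ^ (k + 1))).2
      (Nat.Coprime.pow_right _ ((Nat.coprime_primes Nat.prime_two hp).2 hp2.symm))
    have := this.pow 2
    norm_num at this
    exact this
  obtain ⟨u, hu⟩ := h4
  have hinv : (4 : ZMod (p ^ (k + 1))) * ↑u⁻¹ = 1 := by rw [← hu, Units.mul_inv]
  -- As `4` is a unit, the conic is in each of the first two charts a graph over the coordinate `b =
  -- z`; the value `-z² / 4` is a unit exactly when `z` is.
  have hsol : ∀ a b : ZMod (p ^ (k + 1)), 4 * a + b ^ 2 = 0 ↔ a = -(↑u⁻¹ * b ^ 2) := by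
    intro a b
    constructor
    · intro h
      linear_combination (↑u⁻¹ : ZMod (p ^ (k + 1))) * h - a * hinv
    · rintro rfl
      linear_combination -b ^ 2 * hinv
  have hunit : ∀ b : ZMod (p ^ (k + 1)), IsUnit (-(↑u⁻¹ * b ^ 2) : ZMod (p ^ (k + 1))) ↔
      IsUnit b := by
    intro b
    rw [IsUnit.neg_iff, Units.isUnit_units_mul, isUnit_pow_iff two_ne_zero]
  rw [cocyclicCount_succ hp]
  simp only [quad_brMatrix]
  norm_num only [one_mul, mul_one, one_pow, zero_mul, sub_zero, Int.cast_zero, Int.cast_ofNat]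
  simp only [hsol]
  have h1 : {x : ZMod (p ^ (k + 1)) × ZMod (p ^ (k + 1)) | x.1 = -(↑u⁻¹ * x.2 ^ 2)}.ncard =
      p ^ (k + 1) := by
    have := Set.ncard_image_of_injective (Set.univ : Set (ZMod (p ^ (k + 1))))
      (f := fun b => ((-(↑u⁻¹ * b ^ 2) : ZMod (p ^ (k + 1))), b)) fun a b h => (Prod.mk.inj h).2
    rw [Set.ncard_univ, Nat.card_zmod] at this
    refine Eq.trans ?_ this
    congr 1
    ext ⟨a, b⟩
    simp [eq_comm]
  have h2 : {x : ZMod (p ^ (k + 1)) × ZMod (p ^ (k + 1)) | ¬ IsUnit x.1 ∧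
      x.1 = -(↑u⁻¹ * x.2 ^ 2)}.ncard = p ^ k := by
    have := Set.ncard_image_of_injective {b : ZMod (p ^ (k + 1)) | ¬ IsUnit b}
      (f := fun b => ((-(↑u⁻¹ * b ^ 2) : ZMod (p ^ (k + 1))), b)) fun a b h => (Prod.mk.inj h).2
    rw [ncard_not_isUnit hp] at this
    refine Eq.trans ?_ this
    congr 1
    ext ⟨a, b⟩
    simp only [Set.mem_ofPred_eq, Set.mem_image, Prod.mk.injEq, exists_eq_right_right]
    constructor
    · rintro ⟨h, rfl⟩
      exact ⟨by rwa [hunit] at h, rfl⟩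
    · rintro ⟨h, rfl⟩
      exact ⟨by rwa [hunit], rfl⟩
  have h3 : {x : ZMod (p ^ (k + 1)) × ZMod (p ^ (k + 1)) | ¬ IsUnit x.1 ∧ ¬ IsUnit x.2 ∧
      4 * (x.1 * x.2) + 1 = 0} = ∅ := by
    ext x
    simp only [Set.mem_ofPred_eq, Set.mem_empty_iff_false, iff_false]
    rintro ⟨hx, -, h⟩
    refine hx (IsUnit.of_mul_eq_one (-4 * x.2) ?_)
    linear_combination -h
  rw [h1, h2, h3, Set.ncard_empty, add_zero]

/-- The second coordinate must be even, say `2c` with `c` modulo half the modulus. Dividing by `2`,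
the first coordinate is determined modulo half the modulus as `-2c²`, so it has two lifts. This
serves the second chart of `sl₂` at `2`. -/
theorem ncard_two_mul_add_sq (k : ℕ) :
    {x : ZMod (2 ^ k) × ZMod (2 ^ k) | 2 * x.1 + x.2 ^ 2 = 0}.ncard = 2 ^ k := by
  cases k with
  | zero =>
    have := subsingleton_zmod_pow_zero 2
    rw [pow_zero, Set.ncard_eq_one]
    refine ⟨0, Set.ext fun x => ?_⟩
    simp only [Set.mem_ofPred_eq, Set.mem_singleton_iff]
    exact ⟨fun _ => Subsingleton.elim _ _, fun _ => Subsingleton.elim _ _⟩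
  | succ k =>
    let f : ZMod (2 ^ (k + 1)) × ZMod (2 ^ k) →+ ZMod (2 ^ k) × ZMod (2 ^ k) :=
      AddMonoidHom.prodMap (red 2 1 k).toAddMonoidHom (AddMonoidHom.id _)
    have hf : Function.Surjective f :=
      Function.Surjective.prodMap (red_surjective 2 1 k) Function.surjective_id
    have key := ncard_preimage_of_surjective f hf {x | x.1 = -(2 * x.2 ^ 2)} (c := 2)
      (by simp only [Nat.card_prod, Nat.card_zmod]; ring)
    have hgraph : {x : ZMod (2 ^ k) × ZMod (2 ^ k) | x.1 = -(2 * x.2 ^ 2)}.ncard = 2 ^ k := by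
      have := Set.ncard_image_of_injective (Set.univ : Set (ZMod (2 ^ k)))
        (f := fun b => ((-(2 * b ^ 2) : ZMod (2 ^ k)), b)) fun a b h => (Prod.mk.inj h).2
      rw [Set.ncard_univ, Nat.card_zmod] at this
      refine Eq.trans ?_ this
      congr 1
      ext ⟨a, b⟩
      simp [eq_comm]
    have hinj : Function.Injective (Prod.map (id : ZMod (2 ^ (k + 1)) → _) (shift 2 1 k)) :=
      Function.injective_id.prodMap (shift_injective Nat.prime_two 1 k)
    rw [hgraph, ← pow_succ, ← Set.ncard_image_of_injective _ hinj] at key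
    refine Eq.trans ?_ key
    congr 1
    ext ⟨a, b⟩
    have hiff : ∀ c : ZMod (2 ^ k), 2 * a + shift 2 1 k c ^ 2 = 0 ↔
        red 2 1 k a = -(2 * c ^ 2) := by
      intro c
      have h1 : 2 * a = shift 2 1 k (red 2 1 k a) := by
        have := pow_mul_eq_shift_red 1 k a
        rwa [pow_one] at this
      have h2 : red 2 1 k (shift 2 1 k c) = 2 * c := by
        obtain ⟨n, rfl⟩ := ZMod.intCast_surjective c
        rw [shift_intCast, red_intCast]
        push_cast
        ring
      rw [h1, sq, mul_shift, h2, ← map_add, shift_eq_zero_iff Nat.prime_two,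
        add_eq_zero_iff_eq_neg, mul_assoc, ← sq]
    simp only [Set.mem_ofPred_eq, Set.mem_image, Set.mem_preimage, Prod.exists, Prod.map_apply,
      Prod.mk.injEq, id]
    constructor
    · intro h
      have hb : ¬ IsUnit b := by
        intro hb
        have h2 : b ^ 2 = 2 * -a := by linear_combination h
        have := isUnit_of_mul_isUnit_left (h2 ▸ hb.pow 2)
        have h3 := (ZMod.isUnit_iff_coprime 2 (2 ^ (k + 1))).1 (by exact_mod_cast this)
        simp at h3
      obtain ⟨c, rfl⟩ := (not_isUnit_iff_exists_shift Nat.prime_two).1 hb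
      exact ⟨a, c, (hiff c).1 h, rfl, rfl⟩
    · rintro ⟨a', c, h, rfl, rfl⟩
      exact (hiff c).2 h

theorem cocyclicCount_sl2_two_one : cocyclicCount (brMatrix (-2) 0 2) 2 1 = 3 := by
  have h := cocyclicCount_succ (M := brMatrix (-2) 0 2) Nat.prime_two 0
  refine h.trans ?_
  simp only [quad_brMatrix]
  have h4 : ((2 - -2 : ℤ) : ZMod (2 ^ (0 + 1))) = 0 := by decide
  have hu : {x : ZMod (2 ^ (0 + 1)) | ¬ IsUnit x} = {0} := by
    ext y
    simp only [Set.mem_ofPred_eq, Set.mem_singleton_iff, not_isUnit_iff_exists_shift Nat.prime_two]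
    have := subsingleton_zmod_pow_zero 2
    exact ⟨fun ⟨z, hz⟩ => by rw [← hz, Subsingleton.elim z 0, map_zero], fun h => ⟨0, by simp [h]⟩⟩
  have hs : {x : ZMod (2 ^ (0 + 1)) | x ^ 2 = 0} = {0} := by
    ext y; revert y
    simp only [Set.mem_ofPred_eq, Set.mem_singleton_iff]; decide
  have h1 : {x : ZMod (2 ^ (0 + 1)) × ZMod (2 ^ (0 + 1)) | x.2 ^ 2 = 0}.ncard = 2 := by
    have h := ncard_prod (Set.univ : Set (ZMod (2 ^ (0 + 1)))) {y : ZMod (2 ^ (0 + 1)) | y ^ 2 = 0}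
    simp only [Set.mem_univ, true_and, Set.mem_ofPred_eq] at h
    rw [h, hs, Set.ncard_univ, Nat.card_zmod, Set.ncard_singleton]
    rfl
  have h2 : {x : ZMod (2 ^ (0 + 1)) × ZMod (2 ^ (0 + 1)) | ¬ IsUnit x.1 ∧ x.2 ^ 2 = 0}.ncard =
      1 := by
    have h := ncard_prod {x : ZMod (2 ^ (0 + 1)) | ¬ IsUnit x} {y : ZMod (2 ^ (0 + 1)) | y ^ 2 = 0}
    simp only [Set.mem_ofPred_eq] at h
    rw [h, hs, hu, Set.ncard_singleton]
  have := nontrivial_zmod_pow Nat.prime_two 0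
  simp only [h4, zero_mul, Int.cast_zero, sub_zero, zero_add, one_pow, one_ne_zero, and_false,
    Set.ofPred_false, Set.ncard_empty]
  rw [h1, h2]

/-- In both surviving charts `z = 2c`, and the equation becomes `x + c² = 0` modulo `2 ^ k`, where
`x` is the other free coordinate. In the first chart `x` has four lifts and `c` two, giving `2 ^ (k
+ 3)`. In the second also `x = 2d`, which leaves `2d + c² = 0` modulo `2 ^ k` with four lifts,
giving `2 ^ (k + 2)`. -/
theorem cocyclicCount_sl2_two (k : ℕ) :
    cocyclicCount (brMatrix (-2) 0 2) 2 (k + 2) = 3 * 2 ^ (k + 2) := by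
  rw [cocyclicCount_succ Nat.prime_two (k + 1)]
  simp only [quad_brMatrix]
  norm_num only [one_mul, mul_one, one_pow, zero_mul, sub_zero, Int.cast_zero, Int.cast_ofNat]
  have h4u : ∀ a b : ZMod (2 ^ (k + 1 + 1)), 4 * a + b ^ 2 = 0 → ¬ IsUnit b := by
    intro a b h hb
    have h2 : b ^ 2 = 2 * (-2 * a) := by linear_combination h
    have := isUnit_of_mul_isUnit_left (h2 ▸ hb.pow 2)
    have h3 := (ZMod.isUnit_iff_coprime 2 (2 ^ (k + 1 + 1))).1 (by exact_mod_cast this)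
    simp at h3
  have hiff : ∀ (a : ZMod (2 ^ (k + 1 + 1))) (c : ZMod (2 ^ (k + 1))),
      4 * a + shift 2 1 (k + 1) c ^ 2 = 0 ↔ red 2 2 k a + red 2 1 k c ^ 2 = 0 := by
    intro a c
    have h1 : 4 * a = shift 2 2 k (red 2 2 k a) := by
      have := pow_mul_eq_shift_red (p := 2) 2 k a
      norm_num at this
      exact this
    rw [sq, shift_mul_shift, h1, ← sq]
    exact (map_add (shift 2 2 k) _ _).symm ▸ shift_eq_zero_iff Nat.prime_two
  have h1 : {x : ZMod (2 ^ (k + 1 + 1)) × ZMod (2 ^ (k + 1 + 1)) | 4 * x.1 + x.2 ^ 2 = 0}.ncard =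
      2 ^ (k + 3) := by
    let f : ZMod (2 ^ (k + 2)) × ZMod (2 ^ (k + 1)) →+ ZMod (2 ^ k) × ZMod (2 ^ k) :=
      AddMonoidHom.prodMap (red 2 2 k).toAddMonoidHom (red 2 1 k).toAddMonoidHom
    have hf : Function.Surjective f :=
      Function.Surjective.prodMap (red_surjective 2 2 k) (red_surjective 2 1 k)
    have key := ncard_preimage_of_surjective f hf {x | x.1 = -x.2 ^ 2} (c := 8)
      (by simp only [Nat.card_prod, Nat.card_zmod]; ring)
    have hgraph : {x : ZMod (2 ^ k) × ZMod (2 ^ k) | x.1 = -x.2 ^ 2}.ncard = 2 ^ k := by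
      have := Set.ncard_image_of_injective (Set.univ : Set (ZMod (2 ^ k)))
        (f := fun b => ((-b ^ 2 : ZMod (2 ^ k)), b)) fun a b h => (Prod.mk.inj h).2
      rw [Set.ncard_univ, Nat.card_zmod] at this
      refine Eq.trans ?_ this
      congr 1
      ext ⟨a, b⟩
      simp [eq_comm]
    have hinj : Function.Injective (Prod.map (id : ZMod (2 ^ (k + 2)) → _) (shift 2 1 (k + 1))) :=
      Function.injective_id.prodMap (shift_injective Nat.prime_two 1 (k + 1))
    rw [hgraph, ← Set.ncard_image_of_injective _ hinj, show 2 ^ k * 8 = 2 ^ (k + 3) by ring] at key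
    refine Eq.trans ?_ key
    congr 1
    ext ⟨a, b⟩
    constructor
    · intro h
      obtain ⟨c, rfl⟩ := (not_isUnit_iff_exists_shift Nat.prime_two).1 (h4u a b h)
      exact ⟨(a, c), eq_neg_of_add_eq_zero_left ((hiff a c).1 h), rfl⟩
    · rintro ⟨⟨a', c⟩, h, h'⟩
      obtain ⟨rfl, rfl⟩ := Prod.mk.inj h'
      exact (hiff _ c).2 (add_eq_zero_iff_eq_neg.2 h)
  have h2 : {x : ZMod (2 ^ (k + 1 + 1)) × ZMod (2 ^ (k + 1 + 1)) | ¬ IsUnit x.1 ∧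
      4 * x.1 + x.2 ^ 2 = 0}.ncard = 2 ^ (k + 2) := by
    have key := ncard_preimage_red_prod Nat.prime_two 1 k {x | 2 * x.1 + x.2 ^ 2 = 0}
    have hinj : Function.Injective (Prod.map (shift 2 1 (k + 1)) (shift 2 1 (k + 1))) :=
      (shift_injective Nat.prime_two 1 (k + 1)).prodMap (shift_injective Nat.prime_two 1 (k + 1))
    rw [ncard_two_mul_add_sq, ← Set.ncard_image_of_injective _ hinj, mul_one, ← pow_add] at key
    refine Eq.trans ?_ key
    congr 1
    have hred : ∀ c : ZMod (2 ^ (k + 1)), red 2 2 k (shift 2 1 (k + 1) c) = 2 * red 2 1 k c := by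
      intro c
      obtain ⟨n, rfl⟩ := ZMod.intCast_surjective c
      rw [shift_intCast, red_intCast]
      rw [red_intCast]
      push_cast
      ring
    ext ⟨a, b⟩
    constructor
    · rintro ⟨ha, h⟩
      obtain ⟨c, rfl⟩ := (not_isUnit_iff_exists_shift Nat.prime_two).1 (h4u a b h)
      obtain ⟨d, rfl⟩ := (not_isUnit_iff_exists_shift Nat.prime_two).1 ha
      refine ⟨(d, c), ?_, rfl⟩
      have := (hiff _ c).1 h
      rw [hred] at this
      exact this
    · rintro ⟨⟨d, c⟩, h, h'⟩
      obtain ⟨rfl, rfl⟩ := Prod.mk.inj h'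
      refine ⟨(not_isUnit_iff_exists_shift Nat.prime_two).2 ⟨d, rfl⟩, (hiff _ c).2 ?_⟩
      rw [hred]
      exact h
  have h3 : {x : ZMod (2 ^ (k + 1 + 1)) × ZMod (2 ^ (k + 1 + 1)) | ¬ IsUnit x.1 ∧ ¬ IsUnit x.2 ∧
      4 * (x.1 * x.2) + 1 = 0} = ∅ := by
    ext x
    simp only [Set.mem_ofPred_eq, Set.mem_empty_iff_false, iff_false]
    rintro ⟨hx, -, h⟩
    refine hx (IsUnit.of_mul_eq_one (-4 * x.2) ?_)
    linear_combination -h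
  rw [h1, h2, h3, Set.ncard_empty, add_zero]
  ring

end CotypeDensity

namespace CotypeDensity

open scoped Matrix
open PowerSeries (X mk coeff)

variable {M : Matrix (Fin 3) (Fin 3) ℤ} {p : ℕ}

/-! ### Local generating series -/

/-- The generating series of the numbers of closed sublattices of index `p ^ k` and corank at
most `m`. -/
noncomputable def countSeries (M : Matrix (Fin 3) (Fin 3) ℤ) (p m : ℕ) : PowerSeries ℝ :=
  mk fun k => (closedCount M m (p ^ k) : ℝ)

/-- The generating series of `rankCount`. -/
noncomputable def rankSeries (M : Matrix (Fin 3) (Fin 3) ℤ) (p j : ℕ) : PowerSeries ℝ :=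
  mk fun k => (rankCount M p j k : ℝ)

theorem coeff_natCast_mul (a : ℕ) (F : PowerSeries ℝ) (n : ℕ) :
    coeff n ((a : PowerSeries ℝ) * F) = a * coeff n F := by
  rw [← map_natCast (PowerSeries.C (R := ℝ)), PowerSeries.coeff_C_mul]

theorem natCast_powerSeries_ne_zero {a : ℕ} (ha : a ≠ 0) : (a : PowerSeries ℝ) ≠ 0 := by
  intro h
  have := congrArg (coeff 0) h
  simp at this
  exact ha this

theorem coeff_X_sq_mul (F : PowerSeries ℝ) (k : ℕ) : coeff (k + 1 + 1) (X ^ 2 * F) = coeff k F :=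
  PowerSeries.coeff_X_pow_mul F 2 k

theorem coeff_X_cube_mul (F : PowerSeries ℝ) (k : ℕ) :
    coeff (k + 1 + 1 + 1) (X ^ 3 * F) = coeff k F :=
  PowerSeries.coeff_X_pow_mul F 3 k

theorem countSeries_eq_sum (hp : p.Prime) (m : ℕ) :
    countSeries M p m = ∑ j ∈ Finset.range (m + 1), rankSeries M p j := by
  ext k
  simp [countSeries, rankSeries, closedCount_prime_pow hp]

theorem rankSeries_zero (hp : p.Prime) : rankSeries M p 0 = 1 := by
  ext k
  rw [rankSeries, PowerSeries.coeff_mk, PowerSeries.coeff_one]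
  split_ifs with h
  · rw [h, rankCount_zero_zero, Nat.cast_one]
  · rw [rankCount_zero_left hp h, Nat.cast_zero]

theorem rankSeries_two (hp : p.Prime) :
    rankSeries M p 2 = X ^ 2 * (((p ^ 2 + p + 1 : ℕ) : PowerSeries ℝ) * rankSeries M p 0 +
      ((p ^ 2 + p : ℕ) : PowerSeries ℝ) * rankSeries M p 1 +
      ((p ^ 2 : ℕ) : PowerSeries ℝ) * rankSeries M p 2) := by
  ext k
  rw [PowerSeries.coeff_X_pow_mul']
  split_ifs with h
  · obtain ⟨k, rfl⟩ := Nat.exists_eq_add_of_le' h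
    rw [Nat.add_sub_cancel, map_add, map_add, coeff_natCast_mul, coeff_natCast_mul,
      coeff_natCast_mul]
    simp only [rankSeries, PowerSeries.coeff_mk]
    rw [rankCount_two hp]
    push_cast
    ring
  · rw [rankSeries, PowerSeries.coeff_mk, rankCount_eq_zero_of_lt hp (by omega), Nat.cast_zero]

theorem rankSeries_three (hp : p.Prime) :
    rankSeries M p 3 = X ^ 3 * countSeries (p • M) p 3 := by
  ext k
  rw [PowerSeries.coeff_X_pow_mul']
  split_ifs with h
  · obtain ⟨k, rfl⟩ := Nat.exists_eq_add_of_le' h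
    rw [Nat.add_sub_cancel, rankSeries, countSeries, PowerSeries.coeff_mk, PowerSeries.coeff_mk,
      rankCount_three hp]
  · rw [rankSeries, PowerSeries.coeff_mk, rankCount_eq_zero_of_lt hp (by omega), Nat.cast_zero]

theorem countSeries_one (hp : p.Prime) : countSeries M p 1 = 1 + rankSeries M p 1 := by
  rw [countSeries_eq_sum hp, Finset.sum_range_succ, Finset.sum_range_one, rankSeries_zero hp]

theorem countSeries_two (hp : p.Prime) :
    countSeries M p 2 * (1 - (p : PowerSeries ℝ) ^ 2 * X ^ 2) =
      countSeries M p 1 * (1 + (p : PowerSeries ℝ) * X ^ 2) + X ^ 2 := by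
  have h2 : countSeries M p 2 = countSeries M p 1 + rankSeries M p 2 := by
    rw [countSeries_eq_sum hp, countSeries_eq_sum hp, Finset.sum_range_succ]
  have h := rankSeries_two (M := M) hp
  rw [rankSeries_zero hp] at h
  rw [h2, countSeries_one hp]
  push_cast at h
  linear_combination h

theorem countSeries_three (hp : p.Prime) :
    countSeries M p 3 = countSeries M p 2 + X ^ 3 * countSeries (p • M) p 3 := by
  rw [← rankSeries_three hp, countSeries_eq_sum hp, countSeries_eq_sum hp, Finset.sum_range_succ]

/-- Modulo `p` the form of `p M` vanishes, so all `p ^ 2 + p + 1` points count in degree one; in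
higher degree the coefficients are `p ^ 2` times those of `M` one degree lower. -/
theorem countSeries_one_smul (hp : p.Prime) :
    countSeries (p • M) p 1 = 1 + ((p : PowerSeries ℝ) ^ 2 + (p : PowerSeries ℝ) + 1) * X +
      (p : PowerSeries ℝ) ^ 2 * X * (countSeries M p 1 - 1) := by
  have h1 : (p : PowerSeries ℝ) ^ 2 + (p : PowerSeries ℝ) + 1 = ((p ^ 2 + p + 1 : ℕ) : PowerSeries ℝ) := by
    push_cast; ring
  have h2 : (p : PowerSeries ℝ) ^ 2 * X * (countSeries M p 1 - 1) =
      ((p ^ 2 : ℕ) : PowerSeries ℝ) * (X * (countSeries M p 1 - 1)) := by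
    push_cast; ring
  rw [h1, h2]
  have hc : ∀ M' : Matrix (Fin 3) (Fin 3) ℤ, ∀ k, coeff k (countSeries M' p 1) =
      cocyclicCount M' p k := fun M' k => by
    rw [countSeries, PowerSeries.coeff_mk, cocyclicCount]
  ext k
  rw [map_add, map_add, coeff_natCast_mul, coeff_natCast_mul, hc]
  rcases k with _ | _ | k
  · simp [cocyclicCount_zero hp]
  · rw [PowerSeries.coeff_succ_X_mul, zero_add, cocyclicCount_smul_one hp, map_sub, hc,
      cocyclicCount_zero hp]
    simp [PowerSeries.coeff_one]
  · rw [PowerSeries.coeff_succ_X_mul, cocyclicCount_smul hp, map_sub, hc]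
    simp [PowerSeries.coeff_one, PowerSeries.coeff_X]

/-- The denominator of the local series of all closed sublattices. -/
noncomputable def denomSeries (p : ℕ) : PowerSeries ℝ :=
  (1 - (p : PowerSeries ℝ) ^ 2 * X ^ 2) * (1 - X ^ 3) * (1 - (p : PowerSeries ℝ) ^ 2 * X ^ 4)

/-- Let `E M` be the difference of the two sides. The rank two and rank three recursions, with the
formula for the cocyclic series of `p M`, give `E M = X ^ 3 * E (p • M)` for every `M`. Iterating,
`E M` is divisible by every power of `X`, so it is zero. -/
theorem denomSeries_mul_countSeries (hp : p.Prime) (M : Matrix (Fin 3) (Fin 3) ℤ) :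
    denomSeries p * countSeries M p 3 =
      (1 + (p : PowerSeries ℝ) * X ^ 2) * ((1 - X ^ 3) * countSeries M p 1 + X ^ 3 +
        ((p : PowerSeries ℝ) + 1) * X ^ 4) + X ^ 2 * (1 - (p : PowerSeries ℝ) ^ 2 * X ^ 4) := by
  rw [← sub_eq_zero]
  set E : Matrix (Fin 3) (Fin 3) ℤ → PowerSeries ℝ := fun M =>
    denomSeries p * countSeries M p 3 -
      ((1 + (p : PowerSeries ℝ) * X ^ 2) * ((1 - X ^ 3) * countSeries M p 1 + X ^ 3 +
        ((p : PowerSeries ℝ) + 1) * X ^ 4) + X ^ 2 * (1 - (p : PowerSeries ℝ) ^ 2 * X ^ 4)) with hE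
  change E M = 0
  have hrec : ∀ M, E M = X ^ 3 * E (p • M) := by
    intro M
    have h1 := countSeries_two (M := M) hp
    have h2 := countSeries_three (M := M) hp
    have h3 := countSeries_one_smul (M := M) hp
    simp only [hE]
    rw [h2, h3, denomSeries]
    linear_combination (1 - X ^ 3) * (1 - (p : PowerSeries ℝ) ^ 2 * X ^ 4) * h1
  have hcoeff : ∀ n M, coeff n (E M) = 0 := by
    intro n
    induction n using Nat.strong_induction_on with
    | _ n ih =>
      intro M
      rw [hrec, PowerSeries.coeff_X_pow_mul']
      split_ifs with h
      · exact ih _ (by omega) _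
      · rfl
  ext n
  rw [hcoeff, map_zero]

/-! ### The cocyclic local series -/

/-- The geometric series. -/
noncomputable def geomSeries (a : ℝ) : PowerSeries ℝ := mk fun k => a ^ k

theorem geomSeries_eq (a : ℕ) : geomSeries a = 1 + (a : PowerSeries ℝ) * X * geomSeries a := by
  rw [mul_assoc]
  ext k
  rw [map_add, coeff_natCast_mul]
  cases k with
  | zero => simp [geomSeries]
  | succ k =>
    rw [PowerSeries.coeff_succ_X_mul]
    simp [geomSeries, PowerSeries.coeff_one, pow_succ, mul_comm]

theorem coeff_countSeries_one (k : ℕ) :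
    coeff k (countSeries M p 1) = (cocyclicCount M p k : ℝ) := by
  rw [countSeries, PowerSeries.coeff_mk, cocyclicCount]

theorem countSeries_one_ab (hp : p.Prime) :
    countSeries 0 p 1 * (1 - (p : PowerSeries ℝ) ^ 2 * X) = 1 + ((p : PowerSeries ℝ) + 1) * X := by
  have h : countSeries 0 p 1 = 1 + ((p ^ 2 + p + 1 : ℕ) : PowerSeries ℝ) *
      (X * geomSeries ((p ^ 2 : ℕ) : ℝ)) := by
    ext k
    rw [coeff_countSeries_one, map_add, coeff_natCast_mul]
    cases k with
    | zero => simp [cocyclicCount_zero hp]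
    | succ k =>
      rw [PowerSeries.coeff_succ_X_mul, cocyclicCount_zero_matrix hp]
      simp [geomSeries, PowerSeries.coeff_one, pow_mul]
  have hg := geomSeries_eq (p ^ 2)
  rw [h]
  push_cast at hg ⊢
  linear_combination (((p : PowerSeries ℝ) ^ 2 + (p : PowerSeries ℝ) + 1) * X) * hg

theorem countSeries_one_sl2_of_odd (hp : p.Prime) (hp2 : p ≠ 2) :
    countSeries (brMatrix (-2) 0 2) p 1 * (1 - (p : PowerSeries ℝ) * X) = 1 + X := by
  have h : countSeries (brMatrix (-2) 0 2) p 1 = 1 + ((p + 1 : ℕ) : PowerSeries ℝ) *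
      (X * geomSeries p) := by
    ext k
    rw [coeff_countSeries_one, map_add, coeff_natCast_mul]
    cases k with
    | zero => simp [cocyclicCount_zero hp]
    | succ k =>
      rw [PowerSeries.coeff_succ_X_mul, cocyclicCount_sl2_of_odd hp hp2]
      simp only [geomSeries, PowerSeries.coeff_one, PowerSeries.coeff_mk, Nat.succ_ne_zero,
        if_false]
      push_cast
      ring
  have hg := geomSeries_eq p
  rw [h]
  push_cast at hg ⊢
  linear_combination (((p : PowerSeries ℝ) + 1) * X) * hg

theorem countSeries_one_sl2_two :
    countSeries (brMatrix (-2) 0 2) 2 1 * (1 - 2 * X) = 1 + X + 6 * X ^ 2 := by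
  have h : countSeries (brMatrix (-2) 0 2) 2 1 = 1 + ((3 : ℕ) : PowerSeries ℝ) * X +
      ((12 : ℕ) : PowerSeries ℝ) * (X ^ 2 * geomSeries (2 : ℕ)) := by
    ext k
    rw [coeff_countSeries_one, map_add, map_add, coeff_natCast_mul, coeff_natCast_mul]
    rcases k with _ | _ | k
    · simp [cocyclicCount_zero Nat.prime_two]
    · simp [cocyclicCount_sl2_two_one, PowerSeries.coeff_one, PowerSeries.coeff_X_pow_mul']
    · rw [cocyclicCount_sl2_two, coeff_X_sq_mul]
      simp [geomSeries, PowerSeries.coeff_one, PowerSeries.coeff_X]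
      ring
  have hg := geomSeries_eq 2
  rw [h]
  push_cast at hg ⊢
  linear_combination (12 * X ^ 2) * hg

theorem countSeries_one_heis (hp : p.Prime) :
    countSeries (brMatrix 0 0 0) p 1 *
        ((1 - (p : PowerSeries ℝ) * X) * (1 - (p : PowerSeries ℝ) ^ 3 * X ^ 2)) =
      1 + X - (p : PowerSeries ℝ) * X ^ 2 - (p : PowerSeries ℝ) ^ 3 * X ^ 3 := by
  -- The weight `p ^ k` makes both charts multiples of one series; multiplying the count by `p`
  -- avoids `p ^ (k - 1)`, and the correction `-1` comes from degree zero.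
  set S : PowerSeries ℝ := mk fun k => ((p ^ k * sqrtCount p 0 k : ℕ) : ℝ) with hS
  have hp0 := natCast_powerSeries_ne_zero hp.ne_zero
  have h1 : S = 1 + ((p : ℕ) : PowerSeries ℝ) * X +
      ((p ^ 3 : ℕ) : PowerSeries ℝ) * (X ^ 2 * S) := by
    ext k
    rw [map_add, map_add, coeff_natCast_mul, coeff_natCast_mul]
    rcases k with _ | _ | k
    · simp [hS, sqrtCount_zero_right]
    · simp [hS, sqrtCount_zero_one hp, PowerSeries.coeff_one, PowerSeries.coeff_X_pow_mul']
    · rw [coeff_X_sq_mul]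
      simp only [hS, PowerSeries.coeff_one, PowerSeries.coeff_X, PowerSeries.coeff_mk]
      rw [sqrtCount_zero_add_two hp, if_neg (by omega), if_neg (by omega)]
      push_cast
      ring
  have h2 : ((p : ℕ) : PowerSeries ℝ) * countSeries (brMatrix 0 0 0) p 1 =
      ((p + 1 : ℕ) : PowerSeries ℝ) * S - 1 := by
    ext k
    rw [map_sub, coeff_natCast_mul, coeff_natCast_mul, coeff_countSeries_one]
    cases k with
    | zero => simp [hS, cocyclicCount_zero hp, sqrtCount_zero_right]
    | succ k =>
      rw [cocyclicCount_heis hp]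
      simp only [hS, PowerSeries.coeff_one, PowerSeries.coeff_mk, Nat.succ_ne_zero, if_false]
      push_cast
      ring
  push_cast at h1 h2
  refine mul_left_cancel₀ hp0 ?_
  linear_combination ((1 - (p : PowerSeries ℝ) * X) * (1 - (p : PowerSeries ℝ) ^ 3 * X ^ 2)) * h2 +
    ((p : PowerSeries ℝ) + 1) * (1 - (p : PowerSeries ℝ) * X) * h1

/-- The generating series of `p ^ k` times the number of square roots of `ε`, without its
constant term. -/
noncomputable def sqrtSeries (p : ℕ) (ε : ℤ) : PowerSeries ℝ :=
  mk fun k => if k = 0 then 0 else ((p ^ k * sqrtCount p ε k : ℕ) : ℝ)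

theorem countSeries_one_cone (hp : p.Prime) {ε : ℤ} (hε : IsUnit ε) :
    countSeries (brMatrix 0 ε 0) p 1 * (1 - (p : PowerSeries ℝ) ^ 2 * X ^ 2) =
      1 + X + (1 - (p : PowerSeries ℝ) * X ^ 2) * sqrtSeries p ε := by
  set A : PowerSeries ℝ := mk fun k => (coneCount p ε k : ℝ) with hA
  have hp0 := natCast_powerSeries_ne_zero hp.ne_zero
  -- The cone recursion times `p`, so that `p ^ k - p ^ (k - 1)` becomes `(p - 1) p ^ k`; degrees
  -- zero and one account for the terms `p` and `p X`.
  have h1 : ((p : ℕ) : PowerSeries ℝ) * A + sqrtSeries p ε = ((p : ℕ) : PowerSeries ℝ) * 1 +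
      ((p : ℕ) : PowerSeries ℝ) * X +
      ((p : ℕ) : PowerSeries ℝ) * sqrtSeries p ε + ((p ^ 3 : ℕ) : PowerSeries ℝ) * (X ^ 2 * A) := by
    ext k
    simp only [map_add, coeff_natCast_mul]
    have hpp : ((p - 1 : ℕ) : ℝ) = p - 1 := by
      rw [Nat.cast_sub hp.one_le, Nat.cast_one]
    rcases k with _ | _ | k
    · simp [hA, coneCount_zero_right, sqrtSeries]
    · simp [hA, coneCount_one hp hε, PowerSeries.coeff_one, PowerSeries.coeff_X_pow_mul',
        sqrtSeries, hpp]
      ring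
    · rw [coeff_X_sq_mul]
      simp only [hA, PowerSeries.coeff_one, PowerSeries.coeff_X, PowerSeries.coeff_mk, sqrtSeries]
      rw [coneCount_add_two hp hε, if_neg (by omega), if_neg (by omega), if_neg (by omega)]
      have : ((p ^ (k + 2) - p ^ (k + 1) : ℕ) : ℝ) = p ^ (k + 2) - p ^ (k + 1) := by
        rw [Nat.cast_sub (Nat.pow_le_pow_right hp.pos (by omega))]
        push_cast
        rfl
      push_cast [this]
      ring
  have h2 : ((p : ℕ) : PowerSeries ℝ) * countSeries (brMatrix 0 ε 0) p 1 =
      ((p : ℕ) : PowerSeries ℝ) * A + sqrtSeries p ε := by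
    ext k
    rw [map_add, coeff_natCast_mul, coeff_natCast_mul, coeff_countSeries_one]
    cases k with
    | zero => simp [hA, cocyclicCount_zero hp, coneCount_zero_right, sqrtSeries]
    | succ k =>
      rw [cocyclicCount_cone hp]
      simp only [hA, sqrtSeries, PowerSeries.coeff_mk, Nat.succ_ne_zero, if_false]
      push_cast
      ring
  push_cast at h1 h2
  refine mul_left_cancel₀ hp0 ?_
  linear_combination (1 - (p : PowerSeries ℝ) ^ 2 * X ^ 2) * h2 + h1

theorem natCast_add_natCast_mul_X_ne_zero (a : ℕ) :
    (1 + (a : PowerSeries ℝ) * X) ≠ 0 := by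
  intro h
  have := congrArg (coeff 0) h
  simp at this

theorem sqrtSeries_of_forall_two {ε : ℤ} (h : ∀ k, sqrtCount p ε (k + 1) = 2) :
    sqrtSeries p ε = 2 * (p : PowerSeries ℝ) * X * geomSeries p := by
  have : 2 * (p : PowerSeries ℝ) * X * geomSeries p =
      ((2 * p : ℕ) : PowerSeries ℝ) * (X * geomSeries p) := by
    push_cast; ring
  rw [this]
  ext k
  rw [coeff_natCast_mul, sqrtSeries, PowerSeries.coeff_mk]
  cases k with
  | zero => simp
  | succ k =>
    rw [PowerSeries.coeff_succ_X_mul, if_neg (Nat.succ_ne_zero k), h k]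
    simp only [geomSeries, PowerSeries.coeff_mk]
    push_cast
    ring

theorem countSeries_one_of_split (hp : p.Prime) {ε : ℤ} (hε : IsUnit ε)
    (h : ∀ k, sqrtCount p ε (k + 1) = 2) :
    countSeries (brMatrix 0 ε 0) p 1 * (1 - (p : PowerSeries ℝ) * X) ^ 2 =
      1 + X - 2 * (p : PowerSeries ℝ) * X ^ 2 := by
  have h1 := countSeries_one_cone hp hε
  rw [sqrtSeries_of_forall_two h] at h1
  have hg := geomSeries_eq p
  -- The general formula has denominator `(1 - pX)(1 + pX)` and the square root series adds another
  -- `1 - pX`; the factor `1 + pX` turns out to cancel.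
  refine mul_left_cancel₀ (natCast_add_natCast_mul_X_ne_zero p) ?_
  linear_combination (1 - (p : PowerSeries ℝ) * X) * h1 +
    (1 - (p : PowerSeries ℝ) * X ^ 2) * (2 * p * X) * hg

theorem countSeries_one_of_inert (hp : p.Prime) {ε : ℤ} (hε : IsUnit ε)
    (h : ∀ k, sqrtCount p ε (k + 1) = 0) :
    countSeries (brMatrix 0 ε 0) p 1 * (1 - (p : PowerSeries ℝ) ^ 2 * X ^ 2) = 1 + X := by
  have h1 := countSeries_one_cone hp hε
  have : sqrtSeries p ε = 0 := by
    ext k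
    cases k with
    | zero => simp [sqrtSeries]
    | succ k => simp [sqrtSeries, h]
  rw [h1, this, mul_zero, add_zero]

theorem countSeries_one_l1_two :
    countSeries (brMatrix 0 1 0) 2 1 * (1 - 2 * X) ^ 2 =
      1 - X + 4 * X ^ 2 + 4 * X ^ 3 - 16 * X ^ 4 := by
  have h1 := countSeries_one_cone Nat.prime_two isUnit_one
  -- The numbers of square roots of `1` are `1`, `2`, then `4` from exponent three on, with weights
  -- `2`, `4` and `2 ^ k`.
  have h : sqrtSeries 2 1 = ((2 : ℕ) : PowerSeries ℝ) * X + ((8 : ℕ) : PowerSeries ℝ) * X ^ 2 +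
      ((32 : ℕ) : PowerSeries ℝ) * (X ^ 3 * geomSeries (2 : ℕ)) := by
    ext k
    simp only [map_add, coeff_natCast_mul]
    rcases k with _ | _ | _ | k
    · simp [sqrtSeries]
    · simp [sqrtSeries, sqrtCount_two_one_one, PowerSeries.coeff_X_pow_mul',
        PowerSeries.coeff_X_pow]
    · simp [sqrtSeries, sqrtCount_two_one_two, PowerSeries.coeff_X_pow_mul',
        PowerSeries.coeff_X_pow, PowerSeries.coeff_X]
      norm_num
    · rw [coeff_X_cube_mul]
      simp [sqrtSeries, sqrtCount_two_one, geomSeries, PowerSeries.coeff_X_pow,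
        PowerSeries.coeff_X]
      ring
  have hg := geomSeries_eq 2
  rw [h] at h1
  have hne := natCast_add_natCast_mul_X_ne_zero 2
  push_cast at hg h1 hne
  refine mul_left_cancel₀ hne ?_
  linear_combination (1 - 2 * X) * h1 + (1 - 2 * X ^ 2) * (32 * X ^ 3) * hg

theorem countSeries_one_l2_two :
    countSeries (brMatrix 0 (-1) 0) 2 1 * (1 - 2 * X) = 1 + X - 2 * X ^ 2 := by
  have h1 := countSeries_one_cone Nat.prime_two isUnit_one.neg
  have h : sqrtSeries 2 (-1) = ((2 : ℕ) : PowerSeries ℝ) * X := by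
    ext k
    simp only [coeff_natCast_mul]
    rcases k with _ | _ | k
    · simp [sqrtSeries]
    · simp [sqrtSeries, sqrtCount_two_neg_one_one]
    · simp [sqrtSeries, sqrtCount_two_neg_one, PowerSeries.coeff_X]
  rw [h] at h1
  have hne := natCast_add_natCast_mul_X_ne_zero 2
  push_cast at h1 hne
  refine mul_left_cancel₀ hne ?_
  linear_combination h1

end CotypeDensity

namespace CotypeDensity

open PowerSeries (X mk coeff)

/-! ### Values and weighted norms of power series -/

/-- The series `F` converges absolutely at `τ` with sum `a`. -/
def HasValue (τ : ℝ) (F : PowerSeries ℝ) (a : ℝ) : Prop :=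
  (Summable fun k => ‖coeff k F * τ ^ k‖) ∧ ∑' k, coeff k F * τ ^ k = a

/-- The weighted norm of a series with real coefficients. -/
noncomputable def weightedNorm (τ : ℝ) (F : PowerSeries ℝ) : ℝ := ∑' k, ‖coeff k F * τ ^ k‖

theorem coeff_mul_mul_pow (τ : ℝ) (F G : PowerSeries ℝ) (n : ℕ) :
    coeff n (F * G) * τ ^ n = ∑ kl ∈ Finset.HasAntidiagonal.antidiagonal n,
      (coeff kl.1 F * τ ^ kl.1) * (coeff kl.2 G * τ ^ kl.2) := by
  rw [PowerSeries.coeff_mul, Finset.sum_mul]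
  refine Finset.sum_congr rfl fun kl h => ?_
  rw [← Finset.HasAntidiagonal.mem_antidiagonal.1 h, pow_add]
  ring

namespace HasValue

variable {τ a b : ℝ} {F G : PowerSeries ℝ}

theorem add (hF : HasValue τ F a) (hG : HasValue τ G b) : HasValue τ (F + G) (a + b) := by
  have h : ∀ k, coeff k (F + G) * τ ^ k = coeff k F * τ ^ k + coeff k G * τ ^ k := fun k => by
    rw [map_add, add_mul]
  constructor
  · simp_rw [h]
    exact (hF.1.add hG.1).of_nonneg_of_le (fun _ => norm_nonneg _) fun _ => norm_add_le _ _
  · simp_rw [h]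
    rw [hF.1.of_norm.tsum_add hG.1.of_norm, hF.2, hG.2]

theorem neg (hF : HasValue τ F a) : HasValue τ (-F) (-a) := by
  have h : ∀ k, coeff k (-F) * τ ^ k = -(coeff k F * τ ^ k) := fun k => by
    rw [map_neg, neg_mul]
  constructor
  · simp_rw [h, norm_neg]
    exact hF.1
  · simp_rw [h]
    rw [tsum_neg, hF.2]

theorem sub (hF : HasValue τ F a) (hG : HasValue τ G b) : HasValue τ (F - G) (a - b) := by
  rw [sub_eq_add_neg, sub_eq_add_neg]
  exact hF.add hG.neg

theorem mul (hF : HasValue τ F a) (hG : HasValue τ G b) : HasValue τ (F * G) (a * b) := by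
  have h := funext (coeff_mul_mul_pow τ F G)
  have h1 := summable_norm_sum_mul_antidiagonal_of_summable_norm hF.1 hG.1
  have h2 := tsum_mul_tsum_eq_tsum_sum_antidiagonal_of_summable_norm hF.1 hG.1
  rw [hF.2, hG.2] at h2
  rw [HasValue, h2, ← h]
  refine ⟨?_, rfl⟩
  simp only [funext_iff] at h
  simpa only [h] using h1

theorem natCast (τ : ℝ) (n : ℕ) : HasValue τ (n : PowerSeries ℝ) n := by
  have h : ∀ k, coeff k (n : PowerSeries ℝ) * τ ^ k = if k = 0 then (n : ℝ) else 0 := fun k => by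
    have := coeff_natCast_mul n 1 k
    rw [mul_one, PowerSeries.coeff_one] at this
    rw [this]
    split_ifs with hk
    · simp [hk]
    · simp
  constructor
  · simp_rw [h]
    exact summable_of_ne_finset_zero (s := {0}) fun k hk => by simp_all
  · simp_rw [h]
    exact tsum_ite_eq 0 _

theorem one (τ : ℝ) : HasValue τ 1 1 := by
  simpa using natCast τ 1

theorem X (τ : ℝ) : HasValue τ X τ := by
  have h : ∀ k, coeff k (PowerSeries.X : PowerSeries ℝ) * τ ^ k = if k = 1 then τ else 0 :=
    fun k => by
      rw [PowerSeries.coeff_X]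
      split_ifs with hk
      · simp [hk]
      · simp
  constructor
  · simp_rw [h]
    exact summable_of_ne_finset_zero (s := {1}) fun k hk => by simp_all
  · simp_rw [h]
    exact tsum_ite_eq 1 _

theorem pow (hF : HasValue τ F a) (n : ℕ) : HasValue τ (F ^ n) (a ^ n) := by
  induction n with
  | zero => simpa using one τ
  | succ n ih =>
    rw [pow_succ, pow_succ]
    exact ih.mul hF

theorem unique (h : HasValue τ F a) (h' : HasValue τ F b) : a = b := h.2.symm.trans h'.2

end HasValue

theorem weightedNorm_nonneg (τ : ℝ) (F : PowerSeries ℝ) : 0 ≤ weightedNorm τ F :=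
  tsum_nonneg fun _ => norm_nonneg _

section WeightedNorm

variable {τ a b : ℝ} {F G : PowerSeries ℝ}

theorem weightedNorm_neg (τ : ℝ) (F : PowerSeries ℝ) :
    weightedNorm τ (-F) = weightedNorm τ F := by
  simp [weightedNorm]

theorem weightedNorm_add_le (hF : HasValue τ F a) (hG : HasValue τ G b) :
    weightedNorm τ (F + G) ≤ weightedNorm τ F + weightedNorm τ G := by
  rw [weightedNorm, weightedNorm, weightedNorm, ← hF.1.tsum_add hG.1]
  refine (hF.add hG).1.tsum_le_tsum (fun k => ?_) (hF.1.add hG.1)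
  rw [map_add, add_mul]
  exact norm_add_le _ _

theorem weightedNorm_mul_le (hF : HasValue τ F a) (hG : HasValue τ G b) :
    weightedNorm τ (F * G) ≤ weightedNorm τ F * weightedNorm τ G := by
  have hF' : Summable fun k => ‖‖coeff k F * τ ^ k‖‖ := by simpa only [norm_norm] using hF.1
  have hG' : Summable fun k => ‖‖coeff k G * τ ^ k‖‖ := by simpa only [norm_norm] using hG.1
  rw [weightedNorm, weightedNorm, weightedNorm,
    tsum_mul_tsum_eq_tsum_sum_antidiagonal_of_summable_norm hF' hG']
  refine (hF.mul hG).1.tsum_le_tsum (fun k => ?_)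
    (summable_norm_sum_mul_antidiagonal_of_summable_norm hF' hG').of_norm
  rw [coeff_mul_mul_pow]
  refine (norm_sum_le _ _).trans (le_of_eq (Finset.sum_congr rfl fun _ _ => norm_mul _ _))

theorem weightedNorm_natCast (τ : ℝ) (n : ℕ) : weightedNorm τ (n : PowerSeries ℝ) = n := by
  have h : ∀ k, ‖coeff k (n : PowerSeries ℝ) * τ ^ k‖ = if k = 0 then (n : ℝ) else 0 :=
    fun k => by
      have := coeff_natCast_mul n 1 k
      rw [mul_one, PowerSeries.coeff_one] at this
      rw [this]
      split_ifs with hk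
      · simp [hk]
      · simp
  simp_rw [weightedNorm, h]
  exact tsum_ite_eq 0 _

theorem weightedNorm_X (hτ : 0 ≤ τ) : weightedNorm τ (X : PowerSeries ℝ) = τ := by
  have h : ∀ k, ‖coeff k (X : PowerSeries ℝ) * τ ^ k‖ = if k = 1 then τ else 0 :=
    fun k => by
      rw [PowerSeries.coeff_X]
      split_ifs with hk
      · simp [hk, abs_of_nonneg hτ]
      · simp
  simp_rw [weightedNorm, h]
  exact tsum_ite_eq 1 _

theorem weightedNorm_pow_le (hF : HasValue τ F a) (n : ℕ) :
    weightedNorm τ (F ^ n) ≤ weightedNorm τ F ^ n := by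
  induction n with
  | zero => simpa using (weightedNorm_natCast τ 1).le
  | succ n ih =>
    rw [pow_succ, pow_succ]
    exact (weightedNorm_mul_le (hF.pow n) hF).trans
      (mul_le_mul_of_nonneg_right ih (weightedNorm_nonneg _ _))

theorem sum_range_ite_sub (g : ℕ → ℝ) (b n : ℕ) :
    ∑ k ∈ Finset.range n, (if b ≤ k then g (k - b) else 0) = ∑ k ∈ Finset.range (n - b), g k := by
  induction n with
  | zero => simp
  | succ n ih =>
    rw [Finset.sum_range_succ, ih]
    split_ifs with h
    · rw [Nat.succ_sub h, Finset.sum_range_succ]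
    · rw [show n + 1 - b = n - b by omega, add_zero]

/-- Writing `F = H + m X ^ b F` with `m τ ^ b ≤ 1 / 2`, every partial sum of the norm of `F` is at
most the norm of `H` plus half of itself. This yields convergence and the bound at once, and
replaces inverting `1 - m X ^ b`. -/
theorem weightedNorm_le_of_sub_mul (hτ : 0 ≤ τ) (m b : ℕ) (hm : m * τ ^ b ≤ 1 / 2)
    (h : HasValue τ ((1 - (m : PowerSeries ℝ) * X ^ b) * F) a) :
    (∃ a', HasValue τ F a') ∧
      weightedNorm τ F ≤ 2 * weightedNorm τ ((1 - (m : PowerSeries ℝ) * X ^ b) * F) := by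
  set H := (1 - (m : PowerSeries ℝ) * X ^ b) * F with hH
  have hF : F = H + (m : PowerSeries ℝ) * (X ^ b * F) := by rw [hH]; ring
  have hbound : ∀ n, ∑ k ∈ Finset.range n, ‖coeff k F * τ ^ k‖ ≤ 2 * weightedNorm τ H := by
    intro n
    have hterm : ∀ k, ‖coeff k F * τ ^ k‖ ≤ ‖coeff k H * τ ^ k‖ +
        1 / 2 * (if b ≤ k then ‖coeff (k - b) F * τ ^ (k - b)‖ else 0) := by
      intro k
      conv_lhs => rw [hF]
      rw [map_add, add_mul, coeff_natCast_mul, PowerSeries.coeff_X_pow_mul']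
      refine (norm_add_le _ _).trans (add_le_add le_rfl ?_)
      split_ifs with hb
      · obtain ⟨k, rfl⟩ := Nat.exists_eq_add_of_le' hb
        rw [Nat.add_sub_cancel, pow_add,
          show (m : ℝ) * coeff k F * (τ ^ k * τ ^ b) = (m * τ ^ b) * (coeff k F * τ ^ k) by ring,
          norm_mul]
        refine mul_le_mul_of_nonneg_right ?_ (norm_nonneg _)
        rwa [Real.norm_of_nonneg (by positivity)]
      · simp
    have h1 : ∑ k ∈ Finset.range n, ‖coeff k F * τ ^ k‖ ≤ weightedNorm τ H +
        1 / 2 * ∑ k ∈ Finset.range n, ‖coeff k F * τ ^ k‖ := by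
      refine (Finset.sum_le_sum fun k _ => hterm k).trans ?_
      rw [Finset.sum_add_distrib, ← Finset.mul_sum,
        sum_range_ite_sub fun k => ‖coeff k F * τ ^ k‖]
      gcongr
      · exact h.1.sum_le_tsum _ fun _ _ => norm_nonneg _
      · exact Nat.sub_le _ _
    linarith
  exact ⟨⟨_, summable_of_sum_range_le (fun _ => norm_nonneg _) hbound, rfl⟩,
    Real.tsum_le_of_sum_range_le (fun _ => norm_nonneg _) hbound⟩

end WeightedNorm

/-! ### Families of local series that are uniformly small -/

/-- The family `F p` of local series satisfies `F p = O(p ^ (-j))` at `p ^ (-r)`. -/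
def IsLocalO (r j : ℕ) (F : ℕ → PowerSeries ℝ) : Prop :=
  ∃ c : ℝ, 0 ≤ c ∧ ∀ p : ℕ, p.Prime → (∃ a, HasValue (((p : ℝ) ^ r)⁻¹) (F p) a) ∧
    weightedNorm (((p : ℝ) ^ r)⁻¹) (F p) ≤ c / (p : ℝ) ^ j

namespace IsLocalO

variable {r j : ℕ} {F G : ℕ → PowerSeries ℝ}

theorem congr (h : ∀ p : ℕ, p.Prime → F p = G p) (hF : IsLocalO r j F) : IsLocalO r j G := by
  obtain ⟨c, hc, hF⟩ := hF
  exact ⟨c, hc, fun p hp => h p hp ▸ hF p hp⟩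

theorem add (hF : IsLocalO r j F) (hG : IsLocalO r j G) : IsLocalO r j fun p => F p + G p := by
  obtain ⟨c, hc, hF⟩ := hF
  obtain ⟨d, hd, hG⟩ := hG
  refine ⟨c + d, by positivity, fun p hp => ?_⟩
  obtain ⟨⟨a, ha⟩, h1⟩ := hF p hp
  obtain ⟨⟨b, hb⟩, h2⟩ := hG p hp
  refine ⟨⟨_, ha.add hb⟩, (weightedNorm_add_le ha hb).trans ?_⟩
  rw [add_div]
  exact add_le_add h1 h2

theorem neg (hF : IsLocalO r j F) : IsLocalO r j fun p => -F p := by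
  obtain ⟨c, hc, hF⟩ := hF
  refine ⟨c, hc, fun p hp => ?_⟩
  obtain ⟨⟨a, ha⟩, h1⟩ := hF p hp
  exact ⟨⟨_, ha.neg⟩, by rwa [weightedNorm_neg]⟩

theorem sub (hF : IsLocalO r j F) (hG : IsLocalO r j G) : IsLocalO r j fun p => F p - G p := by
  simp_rw [sub_eq_add_neg]
  exact hF.add hG.neg

theorem mul (hF : IsLocalO r 0 F) (hG : IsLocalO r j G) : IsLocalO r j fun p => F p * G p := by
  obtain ⟨c, hc, hF⟩ := hF
  obtain ⟨d, hd, hG⟩ := hG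
  refine ⟨c * d, by positivity, fun p hp => ?_⟩
  obtain ⟨⟨a, ha⟩, h1⟩ := hF p hp
  obtain ⟨⟨b, hb⟩, h2⟩ := hG p hp
  refine ⟨⟨_, ha.mul hb⟩, (weightedNorm_mul_le ha hb).trans ?_⟩
  rw [pow_zero, div_one] at h1
  rw [mul_div_assoc]
  exact mul_le_mul h1 h2 (weightedNorm_nonneg _ _) hc

theorem mono (hF : IsLocalO r j F) : IsLocalO r 0 F := by
  obtain ⟨c, hc, hF⟩ := hF
  refine ⟨c, hc, fun p hp => ⟨(hF p hp).1, (hF p hp).2.trans ?_⟩⟩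
  rw [pow_zero]
  refine div_le_div_of_nonneg_left hc one_pos ?_
  exact one_le_pow₀ (by exact_mod_cast hp.one_le)

theorem natCast (r n : ℕ) : IsLocalO r 0 fun _ => (n : PowerSeries ℝ) :=
  ⟨n, by positivity, fun p _ => ⟨⟨_, HasValue.natCast _ n⟩, by
    rw [weightedNorm_natCast, pow_zero, div_one]⟩⟩

theorem one (r : ℕ) : IsLocalO r 0 fun _ => (1 : PowerSeries ℝ) := by
  simpa using natCast r 1

theorem monomial {a b : ℕ} (h : a + j ≤ r * b) :
    IsLocalO r j fun p => (p : PowerSeries ℝ) ^ a * X ^ b := by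
  refine ⟨1, zero_le_one, fun p hp => ?_⟩
  have hp0 : (0 : ℝ) < p := by exact_mod_cast hp.pos
  have hτ : 0 ≤ ((p : ℝ) ^ r)⁻¹ := by positivity
  have h1 := HasValue.natCast (((p : ℝ) ^ r)⁻¹) p
  have h2 := HasValue.X (((p : ℝ) ^ r)⁻¹)
  refine ⟨⟨_, (h1.pow a).mul (h2.pow b)⟩, ?_⟩
  calc _ ≤ (p : ℝ) ^ a * (((p : ℝ) ^ r)⁻¹) ^ b := by
        refine (weightedNorm_mul_le (h1.pow a) (h2.pow b)).trans ?_
        refine mul_le_mul ((weightedNorm_pow_le h1 a).trans_eq ?_)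
          ((weightedNorm_pow_le h2 b).trans_eq ?_) (weightedNorm_nonneg _ _) (by positivity)
        · rw [weightedNorm_natCast]
        · rw [weightedNorm_X hτ]
    _ ≤ 1 / (p : ℝ) ^ j := by
        rw [inv_pow, ← pow_mul, ← div_eq_mul_inv, div_le_div_iff₀ (by positivity) (by positivity),
          one_mul, ← pow_add]
        exact pow_le_pow_right₀ (by exact_mod_cast hp.one_le) h

theorem ite (P : ℕ → Prop) [DecidablePred P] (hF : IsLocalO r j F) (hG : IsLocalO r j G) :
    IsLocalO r j fun p => if P p then F p else G p := by
  obtain ⟨c, hc, hF⟩ := hF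
  obtain ⟨d, hd, hG⟩ := hG
  refine ⟨max c d, le_max_of_le_left hc, fun p hp => ?_⟩
  have hp0 : (0 : ℝ) < p := by exact_mod_cast hp.pos
  dsimp only
  split_ifs
  · exact ⟨(hF p hp).1, (hF p hp).2.trans (by gcongr; exact le_max_left _ _)⟩
  · exact ⟨(hG p hp).1, (hG p hp).2.trans (by gcongr; exact le_max_right _ _)⟩

/-- Since `p ^ a τ ^ b ≤ p ^ (-2) ≤ 1 / 2` at `τ = p ^ (-r)`, division by `1 - p ^ a X ^ b` at most
doubles the norm. -/
theorem of_sub_mul {a b : ℕ} (h : a + 2 ≤ r * b)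
    (hF : IsLocalO r j fun p => (1 - (p : PowerSeries ℝ) ^ a * X ^ b) * F p) :
    IsLocalO r j F := by
  obtain ⟨c, hc, hF⟩ := hF
  refine ⟨2 * c, by positivity, fun p hp => ?_⟩
  have hp0 : (0 : ℝ) < p := by exact_mod_cast hp.pos
  have hp2 : (2 : ℝ) ≤ p := by exact_mod_cast hp.two_le
  obtain ⟨⟨x, hx⟩, h1⟩ := hF p hp
  have hm : ((p ^ a : ℕ) : ℝ) * (((p : ℝ) ^ r)⁻¹) ^ b ≤ 1 / 2 := by
    rw [inv_pow, ← pow_mul, ← div_eq_mul_inv, div_le_div_iff₀ (by positivity) (by positivity),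
      one_mul]
    calc ((p ^ a : ℕ) : ℝ) * 2 ≤ (p : ℝ) ^ a * p ^ 2 := by
          push_cast
          gcongr
          nlinarith
      _ = (p : ℝ) ^ (a + 2) := by rw [pow_add]
      _ ≤ _ := pow_le_pow_right₀ (by linarith) h
  have hcast : (p : PowerSeries ℝ) ^ a = ((p ^ a : ℕ) : PowerSeries ℝ) := (Nat.cast_pow p a).symm
  simp only [hcast] at hx h1
  obtain ⟨h2, h3⟩ := weightedNorm_le_of_sub_mul (by positivity) _ b hm hx
  refine ⟨h2, h3.trans ?_⟩
  rw [mul_div_assoc]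
  exact mul_le_mul_of_nonneg_left h1 zero_le_two

end IsLocalO

end CotypeDensity

namespace CotypeDensity

open PowerSeries (X mk coeff)

variable {M : Matrix (Fin 3) (Fin 3) ℤ} {r : ℕ} {h V : ℕ → PowerSeries ℝ}

/-! ### Regularized local series -/

/-- The cocyclic local series of `M` are `h p / V p`, with `V` bounded and `h` close to `1`. -/
structure LocalData (M : Matrix (Fin 3) (Fin 3) ℤ) (r : ℕ) (h V : ℕ → PowerSeries ℝ) : Prop where
  eq : ∀ p : ℕ, p.Prime → countSeries M p 1 * V p = h p
  num : IsLocalO r 2 fun p => h p - 1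
  denom : IsLocalO r 0 V

namespace LocalData

theorem num_bounded (H : LocalData M r h V) : IsLocalO r 0 h :=
  (H.num.mono.add (IsLocalO.one r)).congr fun _ _ => sub_add_cancel _ _

theorem countSeries_one (H : LocalData M r h V) :
    IsLocalO r 2 fun p => countSeries M p 1 * V p - 1 :=
  H.num.congr fun p hp => by rw [H.eq p hp]

/-- Passing from rank one to higher rank does not disturb the regularization: every new term
contains some `p ^ a X ^ b` with `a + 2 ≤ 2b`, which is `O(p ^ (-2))` because `r ≥ 2`. -/
theorem countSeries_two (hr : 2 ≤ r) (H : LocalData M r h V) :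
    IsLocalO r 2 fun p => countSeries M p 2 * V p - 1 := by
  have hm : ∀ a b, a + 2 ≤ 2 * b → IsLocalO r 2 fun p => (p : PowerSeries ℝ) ^ a * X ^ b :=
    fun a b hab => IsLocalO.monomial (hab.trans (Nat.mul_le_mul_right b hr))
  refine IsLocalO.of_sub_mul (a := 2) (b := 2) (by omega) ?_
  refine ((H.num.add (H.num_bounded.mul (hm 1 2 (by omega)))).add
    (H.denom.mul (hm 0 2 (by omega)))).add (hm 2 2 (by omega)) |>.congr fun p hp => ?_
  linear_combination -H.eq p hp * (1 + (p : PowerSeries ℝ) * X ^ 2) -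
    V p * CotypeDensity.countSeries_two (M := M) hp

theorem countSeries_three (hr : 2 ≤ r) (H : LocalData M r h V) :
    IsLocalO r 2 fun p => countSeries M p 3 * V p - 1 := by
  have hm : ∀ a b, a + 2 ≤ 2 * b → IsLocalO r 2 fun p => (p : PowerSeries ℝ) ^ a * X ^ b :=
    fun a b hab => IsLocalO.monomial (hab.trans (Nat.mul_le_mul_right b hr))
  have hs : ∀ a b, a + 2 ≤ 2 * b → IsLocalO r 0 fun p => 1 - (p : PowerSeries ℝ) ^ a * X ^ b :=
    fun a b hab => (IsLocalO.one r).sub (hm a b hab).mono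
  have h1 : IsLocalO r 0 fun p => 1 + (p : PowerSeries ℝ) ^ 1 * X ^ 2 :=
    (IsLocalO.one r).add (hm 1 2 (by omega)).mono
  have hX : IsLocalO r 2 fun p => (p : PowerSeries ℝ) ^ 0 * X ^ 3 +
      ((p : PowerSeries ℝ) ^ 1 * X ^ 4 + (p : PowerSeries ℝ) ^ 0 * X ^ 4) :=
    (hm 0 3 (by omega)).add ((hm 1 4 (by omega)).add (hm 0 4 (by omega)))
  refine IsLocalO.of_sub_mul (a := 2) (b := 4) (by omega) ?_
  refine IsLocalO.of_sub_mul (a := 0) (b := 3) (by omega) ?_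
  refine IsLocalO.of_sub_mul (a := 2) (b := 2) (by omega) ?_
  have key := ((((H.num.add (H.num_bounded.mul (hm 1 2 (by omega)))).sub
    ((h1.mul H.num_bounded).mul (hm 0 3 (by omega)))).add ((h1.mul H.denom).mul hX)).add
    (((hs 2 4 (by omega)).mul H.denom).mul (hm 0 2 (by omega)))).add
    (((hm 2 2 (by omega)).add ((hs 2 2 (by omega)).mul (hm 0 3 (by omega)))).add
      (((hs 2 2 (by omega)).mul (hs 0 3 (by omega))).mul (hm 2 4 (by omega))))
  refine key.congr fun p hp => ?_
  have h2 := denomSeries_mul_countSeries hp M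
  rw [denomSeries] at h2
  linear_combination -H.eq p hp * (1 + (p : PowerSeries ℝ) * X ^ 2) * (1 - X ^ 3) - V p * h2

variable {τ a b : ℝ} {p : ℕ}

theorem value_one (H : LocalData M r h V) (hp : p.Prime) (ha : HasValue τ (h p) a) :
    HasValue τ (countSeries M p 1 * V p) a := by
  rwa [H.eq p hp]

theorem value_two (H : LocalData M r h V) (hp : p.Prime) (ha : HasValue τ (h p) a)
    (hb : HasValue τ (V p) b) {x : ℝ} (hx : HasValue τ (countSeries M p 2 * V p) x) :
    x * (1 - (p : ℝ) ^ 2 * τ ^ 2) = a * (1 + p * τ ^ 2) + τ ^ 2 * b := by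
  have hX := HasValue.X τ
  have hP := HasValue.natCast τ p
  have h1 := HasValue.one τ
  refine (hx.mul (h1.sub ((hP.pow 2).mul (hX.pow 2)))).unique ?_
  convert (ha.mul (h1.add (hP.mul (hX.pow 2)))).add ((hX.pow 2).mul hb) using 1
  linear_combination H.eq p hp * (1 + (p : PowerSeries ℝ) * X ^ 2) +
    V p * CotypeDensity.countSeries_two (M := M) hp

theorem value_three (H : LocalData M r h V) (hp : p.Prime) (ha : HasValue τ (h p) a)
    (hb : HasValue τ (V p) b) {x : ℝ} (hx : HasValue τ (countSeries M p 3 * V p) x) :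
    (1 - (p : ℝ) ^ 2 * τ ^ 2) * (1 - τ ^ 3) * (1 - (p : ℝ) ^ 2 * τ ^ 4) * x =
      (1 + p * τ ^ 2) * ((1 - τ ^ 3) * a + (τ ^ 3 + (p + 1) * τ ^ 4) * b) +
        τ ^ 2 * (1 - (p : ℝ) ^ 2 * τ ^ 4) * b := by
  have hX := HasValue.X τ
  have hP := HasValue.natCast τ p
  have h1 := HasValue.one τ
  refine ((((h1.sub ((hP.pow 2).mul (hX.pow 2))).mul (h1.sub (hX.pow 3))).mul
    (h1.sub ((hP.pow 2).mul (hX.pow 4)))).mul hx).unique ?_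
  convert ((h1.add (hP.mul (hX.pow 2))).mul (((h1.sub (hX.pow 3)).mul ha).add
    (((hX.pow 3).add ((hP.add h1).mul (hX.pow 4))).mul hb))).add
    (((hX.pow 2).mul (h1.sub ((hP.pow 2).mul (hX.pow 4)))).mul hb) using 1
  have h2 := denomSeries_mul_countSeries hp M
  rw [denomSeries] at h2
  linear_combination H.eq p hp * (1 + (p : PowerSeries ℝ) * X ^ 2) * (1 - X ^ 3) + V p * h2

end LocalData

end CotypeDensity

namespace CotypeDensity

open PowerSeries (X mk coeff)

/-! ### Multiplicative functions with prescribed local series -/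

/-- The multiplicative function whose local series at the prime `p` is `F p`. -/
noncomputable def ofLocal (F : ℕ → PowerSeries ℝ) : ArithmeticFunction ℝ :=
  ⟨fun n => if n = 0 then 0 else n.factorization.prod fun p k => coeff k (F p), if_pos rfl⟩

/-- The local series at `p` of an arithmetic function. -/
noncomputable def localSeries (f : ArithmeticFunction ℝ) (p : ℕ) : PowerSeries ℝ :=
  mk fun k => f (p ^ k)

variable {F : ℕ → PowerSeries ℝ} {p : ℕ}

theorem ofLocal_apply {n : ℕ} (hn : n ≠ 0) :
    ofLocal F n = n.factorization.prod fun p k => coeff k (F p) := if_neg hn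

theorem isMultiplicative_ofLocal (F : ℕ → PowerSeries ℝ) : (ofLocal F).IsMultiplicative := by
  rw [ArithmeticFunction.IsMultiplicative.iff_ne_zero]
  refine ⟨by rw [ofLocal_apply one_ne_zero]; simp, fun {m n} hm hn hmn => ?_⟩
  rw [ofLocal_apply (mul_ne_zero hm hn), ofLocal_apply hm, ofLocal_apply hn,
    Nat.factorization_mul_of_coprime hmn, Finsupp.prod_add_index_of_disjoint]
  simpa using hmn.disjoint_primeFactors

theorem ofLocal_prime_pow (hp : p.Prime) (hF : coeff 0 (F p) = 1) (k : ℕ) :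
    ofLocal F (p ^ k) = coeff k (F p) := by
  rw [ofLocal_apply (pow_ne_zero _ hp.ne_zero), hp.factorization_pow, Finsupp.prod_single_index hF]

theorem localSeries_ofLocal (hp : p.Prime) (hF : coeff 0 (F p) = 1) :
    localSeries (ofLocal F) p = F p := by
  ext k
  rw [localSeries, PowerSeries.coeff_mk, ofLocal_prime_pow hp hF]

theorem localSeries_mul (hp : p.Prime) (f g : ArithmeticFunction ℝ) :
    localSeries (f * g) p = localSeries f p * localSeries g p := by
  ext k
  rw [localSeries, PowerSeries.coeff_mk, PowerSeries.coeff_mul, ArithmeticFunction.mul_apply,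
    Nat.sum_divisorsAntidiagonal fun i j => f i * g j, Nat.sum_divisors_prime_pow hp,
    Finset.Nat.sum_antidiagonal_eq_sum_range_succ fun i j =>
      coeff i (localSeries f p) * coeff j (localSeries g p)]
  refine Finset.sum_congr rfl fun i hi => ?_
  rw [Nat.pow_div (Nat.lt_succ_iff.1 (Finset.mem_range.1 hi)) hp.pos]
  simp [localSeries]

theorem eq_mul_of_localSeries {f u g : ArithmeticFunction ℝ} (hf : f.IsMultiplicative)
    (hu : u.IsMultiplicative) (hg : g.IsMultiplicative)
    (h : ∀ p : ℕ, p.Prime → localSeries f p = localSeries u p * localSeries g p) : f = u * g := by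
  refine (ArithmeticFunction.IsMultiplicative.eq_iff_eq_on_prime_powers _ hf _ (hu.mul hg)).2
    fun p i hp => ?_
  have := congrArg (coeff i) (h p hp)
  rw [← localSeries_mul hp] at this
  simpa [localSeries] using this

/-! ### Euler products -/

theorem inv_pow_pow_comm (p r k : ℕ) : (((p ^ k : ℕ) : ℝ) ^ r)⁻¹ = (((p : ℝ) ^ r)⁻¹) ^ k := by
  push_cast
  rw [inv_pow, ← pow_mul, ← pow_mul, mul_comm]

/-- A finite sum of the nonnegative terms is at most a finite Euler product whose factors are at
most `1 + c / p ^ 2 ≤ exp (c / p ^ 2)`; the convergence of `∑ c / n ^ 2` bounds all of them. -/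
theorem summable_ofLocal {r : ℕ} (hF0 : ∀ p : ℕ, p.Prime → coeff 0 (F p) = 1)
    (hF : IsLocalO r 2 fun p => F p - 1) :
    Summable fun n : ℕ => ‖ofLocal F n * ((n : ℝ) ^ r)⁻¹‖ := by
  obtain ⟨c, hc, hF⟩ := hF
  set f : ℕ → ℝ := fun n => ‖ofLocal F n * ((n : ℝ) ^ r)⁻¹‖ with hf
  have hmult := isMultiplicative_ofLocal F
  have hf1 : f 1 = 1 := by simp [hf, hmult.1]
  have hfmul : ∀ {m n : ℕ}, m.Coprime n → f (m * n) = f m * f n := fun {m n} hmn => by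
    simp only [hf]
    rw [hmult.2 hmn, ← norm_mul]
    congr 1
    push_cast
    rw [mul_pow, mul_inv]
    ring
  have hval : ∀ p : ℕ, p.Prime → ∃ a, HasValue (((p : ℝ) ^ r)⁻¹) (F p) a := fun p hp => by
    obtain ⟨⟨a, ha⟩, -⟩ := hF p hp
    exact ⟨a + 1, by simpa using ha.add (HasValue.one _)⟩
  have hfp : ∀ p : ℕ, p.Prime → (fun k => f (p ^ k)) =
      fun k => ‖coeff k (F p) * (((p : ℝ) ^ r)⁻¹) ^ k‖ := fun p hp => by
    ext k
    simp only [hf]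
    rw [ofLocal_prime_pow hp (hF0 p hp), inv_pow_pow_comm]
  have hsum : ∀ {p : ℕ}, p.Prime → Summable fun k => ‖f (p ^ k)‖ := fun {p} hp => by
    obtain ⟨a, ha⟩ := hval p hp
    have : (fun k => ‖f (p ^ k)‖) = fun k => f (p ^ k) := by
      ext k
      rw [Real.norm_of_nonneg (norm_nonneg _)]
    rw [this, hfp p hp]
    exact ha.1
  have hS : Summable fun n : ℕ => c / (n : ℝ) ^ 2 := by
    simpa [div_eq_mul_inv] using
      (Real.summable_nat_pow_inv.2 one_lt_two).mul_left c
  refine summable_of_sum_le (c := Real.exp (∑' n : ℕ, c / (n : ℝ) ^ 2))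
    (fun _ => norm_nonneg _) fun s => ?_
  obtain ⟨N, hN⟩ := s.exists_nat_subset_range
  have hE := (EulerProduct.summable_and_hasSum_smoothNumbers_prod_primesBelow_tsum hf1 hfmul
    hsum N).2
  have hind : HasSum ((Nat.smoothNumbers N).indicator f) (∏ p ∈ N.primesBelow, ∑' k, f (p ^ k)) :=
    hasSum_subtype_iff_indicator.1 hE
  calc ∑ n ∈ s, f n ≤ ∑ n ∈ s, (Nat.smoothNumbers N).indicator f n := by
        refine Finset.sum_le_sum fun n hn => ?_
        rcases eq_or_ne n 0 with rfl | hn0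
        · simp [hf, Set.indicator_apply]
        · rw [Set.indicator_of_mem]
          exact Nat.mem_smoothNumbers_of_lt (Nat.pos_of_ne_zero hn0)
            (Finset.mem_range.1 (hN hn))
    _ ≤ ∏ p ∈ N.primesBelow, ∑' k, f (p ^ k) :=
        sum_le_hasSum s (fun n _ => Set.indicator_nonneg (fun _ _ => norm_nonneg _) n) hind
    _ ≤ ∏ p ∈ N.primesBelow, Real.exp (c / (p : ℝ) ^ 2) := by
        refine Finset.prod_le_prod (fun p _ => tsum_nonneg fun _ => norm_nonneg _) fun p hp => ?_
        have hp' := Nat.prime_of_mem_primesBelow hp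
        rw [hfp p hp']
        obtain ⟨⟨a, ha⟩, h1⟩ := hF p hp'
        have h2 := weightedNorm_add_le ha (HasValue.one (((p : ℝ) ^ r)⁻¹))
        have h3 := weightedNorm_natCast (((p : ℝ) ^ r)⁻¹) 1
        rw [Nat.cast_one, Nat.cast_one] at h3
        rw [sub_add_cancel, h3] at h2
        calc _ ≤ c / (p : ℝ) ^ 2 + 1 := h2.trans (by gcongr)
          _ ≤ _ := Real.add_one_le_exp _
    _ = Real.exp (∑ p ∈ N.primesBelow, c / (p : ℝ) ^ 2) := (Real.exp_sum _ _).symm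
    _ ≤ _ := Real.exp_le_exp.2 (hS.sum_le_tsum _ fun _ _ => by positivity)

theorem tendsto_prod_ofLocal {r : ℕ} (hF0 : ∀ p : ℕ, p.Prime → coeff 0 (F p) = 1)
    (hF : IsLocalO r 2 fun p => F p - 1) {a : ℕ → ℝ}
    (ha : ∀ p : ℕ, p.Prime → HasValue (((p : ℝ) ^ r)⁻¹) (F p) (a p)) :
    Tendsto (fun N : ℕ => ∏ p ∈ N.primesBelow, a p) atTop
      (𝓝 (∑' n : ℕ, ofLocal F n * ((n : ℝ) ^ r)⁻¹)) := by
  have hmult := isMultiplicative_ofLocal F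
  have hE := EulerProduct.eulerProduct (f := fun n : ℕ => ofLocal F n * ((n : ℝ) ^ r)⁻¹)
    (by simp [hmult.1]) (fun {m n} hmn => by
      rw [hmult.2 hmn]
      push_cast
      rw [mul_pow, mul_inv]
      ring) (summable_ofLocal hF0 hF) (by simp)
  refine hE.congr fun N => Finset.prod_congr rfl fun p hp => ?_
  have hp' := Nat.prime_of_mem_primesBelow hp
  rw [← (ha p hp').2]
  refine tsum_congr fun k => ?_
  rw [ofLocal_prime_pow hp' (hF0 p hp'), inv_pow_pow_comm]

/-! ### The counting functions as arithmetic functions -/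

/-- The number of closed sublattices of index `n` and corank at most `m`. -/
noncomputable def countFun (M : Matrix (Fin 3) (Fin 3) ℤ) (m : ℕ) : ArithmeticFunction ℝ :=
  ⟨fun n => if n = 0 then 0 else (closedCount M m n : ℝ), if_pos rfl⟩

variable {M : Matrix (Fin 3) (Fin 3) ℤ} {m : ℕ}

theorem countFun_apply {n : ℕ} (hn : n ≠ 0) : countFun M m n = closedCount M m n := if_neg hn

theorem closedCount_one (M : Matrix (Fin 3) (Fin 3) ℤ) (m : ℕ) : closedCount M m 1 = 1 := by
  have h := closedCount_prime_pow (M := M) Nat.prime_two m 0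
  rw [pow_zero, Finset.sum_range_succ', rankCount_zero_zero] at h
  rw [h, Finset.sum_eq_zero, zero_add]
  exact fun j _ => rankCount_eq_zero_of_lt Nat.prime_two (Nat.succ_pos j)

theorem isMultiplicative_countFun (M : Matrix (Fin 3) (Fin 3) ℤ) (m : ℕ) :
    (countFun M m).IsMultiplicative := by
  rw [ArithmeticFunction.IsMultiplicative.iff_ne_zero]
  refine ⟨by rw [countFun_apply one_ne_zero, closedCount_one, Nat.cast_one],
    fun {a b} ha hb hab => ?_⟩
  rw [countFun_apply (mul_ne_zero ha hb), countFun_apply ha, countFun_apply hb,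
    closedCount_mul_of_coprime M m hab ha hb, Nat.cast_mul]

theorem localSeries_countFun (hp : p.Prime) : localSeries (countFun M m) p = countSeries M p m := by
  ext k
  rw [localSeries, countSeries, PowerSeries.coeff_mk, PowerSeries.coeff_mk,
    countFun_apply (pow_ne_zero _ hp.ne_zero)]

theorem coeff_zero_countSeries : coeff 0 (countSeries M p m) = 1 := by
  rw [countSeries, PowerSeries.coeff_mk, pow_zero, closedCount_one, Nat.cast_one]

/-- The singular part `u` is split off as a Dirichlet factor; the other factor has local series
`countSeries M p m * V p`, close to `1`. -/
theorem countFun_eq_mul {u : ArithmeticFunction ℝ} {V : ℕ → PowerSeries ℝ}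
    (hu : u.IsMultiplicative) (huV : ∀ p : ℕ, p.Prime → localSeries u p * V p = 1)
    (hV : ∀ p : ℕ, p.Prime → coeff 0 (V p) = 1) :
    countFun M m = u * ofLocal fun p => countSeries M p m * V p := by
  refine eq_mul_of_localSeries (isMultiplicative_countFun M m) hu (isMultiplicative_ofLocal _)
    fun p hp => ?_
  rw [localSeries_countFun hp, localSeries_ofLocal hp]
  · linear_combination -countSeries M p m * huV p hp
  · rw [PowerSeries.coeff_mul]
    simp [hV p hp, coeff_zero_countSeries]

end CotypeDensity

namespace CotypeDensity

/-! ### Growth of summatory functions -/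

/-- The summatory function `∑_{0 < n ≤ N} f n`. -/
noncomputable def summatory (f : ArithmeticFunction ℝ) (N : ℕ) : ℝ := ∑ n ∈ Finset.Ioc 0 N, f n

theorem summatory_zero (f : ArithmeticFunction ℝ) : summatory f 0 = 0 := by simp [summatory]

theorem summatory_mul (f g : ArithmeticFunction ℝ) (N : ℕ) :
    summatory (f * g) N = ∑ k ∈ Finset.Ioc 0 N, f k * summatory g (N / k) :=
  ArithmeticFunction.sum_Ioc_mul_eq_sum_sum f g N

/-- The summatory function of `u` is asymptotic to `κ N ^ r ℓ(N)`, for a slowly varying `ℓ`. -/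
structure HasGrowth (u : ArithmeticFunction ℝ) (r : ℕ) (ℓ : ℕ → ℝ) (κ : ℝ) : Prop where
  mono : Monotone ℓ
  one_le : ∀ N, 1 ≤ ℓ N
  slow : ∀ k, 0 < k → Tendsto (fun N => ℓ (N / k) / ℓ N) atTop (𝓝 1)
  tendsto : Tendsto (fun N : ℕ => summatory u N / ((N : ℝ) ^ r * ℓ N)) atTop (𝓝 κ)

theorem tendsto_natCast_div_div (k : ℕ) (hk : 0 < k) :
    Tendsto (fun N : ℕ => ((N / k : ℕ) : ℝ) / N) atTop (𝓝 (k : ℝ)⁻¹) := by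
  have hk' : (0 : ℝ) < k := by exact_mod_cast hk
  have h := (tendsto_nat_floor_mul_div_atTop (R := ℝ) (a := (k : ℝ)⁻¹) (by positivity)).comp
    tendsto_natCast_atTop_atTop
  refine h.congr fun N => ?_
  simp only [Function.comp_apply]
  rw [inv_mul_eq_div, Nat.floor_div_natCast, Nat.floor_natCast]

theorem HasGrowth.exists_bound {u : ArithmeticFunction ℝ} {r : ℕ} {ℓ : ℕ → ℝ} {κ : ℝ}
    (h : HasGrowth u r ℓ κ) :
    ∃ K : ℝ, 0 ≤ K ∧ ∀ N : ℕ, |summatory u N| ≤ K * ((N : ℝ) ^ r * ℓ N) := by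
  obtain ⟨K, hK⟩ := (Metric.isBounded_range_of_tendsto _ h.tendsto).exists_norm_le
  have hK' : ∀ N : ℕ, |summatory u N / ((N : ℝ) ^ r * ℓ N)| ≤ K := fun N => hK _ ⟨N, rfl⟩
  refine ⟨K, (abs_nonneg _).trans (hK' 0), fun N => ?_⟩
  rcases Nat.eq_zero_or_pos N with rfl | hN
  · rw [summatory_zero, abs_zero]
    exact mul_nonneg ((abs_nonneg _).trans (hK' 0))
      (mul_nonneg (by positivity) (zero_le_one.trans (h.one_le 0)))
  · have hpos : 0 < (N : ℝ) ^ r * ℓ N :=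
      mul_pos (by positivity) (zero_lt_one.trans_le (h.one_le N))
    have := hK' N
    rwa [abs_div, abs_of_pos hpos, div_le_iff₀ hpos] at this

/-- The summatory function is `∑ g(k) U(⌊N / k⌋)` with `U` that of `u`. Divided by `N ^ r ℓ(N)`, the
term of `k` tends to `κ g(k) k ^ (-r)` since `ℓ` varies slowly, and it is dominated by a constant
times `|g(k)| k ^ (-r)` since `ℓ` is monotone. -/
theorem HasGrowth.mul {u g : ArithmeticFunction ℝ} {r : ℕ} {ℓ : ℕ → ℝ} {κ : ℝ}
    (h : HasGrowth u r ℓ κ) (hg : Summable fun n : ℕ => ‖g n * ((n : ℝ) ^ r)⁻¹‖) :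
    HasGrowth (g * u) r ℓ (κ * ∑' n : ℕ, g n * ((n : ℝ) ^ r)⁻¹) := by
  refine ⟨h.mono, h.one_le, h.slow, ?_⟩
  obtain ⟨K, hK0, hK⟩ := h.exists_bound
  have hℓ : ∀ N, 0 < ℓ N := fun N => zero_lt_one.trans_le (h.one_le N)
  have hsum : ∀ N : ℕ, summatory (g * u) N / ((N : ℝ) ^ r * ℓ N) =
      ∑' k, g k * summatory u (N / k) / ((N : ℝ) ^ r * ℓ N) := by
    intro N
    rw [summatory_mul, Finset.sum_div, tsum_eq_sum]
    intro k hk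
    rcases Nat.eq_zero_or_pos k with rfl | hk0
    · simp
    · rw [Nat.div_eq_of_lt (by simpa [hk0] using hk), summatory_zero]
      simp
  simp_rw [hsum]
  rw [← tsum_mul_left]
  refine tendsto_tsum_of_dominated_convergence (bound := fun k => K * ‖g k * ((k : ℝ) ^ r)⁻¹‖)
    (hg.mul_left K) (fun k => ?_) ?_
  · rcases Nat.eq_zero_or_pos k with rfl | hk
    · simp
    have h1 := h.tendsto.comp (Nat.tendsto_div_const_atTop hk.ne')
    have h2 := ((h1.mul ((tendsto_natCast_div_div k hk).pow r)).mul (h.slow k hk)).const_mul (g k)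
    have h3 : g k * (κ * (k : ℝ)⁻¹ ^ r * 1) = κ * (g k * ((k : ℝ) ^ r)⁻¹) := by
      rw [inv_pow]; ring
    rw [h3] at h2
    refine h2.congr' ?_
    filter_upwards [eventually_ge_atTop k] with N hN
    have hNk : 0 < N / k := Nat.div_pos hN hk
    have hNk' : ((N / k : ℕ) : ℝ) ≠ 0 := by exact_mod_cast hNk.ne'
    have hN' : (N : ℝ) ≠ 0 := by exact_mod_cast (hk.trans_le hN).ne'
    have := (hℓ (N / k)).ne'
    have := (hℓ N).ne'
    simp only [Function.comp_apply]
    rw [div_pow]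
    field_simp
  · refine Eventually.of_forall fun N k => ?_
    rcases Nat.eq_zero_or_pos k with rfl | hk
    · simp
    rcases Nat.eq_zero_or_pos N with rfl | hN
    · rw [Nat.zero_div, summatory_zero, mul_zero, zero_div, norm_zero]
      positivity
    have hk' : (0 : ℝ) < k := by exact_mod_cast hk
    have hpos : 0 < (N : ℝ) ^ r * ℓ N := mul_pos (by positivity) (hℓ N)
    rw [norm_div, Real.norm_of_nonneg hpos.le, div_le_iff₀ hpos, norm_mul, norm_mul,
      Real.norm_of_nonneg (by positivity : 0 ≤ ((k : ℝ) ^ r)⁻¹), Real.norm_eq_abs (summatory _ _)]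
    calc ‖g k‖ * |summatory u (N / k)|
        ≤ ‖g k‖ * (K * (((N / k : ℕ) : ℝ) ^ r * ℓ (N / k))) := by
          gcongr
          exact hK _
      _ ≤ ‖g k‖ * (K * (((N : ℝ) / k) ^ r * ℓ N)) := by
          have h1 : ((N / k : ℕ) : ℝ) ≤ (N : ℝ) / k := Nat.cast_div_le
          have h2 : ℓ (N / k) ≤ ℓ N := h.mono (Nat.div_le_self N k)
          have := (hℓ (N / k)).le
          gcongr
      _ = K * (‖g k‖ * ((k : ℝ) ^ r)⁻¹) * ((N : ℝ) ^ r * ℓ N) := by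
          rw [div_pow]
          field_simp

/-! ### Growth of the densities of the five algebras -/

/-- The function `n ↦ n ^ a`. -/
noncomputable def powFun (a : ℕ) : ArithmeticFunction ℝ :=
  ⟨fun n => if n = 0 then 0 else (n : ℝ) ^ a, if_pos rfl⟩

theorem powFun_apply {a n : ℕ} (hn : n ≠ 0) : powFun a n = (n : ℝ) ^ a := if_neg hn

theorem isMultiplicative_powFun (a : ℕ) : (powFun a).IsMultiplicative := by
  rw [ArithmeticFunction.IsMultiplicative.iff_ne_zero]
  refine ⟨by simp [powFun_apply], fun {m n} hm hn _ => ?_⟩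
  rw [powFun_apply (mul_ne_zero hm hn), powFun_apply hm, powFun_apply hn, Nat.cast_mul, mul_pow]

theorem HasGrowth.of_one {u : ArithmeticFunction ℝ} {r : ℕ} {κ : ℝ}
    (h : Tendsto (fun N : ℕ => summatory u N / (N : ℝ) ^ r) atTop (𝓝 κ)) :
    HasGrowth u r (fun _ => 1) κ :=
  ⟨fun _ _ _ => le_rfl, fun _ => le_rfl, fun _ _ => by simp, by simpa using h⟩

theorem summatory_powFun_one (N : ℕ) : summatory (powFun 1) N = N * (N + 1) / 2 := by
  induction N with
  | zero => simp [summatory]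
  | succ N ih =>
    rw [summatory] at ih ⊢
    rw [Finset.sum_Ioc_succ_top (Nat.zero_le N), ih, powFun_apply (Nat.succ_ne_zero N)]
    push_cast
    ring

theorem summatory_powFun_two (N : ℕ) :
    summatory (powFun 2) N = N * (N + 1) * (2 * N + 1) / 6 := by
  induction N with
  | zero => simp [summatory]
  | succ N ih =>
    rw [summatory] at ih ⊢
    rw [Finset.sum_Ioc_succ_top (Nat.zero_le N), ih, powFun_apply (Nat.succ_ne_zero N)]
    push_cast
    ring

theorem hasGrowth_powFun_one : HasGrowth (powFun 1) 2 (fun _ => 1) (1 / 2) := by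
  refine .of_one ?_
  have h : Tendsto (fun N : ℕ => (1 + ((N : ℝ))⁻¹) / 2) atTop (𝓝 ((1 + 0) / 2)) :=
    (tendsto_inv_atTop_nhds_zero_nat.const_add 1).div_const 2
  rw [add_zero] at h
  refine h.congr' ?_
  filter_upwards [eventually_gt_atTop 0] with N hN
  have : (N : ℝ) ≠ 0 := by exact_mod_cast hN.ne'
  rw [summatory_powFun_one]
  field_simp

theorem hasGrowth_powFun_two : HasGrowth (powFun 2) 3 (fun _ => 1) (1 / 3) := by
  refine .of_one ?_
  have hi := tendsto_inv_atTop_nhds_zero_nat (𝕜 := ℝ)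
  have h : Tendsto (fun N : ℕ => (1 + ((N : ℝ))⁻¹) * (2 + ((N : ℝ))⁻¹) / 6) atTop
      (𝓝 ((1 + 0) * (2 + 0) / 6)) :=
    ((hi.const_add 1).mul (hi.const_add 2)).div_const 6
  have h3 : ((1 : ℝ) + 0) * (2 + 0) / 6 = 1 / 3 := by norm_num
  rw [h3] at h
  refine h.congr' ?_
  filter_upwards [eventually_gt_atTop 0] with N hN
  have : (N : ℝ) ≠ 0 := by exact_mod_cast hN.ne'
  rw [summatory_powFun_two]
  field_simp

theorem abs_summatory_powFun_one_div_sub_le (N k : ℕ) (hk : 0 < k) :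
    |summatory (powFun 1) (N / k) - ((N : ℝ) / k) ^ 2 / 2| ≤ (N : ℝ) / k := by
  have hk' : (0 : ℝ) < k := by exact_mod_cast hk
  have h1 : ((N / k : ℕ) : ℝ) ≤ (N : ℝ) / k := Nat.cast_div_le
  have h2 : (N : ℝ) / k < ((N / k : ℕ) : ℝ) + 1 := by
    rw [div_lt_iff₀ hk']
    exact_mod_cast (Nat.lt_div_mul_add hk).trans_eq (by ring)
  have h3 : (0 : ℝ) ≤ ((N / k : ℕ) : ℝ) := Nat.cast_nonneg _
  rw [summatory_powFun_one, abs_le]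
  constructor <;> nlinarith

/-- The growth of `n ↦ ∑_{d ∣ n} w d (n / d)` when `w` has logarithmic density. -/
theorem hasGrowth_mul_powFun_one {w : ArithmeticFunction ℝ} {c C : ℝ} (hw : ∀ n, 0 ≤ w n)
    (hlog : Tendsto (fun N : ℕ => (∑ k ∈ Finset.Ioc 0 N, w k / (k : ℝ) ^ 2) /
      (1 + Real.log N)) atTop (𝓝 c))
    (hC : ∀ N : ℕ, ∑ k ∈ Finset.Ioc 0 N, w k / (k : ℝ) ≤ C * N) :
    HasGrowth (w * powFun 1) 2 (fun N => 1 + Real.log N) (c / 2) := by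
  have hpos : ∀ N : ℕ, 1 ≤ 1 + Real.log N := fun N => by
    linarith [Real.log_natCast_nonneg N]
  have hinf : Tendsto (fun N : ℕ => 1 + Real.log N) atTop atTop :=
    tendsto_atTop_add_const_left _ _ (Real.tendsto_log_atTop.comp tendsto_natCast_atTop_atTop)
  refine ⟨fun a b hab => ?_, hpos, fun k hk => ?_, ?_⟩
  · rcases Nat.eq_zero_or_pos a with rfl | ha
    · simpa using Real.log_natCast_nonneg b
    · gcongr
  · have h1 : Tendsto (fun N : ℕ => 1 - Real.log (2 * k) / (1 + Real.log N)) atTop (𝓝 (1 - 0)) :=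
      (hinf.const_div_atTop _).const_sub 1
    rw [sub_zero] at h1
    refine tendsto_of_tendsto_of_tendsto_of_le_of_le' h1 tendsto_const_nhds ?_ ?_
    · filter_upwards [eventually_ge_atTop k] with N hN
      have hN0 : 0 < N := hk.trans_le hN
      have hNk : 0 < N / k := Nat.div_pos hN hk
      rw [le_div_iff₀ (zero_lt_one.trans_le (hpos N)), sub_mul,
        div_mul_cancel₀ _ (zero_lt_one.trans_le (hpos N)).ne', one_mul]
      have h2 : N ≤ 2 * k * (N / k) := by
        have := Nat.lt_div_mul_add hk (a := N)
        nlinarith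
      have h3 : Real.log N ≤ Real.log (2 * k * (N / k : ℕ)) :=
        Real.log_le_log (by exact_mod_cast hN0) (by exact_mod_cast h2)
      rw [Real.log_mul (by positivity) (by positivity)] at h3
      linarith
    · filter_upwards [eventually_ge_atTop k] with N hN
      have hNk : 0 < N / k := Nat.div_pos hN hk
      rw [div_le_one (zero_lt_one.trans_le (hpos N))]
      have : Real.log (N / k : ℕ) ≤ Real.log N :=
        Real.log_le_log (by exact_mod_cast hNk) (by exact_mod_cast Nat.div_le_self N k)
      linarith
  · have hmain := hlog.div_const 2
    have herr : Tendsto (fun N : ℕ => |C| / (1 + Real.log N)) atTop (𝓝 0) :=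
      hinf.const_div_atTop _
    refine tendsto_of_tendsto_of_dist hmain (squeeze_zero' (Eventually.of_forall fun _ =>
      dist_nonneg) ?_ herr)
    filter_upwards [eventually_gt_atTop 0] with N hN
    have hN' : (0 : ℝ) < N := by exact_mod_cast hN
    have hL : 0 < 1 + Real.log N := zero_lt_one.trans_le (hpos N)
    -- Replacing the inner sum by `(N / k) ^ 2 / 2` costs at most `N / k`. The bound on `∑ w(k) / k`
    -- makes the total error `O(N ^ 2)`, which is negligible against `N ^ 2 log N`.
    have hdiff : |summatory (w * powFun 1) N -
        (N : ℝ) ^ 2 / 2 * ∑ k ∈ Finset.Ioc 0 N, w k / (k : ℝ) ^ 2| ≤ |C| * (N : ℝ) ^ 2 := by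
      rw [summatory_mul, Finset.mul_sum, ← Finset.sum_sub_distrib]
      calc _ ≤ ∑ k ∈ Finset.Ioc 0 N, w k * ((N : ℝ) / k) := by
            refine (Finset.abs_sum_le_sum_abs _ _).trans (Finset.sum_le_sum fun k hk => ?_)
            have hk0 : 0 < k := (Finset.mem_Ioc.1 hk).1
            have h1 := abs_summatory_powFun_one_div_sub_le N k hk0
            have h2 : w k * summatory (powFun 1) (N / k) - (N : ℝ) ^ 2 / 2 * (w k / (k : ℝ) ^ 2) =
                w k * (summatory (powFun 1) (N / k) - ((N : ℝ) / k) ^ 2 / 2) := by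
              rw [div_pow]; ring
            rw [h2, abs_mul, abs_of_nonneg (hw k)]
            exact mul_le_mul_of_nonneg_left h1 (hw k)
        _ = N * ∑ k ∈ Finset.Ioc 0 N, w k / (k : ℝ) := by
            rw [Finset.mul_sum]
            exact Finset.sum_congr rfl fun k _ => by ring
        _ ≤ N * (|C| * N) := by
            gcongr
            exact (hC N).trans (by gcongr; exact le_abs_self C)
        _ = _ := by ring
    rw [dist_comm, Real.dist_eq]
    have : summatory (w * powFun 1) N / ((N : ℝ) ^ 2 * (1 + Real.log N)) -
        (∑ k ∈ Finset.Ioc 0 N, w k / (k : ℝ) ^ 2) / (1 + Real.log N) / 2 =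
        (summatory (w * powFun 1) N - (N : ℝ) ^ 2 / 2 * ∑ k ∈ Finset.Ioc 0 N, w k / (k : ℝ) ^ 2) /
          ((N : ℝ) ^ 2 * (1 + Real.log N)) := by
      field_simp
    have hW : 0 < (N : ℝ) ^ 2 * (1 + Real.log N) := mul_pos (by positivity) hL
    rw [this, abs_div, abs_of_pos hW, div_le_div_iff₀ hW hL]
    calc _ ≤ |C| * (N : ℝ) ^ 2 * (1 + Real.log N) := mul_le_mul_of_nonneg_right hdiff hL.le
      _ = _ := by ring

end CotypeDensity

namespace CotypeDensity

open PowerSeries (X mk coeff)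

theorem tendsto_div_one_add_log {A : ℕ → ℝ} {c d : ℝ}
    (h : ∀ N : ℕ, 0 < N → |A N - c * Real.log N| ≤ d) :
    Tendsto (fun N : ℕ => A N / (1 + Real.log N)) atTop (𝓝 c) := by
  have hinf : Tendsto (fun N : ℕ => 1 + Real.log N) atTop atTop :=
    tendsto_atTop_add_const_left _ _ (Real.tendsto_log_atTop.comp tendsto_natCast_atTop_atTop)
  have herr : Tendsto (fun N : ℕ => (d + |c|) / (1 + Real.log N)) atTop (𝓝 0) :=
    hinf.const_div_atTop _
  refine tendsto_of_tendsto_of_dist tendsto_const_nhds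
    (squeeze_zero' (Eventually.of_forall fun _ => dist_nonneg) ?_ herr)
  filter_upwards [eventually_gt_atTop 0] with N hN
  have hL : 0 < 1 + Real.log N := by linarith [Real.log_natCast_nonneg N]
  rw [dist_comm, Real.dist_eq]
  have : A N / (1 + Real.log N) - c = ((A N - c * Real.log N) - c) / (1 + Real.log N) := by
    field_simp
    ring
  rw [this, abs_div, abs_of_pos hL]
  gcongr
  exact (abs_sub _ _).trans (by gcongr; exact h N hN)

theorem sum_inv_eq_harmonic (N : ℕ) : ∑ k ∈ Finset.Ioc 0 N, ((k : ℝ))⁻¹ = harmonic N := by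
  rw [harmonic_eq_sum_Icc]
  push_cast
  rfl

theorem hasGrowth_powFun_one_mul_powFun_one :
    HasGrowth (powFun 1 * powFun 1) 2 (fun N => 1 + Real.log N) (1 / 2) := by
  refine hasGrowth_mul_powFun_one (C := 1) (fun n => ?_) ?_ fun N => ?_
  · rcases Nat.eq_zero_or_pos n with rfl | hn
    · simp
    · rw [powFun_apply hn.ne']
      positivity
  · refine tendsto_div_one_add_log (d := 1) fun N hN => ?_
    have : ∑ k ∈ Finset.Ioc 0 N, powFun 1 k / (k : ℝ) ^ 2 = harmonic N := by
      rw [← sum_inv_eq_harmonic]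
      refine Finset.sum_congr rfl fun k hk => ?_
      have hk : 0 < k := (Finset.mem_Ioc.1 hk).1
      have hk' : (k : ℝ) ≠ 0 := by exact_mod_cast hk.ne'
      rw [powFun_apply hk.ne']
      field_simp
    rw [this, one_mul, abs_le]
    have h1 := log_add_one_le_harmonic N
    have h2 := harmonic_le_one_add_log N
    have h3 : Real.log N ≤ Real.log (N + 1 : ℕ) :=
      Real.log_le_log (by exact_mod_cast hN) (by push_cast; linarith)
    constructor <;> linarith
  · rw [Finset.sum_congr rfl (g := fun _ => (1 : ℝ))]
    · simp
    · intro k hk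
      have hk : 0 < k := (Finset.mem_Ioc.1 hk).1
      have hk' : (k : ℝ) ≠ 0 := by exact_mod_cast hk.ne'
      rw [powFun_apply hk.ne', pow_one, div_self hk']

/-- The function supported on squares with `j ^ 2 ↦ j ^ 3`. -/
noncomputable def sqFun : ArithmeticFunction ℝ :=
  ⟨fun n => if IsSquare n then (n.sqrt : ℝ) ^ 3 else 0, by simp⟩

theorem sqFun_sq (j : ℕ) : sqFun (j ^ 2) = (j : ℝ) ^ 3 := by
  change (if IsSquare (j ^ 2) then ((j ^ 2).sqrt : ℝ) ^ 3 else 0) = _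
  rw [if_pos ⟨j, sq j⟩, Nat.sqrt_eq']

theorem sqFun_of_not_isSquare {n : ℕ} (hn : ¬ IsSquare n) : sqFun n = 0 := if_neg hn

theorem isSquare_of_coprime_mul {m n : ℕ} (hmn : m.Coprime n) (h : IsSquare (m * n)) :
    IsSquare m := by
  obtain ⟨c, hc⟩ := h
  rw [← sq] at hc
  obtain ⟨d, hd⟩ := exists_associated_pow_of_mul_eq_pow
    (by rw [Nat.isUnit_iff]; exact hmn) hc
  rw [associated_iff_eq] at hd
  exact ⟨d, by rw [← hd, sq]⟩

theorem isMultiplicative_sqFun : sqFun.IsMultiplicative := by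
  refine ⟨by simpa using sqFun_sq 1, fun {m n} hmn => ?_⟩
  by_cases h : IsSquare (m * n)
  · obtain ⟨a, rfl⟩ := isSquare_of_coprime_mul hmn h
    obtain ⟨b, rfl⟩ := isSquare_of_coprime_mul hmn.symm (by rwa [mul_comm])
    rw [← sq, ← sq, ← mul_pow, sqFun_sq, sqFun_sq, sqFun_sq, Nat.cast_mul, mul_pow]
  · rw [sqFun_of_not_isSquare h]
    by_cases hm : IsSquare m
    · rw [sqFun_of_not_isSquare fun hn => h (hm.mul hn), mul_zero]
    · rw [sqFun_of_not_isSquare hm, zero_mul]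

theorem sum_sqFun_mul (g : ℕ → ℝ) (N : ℕ) :
    ∑ n ∈ Finset.Ioc 0 N, sqFun n * g n =
      ∑ j ∈ Finset.Ioc 0 N.sqrt, (j : ℝ) ^ 3 * g (j ^ 2) := by
  symm
  have h : ∀ j : ℕ, (j : ℝ) ^ 3 * g (j ^ 2) = sqFun (j ^ 2) * g (j ^ 2) := fun j => by rw [sqFun_sq]
  simp_rw [h]
  rw [← Finset.sum_image (f := fun n => sqFun n * g n) (g := fun j => j ^ 2)
    fun a _ b _ hab => Nat.pow_left_injective two_ne_zero hab]
  refine Finset.sum_subset (fun n hn => ?_) fun n hn hn' => ?_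
  · obtain ⟨j, hj, rfl⟩ := Finset.mem_image.1 hn
    rw [Finset.mem_Ioc] at hj ⊢
    exact ⟨by have := hj.1; positivity, Nat.le_sqrt'.1 hj.2⟩
  · rw [sqFun_of_not_isSquare, zero_mul]
    rintro ⟨j, rfl⟩
    refine hn' (Finset.mem_image.2 ⟨j, ?_, sq j⟩)
    rw [Finset.mem_Ioc] at hn ⊢
    exact ⟨Nat.pos_of_mul_pos_left hn.1, Nat.le_sqrt.2 hn.2⟩

/-- At `k = j ^ 2` the summand `w(k) / k ^ 2` is `1 / j`, so the sum up to `N` is harmonic of length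
`√N`, about `(log N) / 2`; this is the extra factor `1 / 2` in the constant. -/
theorem hasGrowth_sqFun_mul_powFun_one :
    HasGrowth (sqFun * powFun 1) 2 (fun N => 1 + Real.log N) (1 / 2 / 2) := by
  refine hasGrowth_mul_powFun_one (C := 1) (fun n => ?_) ?_ fun N => ?_
  · by_cases hn : IsSquare n
    · obtain ⟨j, rfl⟩ := hn
      rw [← sq, sqFun_sq]
      positivity
    · rw [sqFun_of_not_isSquare hn]
  · refine tendsto_div_one_add_log (d := 1) fun N hN => ?_
    have : ∑ k ∈ Finset.Ioc 0 N, sqFun k / (k : ℝ) ^ 2 = harmonic N.sqrt := by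
      simp_rw [div_eq_mul_inv]
      rw [sum_sqFun_mul, ← sum_inv_eq_harmonic]
      refine Finset.sum_congr rfl fun k hk => ?_
      have hk : 0 < k := (Finset.mem_Ioc.1 hk).1
      have hk' : (k : ℝ) ≠ 0 := by exact_mod_cast hk.ne'
      push_cast
      field_simp
    rw [this, abs_le]
    have h1 := log_add_one_le_harmonic N.sqrt
    have h2 := harmonic_le_one_add_log N.sqrt
    have hs : 0 < N.sqrt := Nat.sqrt_pos.2 hN
    have h3 : Real.log N ≤ 2 * Real.log (N.sqrt + 1 : ℕ) := by
      rw [← Real.log_rpow (by positivity)]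
      refine Real.log_le_log (by exact_mod_cast hN) ?_
      have := (Nat.lt_succ_sqrt' N).le
      exact_mod_cast this
    have h4 : 2 * Real.log (N.sqrt : ℕ) ≤ Real.log N := by
      rw [← Real.log_rpow (by positivity)]
      refine Real.log_le_log (by positivity) ?_
      have := Nat.sqrt_le' N
      exact_mod_cast this
    constructor <;> linarith
  · simp_rw [div_eq_mul_inv]
    rw [sum_sqFun_mul]
    calc _ ≤ ∑ j ∈ Finset.Ioc 0 N.sqrt, (N.sqrt : ℝ) := by
          refine Finset.sum_le_sum fun j hj => ?_
          rw [Finset.mem_Ioc] at hj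
          have hj' : (j : ℝ) ≠ 0 := by exact_mod_cast hj.1.ne'
          have h1 : (j : ℝ) ^ 3 * ((j ^ 2 : ℕ) : ℝ)⁻¹ = j := by
            push_cast
            field_simp
          rw [h1]
          exact_mod_cast hj.2
      _ = ((N.sqrt * N.sqrt : ℕ) : ℝ) := by simp
      _ ≤ 1 * N := by
          rw [one_mul]
          exact_mod_cast Nat.sqrt_le N

/-! ### The growth of the density of `L₂` -/

/-- The function `n ↦ χ₄(n) n`. -/
noncomputable def chiFun : ArithmeticFunction ℝ :=
  ⟨fun n => (ZMod.χ₄ n : ℝ) * n, by simp⟩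

theorem chiFun_apply (n : ℕ) : chiFun n = (ZMod.χ₄ n : ℝ) * n := rfl

theorem isMultiplicative_chiFun : chiFun.IsMultiplicative := by
  refine ⟨by simp [chiFun_apply], fun {m n} _ => ?_⟩
  simp only [chiFun_apply]
  push_cast
  rw [map_mul]
  push_cast
  ring

/-- One period contributes `(4q + 1) - (4q + 3) = -2`. The cancellation makes the summatory function
linear in size, where absolute values would give a quadratic one. -/
theorem summatory_chiFun (q : ℕ) :
    summatory chiFun (4 * q) = -2 * q ∧ summatory chiFun (4 * q + 1) = 2 * q + 1 ∧
      summatory chiFun (4 * q + 2) = 2 * q + 1 ∧ summatory chiFun (4 * q + 3) = -2 * q - 2 := by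
  have hs : ∀ n, summatory chiFun (n + 1) = summatory chiFun n + chiFun (n + 1) := fun n =>
    Finset.sum_Ioc_succ_top (Nat.zero_le n) _
  have hx : ∀ n, chiFun n = ((if n % 2 = 0 then 0 else if n % 4 = 1 then 1 else -1 : ℤ) : ℝ) * n :=
    fun n => by rw [chiFun_apply, ZMod.χ₄_nat_eq_if_mod_four]
  have step : ∀ q : ℕ, summatory chiFun (4 * q) = -2 * q →
      summatory chiFun (4 * q + 1) = 2 * q + 1 ∧ summatory chiFun (4 * q + 2) = 2 * q + 1 ∧
        summatory chiFun (4 * q + 3) = -2 * q - 2 ∧ summatory chiFun (4 * (q + 1)) =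
          -2 * (q + 1 : ℕ) := by
    intro q h
    have h1 : chiFun (4 * q + 1) = 4 * q + 1 := by
      rw [hx, if_neg (by omega), if_pos (by omega)]; push_cast; ring
    have h2 : chiFun (4 * q + 2) = 0 := by
      rw [hx, if_pos (by omega)]; push_cast; ring
    have h3 : chiFun (4 * q + 3) = -(4 * q + 3) := by
      rw [hx, if_neg (by omega), if_neg (by omega)]; push_cast; ring
    have h4 : chiFun (4 * q + 4) = 0 := by
      rw [hx, if_pos (by omega)]; push_cast; ring
    have e1 := hs (4 * q)
    have e2 := hs (4 * q + 1)
    have e3 := hs (4 * q + 2)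
    have e4 := hs (4 * q + 3)
    rw [show 4 * (q + 1) = 4 * q + 3 + 1 by ring]
    simp only [add_assoc, Nat.reduceAdd] at e1 e2 e3 e4 ⊢
    rw [h1, h] at e1
    rw [h2, e1] at e2
    rw [h3, e2] at e3
    rw [h4, e3] at e4
    push_cast
    refine ⟨?_, ?_, ?_, ?_⟩ <;> linarith
  have h0 : ∀ q : ℕ, summatory chiFun (4 * q) = -2 * q := by
    intro q
    induction q with
    | zero => simp [summatory]
    | succ q ih => exact (step q ih).2.2.2
  exact ⟨h0 q, (step q (h0 q)).1, (step q (h0 q)).2.1, (step q (h0 q)).2.2.1⟩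

theorem abs_summatory_chiFun_le (n : ℕ) : |summatory chiFun n| ≤ n := by
  obtain ⟨h0, h1, h2, h3⟩ := summatory_chiFun (n / 4)
  have hq : (0 : ℝ) ≤ (n / 4 : ℕ) := Nat.cast_nonneg _
  obtain h | h | h | h : n = 4 * (n / 4) ∨ n = 4 * (n / 4) + 1 ∨ n = 4 * (n / 4) + 2 ∨
    n = 4 * (n / 4) + 3 := by omega
  · rw [← h] at h0
    have h' := congrArg (Nat.cast (R := ℝ)) h
    push_cast at h'
    rw [h0, abs_le]
    constructor <;> linarith
  · rw [← h] at h1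
    have h' := congrArg (Nat.cast (R := ℝ)) h
    push_cast at h'
    rw [h1, abs_le]
    constructor <;> linarith
  · rw [← h] at h2
    have h' := congrArg (Nat.cast (R := ℝ)) h
    push_cast at h'
    rw [h2, abs_le]
    constructor <;> linarith
  · rw [← h] at h3
    have h' := congrArg (Nat.cast (R := ℝ)) h
    push_cast at h'
    rw [h3, abs_le]
    constructor <;> linarith

/-- Only odd arguments contribute, and they form the Leibniz series for `π / 4`. -/
theorem sum_chiFun_div_sq (j : ℕ) : ∑ k ∈ Finset.Ioc 0 (2 * j), chiFun k * ((k : ℝ) ^ 2)⁻¹ =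
    ∑ i ∈ Finset.range j, (-1 : ℝ) ^ i / (2 * i + 1) := by
  induction j with
  | zero => simp
  | succ j ih =>
    rw [Finset.sum_range_succ, ← ih, show 2 * (j + 1) = 2 * j + 1 + 1 by ring,
      Finset.sum_Ioc_succ_top (by omega), Finset.sum_Ioc_succ_top (by omega)]
    have h1 : chiFun (2 * j + 1) = (-1) ^ j * (2 * j + 1) := by
      rw [chiFun_apply, ZMod.χ₄_eq_neg_one_pow (by omega), show (2 * j + 1) / 2 = j by omega]
      push_cast
      ring
    have h2 : chiFun (2 * j + 1 + 1) = 0 := by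
      rw [chiFun_apply, ZMod.χ₄_nat_eq_if_mod_four, if_pos (by omega)]
      simp
    rw [h1, h2]
    have : (2 * (j : ℝ) + 1) ≠ 0 := by positivity
    push_cast
    field_simp
    ring

/-- The truncation of `f` to arguments at most `K`. -/
noncomputable def truncate (K : ℕ) (f : ArithmeticFunction ℝ) : ArithmeticFunction ℝ :=
  ⟨fun n => if n ≤ K then f n else 0, by simp⟩

theorem truncate_apply (K : ℕ) (f : ArithmeticFunction ℝ) (n : ℕ) :
    truncate K f n = if n ≤ K then f n else 0 := rfl

theorem abs_summatory_chiFun_sub_truncate_le (K n : ℕ) :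
    |summatory (chiFun - truncate K chiFun) n| ≤ if n ≤ K then (0 : ℝ) else 2 * (n : ℝ) := by
  have hsub : summatory (chiFun - truncate K chiFun) n =
      summatory chiFun n - summatory chiFun (min n K) := by
    have h1 : summatory (truncate K chiFun) n = summatory chiFun (min n K) := by
      simp only [summatory, truncate_apply]
      rw [← Finset.sum_filter]
      congr 1
      ext k
      simp only [Finset.mem_filter, Finset.mem_Ioc, le_min_iff, and_assoc]
    rw [← h1, summatory, summatory, summatory, ← Finset.sum_sub_distrib]
    rfl
  rw [hsub]
  split_ifs with h
  · rw [min_eq_left h, sub_self, abs_zero]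
  · refine (abs_sub _ _).trans ?_
    have h1 := abs_summatory_chiFun_le n
    have h2 := abs_summatory_chiFun_le (min n K)
    have h3 : ((min n K : ℕ) : ℝ) ≤ n := by exact_mod_cast min_le_left n K
    linarith

/-- After truncation at `K` the inner sum up to `N / k` vanishes unless `k ≤ N / K`, and otherwise
it is at most `2N / k`. Each of at most `N / K` values of `k` thus contributes at most `2N`. -/
theorem abs_summatory_chiFun_tail_le {K : ℕ} (hK : 0 < K) (N : ℕ) :
    |summatory (powFun 1 * (chiFun - truncate K chiFun)) N| ≤ 2 / K * (N : ℝ) ^ 2 := by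
  have hK' : (0 : ℝ) < K := by exact_mod_cast hK
  rw [summatory_mul]
  calc _ ≤ ∑ k ∈ Finset.Ioc 0 N, if k ≤ N / K then 2 * (N : ℝ) else 0 := by
        refine (Finset.abs_sum_le_sum_abs _ _).trans (Finset.sum_le_sum fun k hk => ?_)
        have hk : 0 < k := (Finset.mem_Ioc.1 hk).1
        have hk' : (0 : ℝ) < k := by exact_mod_cast hk
        rw [abs_mul, powFun_apply hk.ne', pow_one, abs_of_pos hk']
        have h1 := abs_summatory_chiFun_sub_truncate_le K (N / k)
        have h2 : ((N / k : ℕ) : ℝ) * k ≤ N := by exact_mod_cast Nat.div_mul_le_self N k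
        split_ifs at h1 with h
        · rw [le_antisymm h1 (abs_nonneg _), mul_zero]
          split_ifs <;> positivity
        · rw [if_pos]
          · nlinarith
          · rw [Nat.le_div_iff_mul_le hK]
            rw [not_le, Nat.lt_iff_add_one_le, Nat.le_div_iff_mul_le hk] at h
            nlinarith
    _ ≤ (N / K : ℕ) * (2 * (N : ℝ)) := by
        rw [← Finset.sum_filter, Finset.sum_const, nsmul_eq_mul]
        gcongr
        refine (Finset.card_le_card (t := Finset.Ioc 0 (N / K)) fun k hk => ?_).trans_eq (by simp)
        rw [Finset.mem_filter, Finset.mem_Ioc] at hk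
        exact Finset.mem_Ioc.2 ⟨hk.1.1, hk.2⟩
    _ ≤ (N : ℝ) / K * (2 * (N : ℝ)) := by
        gcongr
        exact Nat.cast_div_le
    _ = _ := by ring

theorem tendsto_of_approx {x : ℕ → ℝ} {x' : ℕ → ℕ → ℝ} {y : ℕ → ℝ} {ε : ℕ → ℝ} {a : ℝ}
    (h : ∀ j, Tendsto (x' j) atTop (𝓝 (y j))) (hy : Tendsto y atTop (𝓝 a))
    (hε : Tendsto ε atTop (𝓝 0)) (hx : ∀ᶠ j in atTop, ∀ᶠ N in atTop, |x N - x' j N| ≤ ε j) :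
    Tendsto x atTop (𝓝 a) := by
  rw [Metric.tendsto_atTop']
  intro δ hδ
  have h1 := (Metric.tendsto_nhds.1 hy) (δ / 3) (by positivity)
  have h2 := hε.eventually (gt_mem_nhds (by positivity : (0 : ℝ) < δ / 3))
  obtain ⟨j, hj1, hj2, hj3⟩ := (h1.and (h2.and hx)).exists
  have h4 := (Metric.tendsto_nhds.1 (h j)) (δ / 3) (by positivity)
  obtain ⟨n, hn⟩ := eventually_atTop.1 (h4.and hj3)
  refine ⟨n, fun N hN => ?_⟩
  obtain ⟨h5, h6⟩ := hn N hN.le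
  rw [Real.dist_eq] at *
  rw [abs_lt] at *
  rw [abs_le] at h6
  constructor <;> linarith

/-- The sum `∑ χ₄(n) n / n ^ 2` converges only conditionally, so absolute summability cannot be used
directly. Truncating the character at `2j` leaves a finite sum, for which it can, with a relative
error at most `1 / j`; then `j → ∞`. -/
theorem hasGrowth_powFun_one_mul_chiFun :
    HasGrowth (powFun 1 * chiFun) 2 (fun _ => 1) (1 / 2 * (Real.pi / 4)) := by
  refine .of_one ?_
  refine tendsto_of_approx
    (x' := fun j N => summatory (truncate (2 * j) chiFun * powFun 1) N / (N : ℝ) ^ 2)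
    (y := fun j => 1 / 2 * ∑ i ∈ Finset.range j, (-1 : ℝ) ^ i / (2 * i + 1))
    (ε := fun j => (j : ℝ)⁻¹) (fun j => ?_) (Real.tendsto_sum_pi_div_four.const_mul _)
    tendsto_inv_atTop_nhds_zero_nat ?_
  · have hfin : ∀ n ∉ Finset.Ioc 0 (2 * j), truncate (2 * j) chiFun n * ((n : ℝ) ^ 2)⁻¹ = 0 := by
      intro n hn
      rcases Nat.eq_zero_or_pos n with rfl | hn0
      · simp
      · rw [truncate_apply, if_neg, zero_mul]
        intro h
        exact hn (Finset.mem_Ioc.2 ⟨hn0, h⟩)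
    have h := (hasGrowth_powFun_one.mul (g := truncate (2 * j) chiFun)
      (summable_of_ne_finset_zero (s := Finset.Ioc 0 (2 * j)) fun n hn => by
        rw [hfin n hn, norm_zero])).tendsto
    rw [tsum_eq_sum hfin, Finset.sum_congr rfl fun k hk => by
      rw [truncate_apply, if_pos (Finset.mem_Ioc.1 hk).2], sum_chiFun_div_sq] at h
    simpa using h
  · filter_upwards [eventually_gt_atTop 0] with j hj
    filter_upwards [eventually_gt_atTop 0] with N hN
    have hN' : (0 : ℝ) < N := by exact_mod_cast hN
    have hj' : (0 : ℝ) < j := by exact_mod_cast hj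
    have h1 := abs_summatory_chiFun_tail_le (K := 2 * j) (by omega) N
    have h2 : summatory (powFun 1 * (chiFun - truncate (2 * j) chiFun)) N =
        summatory (powFun 1 * chiFun) N - summatory (truncate (2 * j) chiFun * powFun 1) N := by
      rw [mul_sub, mul_comm (truncate _ _), summatory, summatory, summatory,
        ← Finset.sum_sub_distrib]
      rfl
    rw [h2] at h1
    rw [← sub_div, abs_div, abs_of_pos (by positivity : (0 : ℝ) < (N : ℝ) ^ 2),
      div_le_iff₀ (by positivity)]
    refine h1.trans_eq ?_
    push_cast
    field_simp

end CotypeDensity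

namespace CotypeDensity

open PowerSeries (X mk coeff)

variable {p : ℕ}

/-! ### Local data of the five algebras -/

theorem geomSeries_mul_one_sub (a : ℝ) : geomSeries a * (1 - PowerSeries.C a * X) = 1 := by
  have h : geomSeries a = 1 + PowerSeries.C a * (X * geomSeries a) := by
    ext k
    rw [map_add, PowerSeries.coeff_C_mul]
    cases k with
    | zero => simp [geomSeries]
    | succ k =>
      rw [PowerSeries.coeff_succ_X_mul]
      simp [geomSeries, PowerSeries.coeff_one, pow_succ, mul_comm]
  linear_combination h

theorem localSeries_powFun_mul (hp : p.Prime) (a : ℕ) :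
    localSeries (powFun a) p * (1 - (p : PowerSeries ℝ) ^ a * X) = 1 := by
  have h : localSeries (powFun a) p = geomSeries ((p ^ a : ℕ) : ℝ) := by
    ext k
    rw [localSeries, geomSeries, PowerSeries.coeff_mk, PowerSeries.coeff_mk,
      powFun_apply (pow_ne_zero _ hp.ne_zero)]
    push_cast
    rw [← pow_mul, ← pow_mul, mul_comm]
  have h2 := geomSeries_mul_one_sub ((p ^ a : ℕ) : ℝ)
  rw [map_natCast] at h2
  rw [h]
  push_cast at h2 ⊢
  exact h2

theorem localSeries_chiFun_mul (p : ℕ) :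
    localSeries chiFun p * (1 - PowerSeries.C ((ZMod.χ₄ p : ℝ) * p) * X) = 1 := by
  have h : localSeries chiFun p = geomSeries ((ZMod.χ₄ p : ℝ) * p) := by
    ext k
    rw [localSeries, geomSeries, PowerSeries.coeff_mk, PowerSeries.coeff_mk, chiFun_apply]
    push_cast
    rw [map_pow]
    push_cast
    rw [mul_pow]
  rw [h, geomSeries_mul_one_sub]

/-- The inverse of the local series of `chiFun`. -/
noncomputable def chiFactor (p : ℕ) : PowerSeries ℝ :=
  if p = 2 then 1 else if p % 4 = 1 then 1 - (p : PowerSeries ℝ) * X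
    else 1 + (p : PowerSeries ℝ) * X

theorem localSeries_chiFun_mul_chiFactor (hp : p.Prime) :
    localSeries chiFun p * chiFactor p = 1 := by
  rw [← localSeries_chiFun_mul p]
  congr 1
  rw [chiFactor, ZMod.χ₄_nat_eq_if_mod_four]
  have h2 := hp.eq_two_or_odd
  split_ifs <;> first | omega | simp

theorem sqFun_prime_pow_add_two (hp : p.Prime) (k : ℕ) :
    sqFun (p ^ (k + 2)) = (p : ℝ) ^ 3 * sqFun (p ^ k) := by
  by_cases h : IsSquare (p ^ k)
  · obtain ⟨j, hj⟩ := h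
    rw [pow_add, hj, ← sq, ← mul_pow, sqFun_sq, sqFun_sq]
    push_cast
    ring
  · rw [sqFun_of_not_isSquare h, sqFun_of_not_isSquare, mul_zero]
    rintro ⟨j, hj⟩
    refine h ?_
    have hdvd : p ∣ j := by
      have : p ∣ j * j := hj ▸ dvd_pow_self p (by omega)
      exact (hp.dvd_mul.1 this).elim id id
    obtain ⟨i, rfl⟩ := hdvd
    refine ⟨i, ?_⟩
    have hpp : 0 < p ^ 2 := pow_pos hp.pos 2
    refine Nat.eq_of_mul_eq_mul_left hpp ?_
    calc p ^ 2 * p ^ k = p ^ (k + 2) := by ring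
      _ = p * i * (p * i) := hj
      _ = _ := by ring

theorem localSeries_sqFun_mul (hp : p.Prime) :
    localSeries sqFun p * (1 - (p : PowerSeries ℝ) ^ 3 * X ^ 2) = 1 := by
  have h : localSeries sqFun p = 1 + ((p ^ 3 : ℕ) : PowerSeries ℝ) *
      (X ^ 2 * localSeries sqFun p) := by
    ext k
    rw [map_add, coeff_natCast_mul]
    rcases k with _ | _ | k
    · have := isMultiplicative_sqFun.1
      simp [localSeries, this]
    · have : sqFun p = 0 := sqFun_of_not_isSquare hp.prime.not_isSquare
      simp [localSeries, this, PowerSeries.coeff_one, PowerSeries.coeff_X_pow_mul']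
    · rw [coeff_X_sq_mul]
      simp only [localSeries, PowerSeries.coeff_mk, PowerSeries.coeff_one]
      rw [sqFun_prime_pow_add_two hp, if_neg (by omega)]
      push_cast
      ring
  push_cast at h
  linear_combination h

theorem IsLocalO.natCast_mul {r j : ℕ} {F : ℕ → PowerSeries ℝ} (n : ℕ) (hF : IsLocalO r j F) :
    IsLocalO r j fun p => (n : PowerSeries ℝ) * F p :=
  (IsLocalO.natCast r n).mul hF

theorem localData_ab : LocalData 0 3 (fun p => 1 + ((p : PowerSeries ℝ) + 1) * X)
    (fun p => 1 - (p : PowerSeries ℝ) ^ 2 * X) where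
  eq _ hp := countSeries_one_ab hp
  num := ((IsLocalO.monomial (a := 1) (b := 1) (by norm_num)).add
    (IsLocalO.monomial (a := 0) (b := 1) (by norm_num))).congr fun p _ => by ring
  denom := ((IsLocalO.one 3).sub (IsLocalO.monomial (a := 2) (b := 1) (by norm_num))).congr
    fun p _ => by ring

/-- The numerator of the cocyclic local series of `sl₂`. -/
noncomputable def numSl2 (p : ℕ) : PowerSeries ℝ := if p = 2 then 1 + X + 6 * X ^ 2 else 1 + X

theorem localData_sl2 : LocalData (brMatrix (-2) 0 2) 2 numSl2
    (fun p => 1 - (p : PowerSeries ℝ) * X) where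
  eq p hp := by
    rw [numSl2]
    split_ifs with h
    · subst h
      exact_mod_cast countSeries_one_sl2_two
    · exact countSeries_one_sl2_of_odd hp h
  num := (((IsLocalO.monomial (a := 0) (b := 1) (by norm_num)).add
      ((IsLocalO.monomial (a := 0) (b := 2) (by norm_num)).natCast_mul 6)).ite (· = 2)
    (IsLocalO.monomial (a := 0) (b := 1) (by norm_num))).congr fun p _ => by
      rw [numSl2]
      split_ifs <;> push_cast <;> ring
  denom := ((IsLocalO.one 2).sub (IsLocalO.monomial (a := 1) (b := 1) (by norm_num))).congr
    fun p _ => by ring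

theorem isLocalO_one_sub : IsLocalO 2 0 fun p => 1 - (p : PowerSeries ℝ) * X :=
  localData_sl2.denom

theorem localData_heis : LocalData (brMatrix 0 0 0) 2
    (fun p => 1 + X - (p : PowerSeries ℝ) * X ^ 2 - (p : PowerSeries ℝ) ^ 3 * X ^ 3)
    (fun p => (1 - (p : PowerSeries ℝ) * X) * (1 - (p : PowerSeries ℝ) ^ 3 * X ^ 2)) where
  eq _ hp := countSeries_one_heis hp
  num := (((IsLocalO.monomial (a := 0) (b := 1) (by norm_num)).sub
    (IsLocalO.monomial (a := 1) (b := 2) (by norm_num))).sub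
    (IsLocalO.monomial (a := 3) (b := 3) (by norm_num))).congr fun p _ => by ring
  denom := isLocalO_one_sub.mul
    ((IsLocalO.one 2).sub (IsLocalO.monomial (a := 3) (b := 2) (by norm_num)))

theorem isLocalO_X_sub_two_mul : IsLocalO 2 2 fun p =>
    (p : PowerSeries ℝ) ^ 0 * X ^ 1 - ((2 : ℕ) : PowerSeries ℝ) *
      ((p : PowerSeries ℝ) ^ 1 * X ^ 2) :=
  (IsLocalO.monomial (by norm_num)).sub ((IsLocalO.monomial (by norm_num)).natCast_mul 2)

/-- The numerator of the cocyclic local series of `L₁`. -/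
noncomputable def numL1 (p : ℕ) : PowerSeries ℝ :=
  if p = 2 then 1 - X + 4 * X ^ 2 + 4 * X ^ 3 - 16 * X ^ 4
    else 1 + X - 2 * (p : PowerSeries ℝ) * X ^ 2

theorem localData_l1 : LocalData (brMatrix 0 1 0) 2 numL1
    (fun p => (1 - (p : PowerSeries ℝ) * X) * (1 - (p : PowerSeries ℝ) * X)) where
  eq p hp := by
    rw [numL1, ← sq]
    split_ifs with h
    · subst h
      exact_mod_cast countSeries_one_l1_two
    · exact countSeries_one_of_split hp isUnit_one (sqrtCount_one_of_odd hp h)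
  num := (((((IsLocalO.monomial (a := 0) (b := 2) (by norm_num)).natCast_mul 4).sub
      (IsLocalO.monomial (a := 0) (b := 1) (by norm_num))).add
      (((IsLocalO.monomial (a := 0) (b := 3) (by norm_num)).natCast_mul 4).sub
      ((IsLocalO.monomial (a := 0) (b := 4) (by norm_num)).natCast_mul 16))).ite (· = 2)
    isLocalO_X_sub_two_mul).congr fun p _ => by
      rw [numL1]
      split_ifs <;> push_cast <;> ring
  denom := isLocalO_one_sub.mul isLocalO_one_sub

/-- The numerator of the cocyclic local series of `L₂`. -/
noncomputable def numL2 (p : ℕ) : PowerSeries ℝ :=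
  if p = 2 then 1 + X - 2 * X ^ 2 else if p % 4 = 1 then 1 + X - 2 * (p : PowerSeries ℝ) * X ^ 2
    else 1 + X

theorem localData_l2 : LocalData (brMatrix 0 (-1) 0) 2 numL2
    (fun p => (1 - (p : PowerSeries ℝ) * X) * chiFactor p) where
  eq p hp := by
    rw [numL2, chiFactor]
    have h2 := hp.eq_two_or_odd
    split_ifs with h h4
    · subst h
      rw [mul_one]
      exact_mod_cast countSeries_one_l2_two
    · rw [← sq]
      exact countSeries_one_of_split hp isUnit_one.neg (sqrtCount_neg_one_of_mod_four_eq_one hp h4)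
    · rw [← countSeries_one_of_inert hp isUnit_one.neg
        (sqrtCount_neg_one_of_mod_four_eq_three hp (by omega))]
      ring
  num := (((IsLocalO.monomial (a := 0) (b := 1) (by norm_num)).sub
      ((IsLocalO.monomial (a := 0) (b := 2) (by norm_num)).natCast_mul 2)).ite (· = 2)
    (isLocalO_X_sub_two_mul.ite (· % 4 = 1)
      (IsLocalO.monomial (a := 0) (b := 1) (by norm_num)))).congr fun p _ => by
      rw [numL2]
      split_ifs <;> push_cast <;> ring
  denom := isLocalO_one_sub.mul (((IsLocalO.one 2).ite (· = 2) (isLocalO_one_sub.ite (· % 4 = 1)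
    ((IsLocalO.one 2).add (IsLocalO.monomial (a := 1) (b := 1) (by norm_num))))).congr fun p _ => by
      rw [chiFactor]
      split_ifs <;> ring)

/-! ### Densities as Euler products -/

/-- The value at `τ` of the denominator of the local series of all closed sublattices. -/
noncomputable def denomValue (p : ℕ) (τ : ℝ) : ℝ :=
  (1 - (p : ℝ) ^ 2 * τ ^ 2) * (1 - τ ^ 3) * (1 - (p : ℝ) ^ 2 * τ ^ 4)

/-- The value at `τ` of the numerator of the local series of all closed sublattices, when the
cocyclic local series is a quotient of series with values `a` and `b`. -/
noncomputable def allValue (p : ℕ) (τ a b : ℝ) : ℝ :=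
  (1 + p * τ ^ 2) * ((1 - τ ^ 3) * a + (τ ^ 3 + (p + 1) * τ ^ 4) * b) +
    τ ^ 2 * (1 - (p : ℝ) ^ 2 * τ ^ 4) * b

/-- The local density of closed sublattices of corank at most `1`. -/
noncomputable def localDensityOne (p : ℕ) (τ a b : ℝ) : ℝ :=
  a * denomValue p τ / allValue p τ a b

/-- The local density of closed sublattices of corank at most `2`. -/
noncomputable def localDensityTwo (p : ℕ) (τ a b : ℝ) : ℝ :=
  (a * (1 + p * τ ^ 2) + τ ^ 2 * b) * ((1 - τ ^ 3) * (1 - (p : ℝ) ^ 2 * τ ^ 4)) / allValue p τ a b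

/-- Both counting functions have the same factor `u`, so its growth cancels and the limit is the
quotient of two absolutely convergent sums, each equal to its Euler product. -/
theorem tendsto_density {M : Matrix (Fin 3) (Fin 3) ℤ} {r m : ℕ} {V : ℕ → PowerSeries ℝ}
    {u : ArithmeticFunction ℝ} {ℓ : ℕ → ℝ} {κ : ℝ} {x y : ℕ → ℝ} (hκ : κ ≠ 0)
    (hu : u.IsMultiplicative) (hgrowth : HasGrowth u r ℓ κ)
    (huV : ∀ p : ℕ, p.Prime → localSeries u p * V p = 1)
    (hm : IsLocalO r 2 fun p => countSeries M p m * V p - 1)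
    (h3 : IsLocalO r 2 fun p => countSeries M p 3 * V p - 1)
    (hx : ∀ p : ℕ, p.Prime → HasValue (((p : ℝ) ^ r)⁻¹) (countSeries M p m * V p) (x p))
    (hy : ∀ p : ℕ, p.Prime → HasValue (((p : ℝ) ^ r)⁻¹) (countSeries M p 3 * V p) (y p))
    (hy1 : ∀ p : ℕ, p.Prime → 1 ≤ y p) :
    ∃ δ : ℝ, Tendsto (fun N => summatory (countFun M m) N / summatory (countFun M 3) N)
      atTop (𝓝 δ) ∧ Tendsto (fun N : ℕ => ∏ p ∈ N.primesBelow, x p / y p) atTop (𝓝 δ) := by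
  have hu0 : ∀ p, coeff 0 (localSeries u p) = 1 := fun p => by
    rw [localSeries, PowerSeries.coeff_mk, pow_zero, hu.1]
  have hV0 : ∀ p : ℕ, p.Prime → coeff 0 (V p) = 1 := fun p hp => by
    have h := congrArg (coeff 0) (huV p hp)
    rw [PowerSeries.coeff_mul] at h
    simpa [hu0] using h
  have hF0 : ∀ m, ∀ p : ℕ, p.Prime → coeff 0 (countSeries M p m * V p) = 1 := fun m p hp => by
    rw [PowerSeries.coeff_mul]
    simp [hV0 p hp, coeff_zero_countSeries]
  have hgm := hgrowth.mul (summable_ofLocal (hF0 m) hm)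
  have hg3 := hgrowth.mul (summable_ofLocal (hF0 3) h3)
  have hPm := tendsto_prod_ofLocal (hF0 m) hm hx
  have hP3 := tendsto_prod_ofLocal (hF0 3) h3 hy
  rw [mul_comm, ← countFun_eq_mul hu huV hV0] at hgm hg3
  set Sm := ∑' n : ℕ, ofLocal (fun p => countSeries M p m * V p) n * ((n : ℝ) ^ r)⁻¹
  set S3 := ∑' n : ℕ, ofLocal (fun p => countSeries M p 3 * V p) n * ((n : ℝ) ^ r)⁻¹
  -- All local factors of the denominator are at least `1`, so the infinite product cannot vanish.
  have hS3 : 1 ≤ S3 := ge_of_tendsto' hP3 fun N => by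
    calc (1 : ℝ) = ∏ p ∈ N.primesBelow, 1 := by simp
      _ ≤ _ := Finset.prod_le_prod (fun _ _ => zero_le_one) fun p hp =>
        hy1 p (Nat.prime_of_mem_primesBelow hp)
  refine ⟨Sm / S3, ?_, ?_⟩
  · have h := hgm.tendsto.div hg3.tendsto (mul_ne_zero hκ (by linarith))
    rw [mul_div_mul_left _ _ hκ] at h
    refine h.congr' ?_
    filter_upwards [eventually_gt_atTop 0] with N hN
    have hN' : (N : ℝ) ≠ 0 := by exact_mod_cast hN.ne'
    have hℓ : ℓ N ≠ 0 := (zero_lt_one.trans_le (hgrowth.one_le N)).ne'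
    simp only [Pi.div_apply]
    rw [div_div_div_cancel_right₀]
    positivity
  · simp_rw [Finset.prod_div_distrib]
    exact hPm.div hP3 (by linarith)

theorem LocalData.tendsto_density {M : Matrix (Fin 3) (Fin 3) ℤ} {r : ℕ}
    {h V : ℕ → PowerSeries ℝ} {u : ArithmeticFunction ℝ} {ℓ : ℕ → ℝ} {κ : ℝ} {a b : ℕ → ℝ}
    (H : LocalData M r h V) (hr : 2 ≤ r) (hκ : κ ≠ 0)
    (hu : u.IsMultiplicative) (hgrowth : HasGrowth u r ℓ κ)
    (huV : ∀ p : ℕ, p.Prime → localSeries u p * V p = 1)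
    (ha : ∀ p : ℕ, p.Prime → HasValue (((p : ℝ) ^ r)⁻¹) (h p) (a p))
    (hb : ∀ p : ℕ, p.Prime → HasValue (((p : ℝ) ^ r)⁻¹) (V p) (b p))
    (ha1 : ∀ p : ℕ, p.Prime → 1 ≤ a p) (hb0 : ∀ p : ℕ, p.Prime → 0 ≤ b p) :
    (∃ δ : ℝ, Tendsto (fun N => summatory (countFun M 1) N / summatory (countFun M 3) N)
      atTop (𝓝 δ) ∧ Tendsto (fun N : ℕ => ∏ p ∈ N.primesBelow,
        localDensityOne p (((p : ℝ) ^ r)⁻¹) (a p) (b p)) atTop (𝓝 δ)) ∧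
    (∃ δ : ℝ, Tendsto (fun N => summatory (countFun M 2) N / summatory (countFun M 3) N)
      atTop (𝓝 δ) ∧ Tendsto (fun N : ℕ => ∏ p ∈ N.primesBelow,
        localDensityTwo p (((p : ℝ) ^ r)⁻¹) (a p) (b p)) atTop (𝓝 δ)) := by
  have hval : ∀ m, (IsLocalO r 2 fun p => countSeries M p m * V p - 1) →
      ∀ p : ℕ, p.Prime → ∃ x, HasValue (((p : ℝ) ^ r)⁻¹) (countSeries M p m * V p) x := by
    rintro m ⟨c, -, hc⟩ p hp
    obtain ⟨⟨x, hx⟩, -⟩ := hc p hp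
    exact ⟨x + 1, by simpa using hx.add (HasValue.one _)⟩
  have h1 := H.countSeries_one
  have h2 := H.countSeries_two hr
  have h3 := H.countSeries_three hr
  choose! x hx using hval 2 h2
  choose! y hy using hval 3 h3
  have hx1 := fun p hp => H.value_one hp (ha p hp)
  have hxe := fun p hp => H.value_two hp (ha p hp) (hb p hp) (hx p hp)
  have hye := fun p hp => H.value_three hp (ha p hp) (hb p hp) (hy p hp)
  have hsmall : ∀ p : ℕ, p.Prime → 0 < 1 - (p : ℝ) ^ 2 * (((p : ℝ) ^ r)⁻¹) ^ 2 ∧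
      0 < 1 - (((p : ℝ) ^ r)⁻¹) ^ 3 ∧ 0 < 1 - (p : ℝ) ^ 2 * (((p : ℝ) ^ r)⁻¹) ^ 4 := by
    intro p hp
    have hp1 : (1 : ℝ) < p := by exact_mod_cast hp.one_lt
    have key : ∀ i j, i < r * j → (p : ℝ) ^ i * (((p : ℝ) ^ r)⁻¹) ^ j < 1 := fun i j hij => by
      rw [inv_pow, ← pow_mul, ← div_eq_mul_inv, div_lt_one (by positivity)]
      exact pow_lt_pow_right₀ hp1 hij
    have k1 := key 2 2 (by omega)
    have k2 := key 0 3 (by omega)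
    have k3 := key 2 4 (by omega)
    rw [pow_zero, one_mul] at k2
    exact ⟨by linarith, by linarith, by linarith⟩
  have hD : ∀ p : ℕ, p.Prime → 0 < denomValue p (((p : ℝ) ^ r)⁻¹) := fun p hp => by
    obtain ⟨s1, s2, s3⟩ := hsmall p hp
    exact mul_pos (mul_pos s1 s2) s3
  have hy' : ∀ p : ℕ, p.Prime → y p = allValue p (((p : ℝ) ^ r)⁻¹) (a p) (b p) /
      denomValue p (((p : ℝ) ^ r)⁻¹) := fun p hp => by
    rw [eq_div_iff (hD p hp).ne', mul_comm]
    exact hye p hp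
  -- The term `(1 - τ ^ 3) a` of the numerator already exceeds the denominator, because `a ≥ 1`; the
  -- remaining terms are nonnegative.
  have hy1 : ∀ p : ℕ, p.Prime → 1 ≤ y p := fun p hp => by
    rw [hy' p hp, one_le_div (hD p hp), denomValue, allValue]
    obtain ⟨s1, s2, s3⟩ := hsmall p hp
    have hp1 : (1 : ℝ) < p := by exact_mod_cast hp.one_lt
    have ha1 := ha1 p hp
    have hb0 := hb0 p hp
    set τ := ((p : ℝ) ^ r)⁻¹
    have hτ : 0 < τ := by positivity
    have e1 : (1 - (p : ℝ) ^ 2 * τ ^ 2) * (1 - τ ^ 3) * (1 - (p : ℝ) ^ 2 * τ ^ 4) ≤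
        (1 - τ ^ 3) * a p := by
      calc _ ≤ 1 * (1 - τ ^ 3) * 1 := by
            gcongr <;> linarith [mul_pos (pow_pos (zero_lt_one.trans hp1) 2) (pow_pos hτ 2),
              mul_pos (pow_pos (zero_lt_one.trans hp1) 2) (pow_pos hτ 4)]
        _ ≤ _ := by nlinarith
    have e2 : 0 ≤ (τ ^ 3 + (p + 1) * τ ^ 4) * b p := by positivity
    have e3 : 0 ≤ τ ^ 2 * (1 - (p : ℝ) ^ 2 * τ ^ 4) * b p := by positivity
    have e4 : 0 ≤ (1 - τ ^ 3) * a p := by nlinarith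
    have e5 : 0 ≤ p * τ ^ 2 := by positivity
    nlinarith [mul_nonneg e5 (add_nonneg e4 e2)]
  constructor
  · obtain ⟨δ, hδ1, hδ2⟩ := CotypeDensity.tendsto_density hκ hu hgrowth huV h1 h3 hx1 hy hy1
    refine ⟨δ, hδ1, hδ2.congr fun N => Finset.prod_congr rfl fun p hp => ?_⟩
    have hp := Nat.prime_of_mem_primesBelow hp
    rw [hy' p hp, localDensityOne, div_div_eq_mul_div]
  · obtain ⟨δ, hδ1, hδ2⟩ := CotypeDensity.tendsto_density hκ hu hgrowth huV h2 h3 hx hy hy1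
    refine ⟨δ, hδ1, hδ2.congr fun N => Finset.prod_congr rfl fun p hp => ?_⟩
    have hp := Nat.prime_of_mem_primesBelow hp
    rw [hy' p hp, localDensityTwo, div_div_eq_mul_div, ← hxe p hp, denomValue]
    ring

end CotypeDensity

namespace CotypeDensity

open scoped Matrix

/-! ### Cotype and corank -/

/-- With `a = g a'`, `b = g b'` and `a' u + b' v = 1`, the integer matrix with rows `(b', a')` and
`(-u, v)` has determinant `1` and descends to the quotients. It is surjective there, and the two
sides have equally many elements. -/
theorem nonempty_zmod_prod_equiv {a b : ℕ} (ha : 0 < a) (hb : 0 < b) :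
    Nonempty (ZMod a × ZMod b ≃+ ZMod (a.lcm b) × ZMod (a.gcd b)) := by
  set g := a.gcd b with hg
  set l := a.lcm b with hl
  have hgl : g * l = a * b := Nat.gcd_mul_lcm a b
  have hg0 : 0 < g := Nat.gcd_pos_of_pos_left b ha
  have hl0 : 0 < l := Nat.lcm_pos ha hb
  obtain ⟨a', ha'⟩ := Nat.gcd_dvd_left a b
  obtain ⟨b', hb'⟩ := Nat.gcd_dvd_right a b
  rw [← hg] at ha' hb'
  have hab : l = a * b' := by
    refine Nat.eq_of_mul_eq_mul_left hg0 ?_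
    calc g * l = a * (g * b') := by rw [hgl, ← hb']
      _ = _ := by ring
  have hab' : l = b * a' := by
    refine Nat.eq_of_mul_eq_mul_left hg0 ?_
    calc g * l = g * a' * b := by rw [hgl, ← ha']
      _ = _ := by ring
  set u := Nat.gcdA a b with hu
  set v := Nat.gcdB a b with hv
  have hbez : (a' : ℤ) * u + b' * v = 1 := by
    have h := Nat.gcd_eq_gcd_ab a b
    rw [← hg, ← hu, ← hv] at h
    have hg' : (g : ℤ) ≠ 0 := by exact_mod_cast hg0.ne'
    refine mul_left_cancel₀ hg' ?_
    have e1 : (a : ℤ) = g * a' := by exact_mod_cast ha'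
    have e2 : (b : ℤ) = g * b' := by exact_mod_cast hb'
    calc (g : ℤ) * (a' * u + b' * v) = (g * a') * u + (g * b') * v := by ring
      _ = g * 1 := by rw [← e1, ← e2, ← h, mul_one]
  let c : ℤ → ℤ → ℤ →+ ZMod l × ZMod g := fun s t =>
    (zmultiplesHom (ZMod l × ZMod g)) ((s : ZMod l), (t : ZMod g))
  have hc : ∀ s t n : ℤ, c s t n = (((n * s : ℤ) : ZMod l), ((n * t : ℤ) : ZMod g)) := fun s t n => by
    simp [c, zmultiplesHom_apply]
  have h1 : c b' (-u) a = 0 := by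
    rw [hc, Prod.mk_eq_zero]
    constructor
    · rw [← Nat.cast_mul, ← hab, Int.cast_natCast, ZMod.natCast_self]
    · rw [ZMod.intCast_zmod_eq_zero_iff_dvd, ha', Nat.cast_mul, mul_assoc]
      exact dvd_mul_right _ _
  have h2 : c a' v b = 0 := by
    rw [hc, Prod.mk_eq_zero]
    constructor
    · rw [← Nat.cast_mul, ← hab', Int.cast_natCast, ZMod.natCast_self]
    · rw [ZMod.intCast_zmod_eq_zero_iff_dvd, hb', Nat.cast_mul, mul_assoc]
      exact dvd_mul_right _ _
  let f : ZMod a × ZMod b →+ ZMod l × ZMod g :=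
    (ZMod.lift a ⟨c b' (-u), h1⟩).coprod (ZMod.lift b ⟨c a' v, h2⟩)
  have hf : ∀ x y : ℤ, f ((x : ZMod a), (y : ZMod b)) =
      (((x * b' + y * a' : ℤ) : ZMod l), ((-x * u + y * v : ℤ) : ZMod g)) := fun x y => by
    simp only [f, AddMonoidHom.coprod_apply, ZMod.lift_coe, hc, Prod.mk_add_mk]
    push_cast
    simp
  have hsurj : Function.Surjective f := by
    rintro ⟨s, t⟩
    obtain ⟨s, rfl⟩ := ZMod.intCast_surjective s
    obtain ⟨t, rfl⟩ := ZMod.intCast_surjective t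
    refine ⟨(((s * v - t * a' : ℤ) : ZMod a), ((s * u + t * b' : ℤ) : ZMod b)), ?_⟩
    rw [hf]
    congr 2
    · linear_combination s * hbez
    · linear_combination t * hbez
  have : NeZero a := ⟨ha.ne'⟩
  have : NeZero b := ⟨hb.ne'⟩
  have : NeZero l := ⟨hl0.ne'⟩
  have : NeZero g := ⟨hg0.ne'⟩
  have hcard : Fintype.card (ZMod a × ZMod b) = Fintype.card (ZMod l × ZMod g) := by
    simp only [Fintype.card_prod, ZMod.card]
    rw [← hgl, mul_comm]
  exact ⟨AddEquiv.ofBijective f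
    ((Fintype.bijective_iff_surjective_and_card f).2 ⟨hsurj, hcard⟩)⟩

/-- A product over `Fin 3` as a threefold product. -/
def piFinThreeEquiv (α : Fin 3 → ℕ) :
    (∀ i, ZMod (α i)) ≃+ ZMod (α 0) × ZMod (α 1) × ZMod (α 2) where
  toFun f := (f 0, f 1, f 2)
  invFun t i := match i with
    | 0 => t.1
    | 1 => t.2.1
    | 2 => t.2.2
  left_inv f := by
    ext i
    fin_cases i <;> rfl
  right_inv _ := rfl
  map_add' _ _ := rfl

/-- Replacing a pair by its lcm and gcd sorts it by divisibility; three such exchanges sort a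
triple, as in bubble sort. -/
theorem exists_divisor_chain {a : Fin 3 → ℕ} (ha : ∀ i, 0 < a i) :
    ∃ α : Fin 3 → ℕ, (∀ i, 0 < α i) ∧ α 1 ∣ α 0 ∧ α 2 ∣ α 1 ∧
      Nonempty ((∀ i, ZMod (a i)) ≃+ ∀ i, ZMod (α i)) := by
  set b₁ := (a 1).lcm (a 2) with hb₁
  set c₁ := (a 1).gcd (a 2) with hc₁
  have hb₁0 : 0 < b₁ := Nat.lcm_pos (ha 1) (ha 2)
  have hc₁0 : 0 < c₁ := Nat.gcd_pos_of_pos_left _ (ha 1)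
  set b₂ := (a 0).gcd b₁ with hb₂
  have hb₂0 : 0 < b₂ := Nat.gcd_pos_of_pos_left _ (ha 0)
  obtain ⟨e₁⟩ := nonempty_zmod_prod_equiv (ha 1) (ha 2)
  obtain ⟨e₂⟩ := nonempty_zmod_prod_equiv (ha 0) hb₁0
  obtain ⟨e₃⟩ := nonempty_zmod_prod_equiv hb₂0 hc₁0
  refine ⟨![(a 0).lcm b₁, b₂.lcm c₁, b₂.gcd c₁], ?_, ?_, ?_, ⟨?_⟩⟩
  · intro i
    fin_cases i
    · exact Nat.lcm_pos (ha 0) hb₁0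
    · exact Nat.lcm_pos hb₂0 hc₁0
    · exact Nat.gcd_pos_of_pos_left _ hb₂0
  · have h1 : b₂ ∣ (a 0).lcm b₁ := (Nat.gcd_dvd_right _ _).trans (Nat.dvd_lcm_right _ _)
    have h2 : c₁ ∣ (a 0).lcm b₁ :=
      ((Nat.gcd_dvd_left _ _).trans (Nat.dvd_lcm_left _ _)).trans (Nat.dvd_lcm_right _ _)
    exact Nat.lcm_dvd h1 h2
  · exact (Nat.gcd_dvd_left _ _).trans (Nat.dvd_lcm_left _ _)
  · refine (piFinThreeEquiv a).trans (AddEquiv.trans ?_ (piFinThreeEquiv _).symm)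
    refine ((AddEquiv.refl _).prodCongr e₁).trans ?_
    refine AddEquiv.prodAssoc.symm.trans ?_
    refine (e₂.prodCongr (AddEquiv.refl _)).trans ?_
    refine AddEquiv.prodAssoc.trans ?_
    exact (AddEquiv.refl _).prodCongr e₃

theorem index_range_nsmul_zmod {a : ℕ} (ha : 0 < a) (p : ℕ) :
    (nsmulAddMonoidHom (α := ZMod a) p).range.index = a.gcd p := by
  have : NeZero a := ⟨ha.ne'⟩
  have hrange : (nsmulAddMonoidHom (α := ZMod a) p).range = AddSubgroup.zmultiples (p : ZMod a) := by
    ext x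
    rw [AddMonoidHom.mem_range, AddSubgroup.mem_zmultiples_iff]
    constructor
    · rintro ⟨y, rfl⟩
      obtain ⟨y, rfl⟩ := ZMod.intCast_surjective y
      exact ⟨y, by simp [mul_comm]⟩
    · rintro ⟨k, rfl⟩
      exact ⟨(k : ZMod a), by simp [mul_comm]⟩
  have h1 := (AddSubgroup.zmultiples (p : ZMod a)).card_mul_index
  rw [Nat.card_zmultiples, ZMod.addOrderOf_coe p ha.ne', Nat.card_zmod] at h1
  rw [hrange]
  have hg : 0 < a.gcd p := Nat.gcd_pos_of_pos_left p ha
  have h2 : a / a.gcd p * a.gcd p = a := Nat.div_mul_cancel (Nat.gcd_dvd_left a p)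
  have h3 : 0 < a / a.gcd p := Nat.div_pos (Nat.le_of_dvd ha (Nat.gcd_dvd_left a p)) hg
  exact Nat.eq_of_mul_eq_mul_left h3 (h1.trans h2.symm)

theorem index_pi_of_finite {ι : Type*} [Fintype ι] {G : ι → Type*} [∀ i, AddGroup (G i)]
    [∀ i, Finite (G i)] (H : ∀ i, AddSubgroup (G i)) :
    (AddSubgroup.pi Set.univ H).index = ∏ i, (H i).index := by
  have hcard : Nat.card (AddSubgroup.pi Set.univ H) = ∏ i, Nat.card (H i) := by
    rw [← Nat.card_pi]
    exact Nat.card_congr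
      { toFun := fun f i => ⟨f.1 i, f.2 i trivial⟩
        invFun := fun g => ⟨fun i => g i, fun i _ => (g i).2⟩
        left_inv := fun _ => rfl
        right_inv := fun _ => rfl }
  have h := (AddSubgroup.pi Set.univ H).card_mul_index
  rw [hcard, Nat.card_pi, ← Finset.prod_congr rfl fun i _ => (H i).card_mul_index,
    Finset.prod_mul_distrib] at h
  exact Nat.eq_of_mul_eq_mul_left (Finset.prod_pos fun i _ => Nat.card_pos) h

theorem index_sup_dilate_top_of_cotype {Λ : AddSubgroup Vec} {α : Fin 3 → ℕ} (hα : ∀ i, 0 < α i)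
    {ψ : Vec →+ ∀ i, ZMod (α i)} (hψ : Function.Surjective ψ) (hker : ψ.ker = Λ) (p : ℕ) :
    (Λ ⊔ dilate p ⊤).index = ∏ i, (α i).gcd p := by
  have h1 : Λ ⊔ dilate p ⊤ = ((dilate p ⊤).map ψ).comap ψ := by
    rw [AddSubgroup.comap_map_eq, hker, sup_comm]
  have h2 : (dilate p ⊤).map ψ =
      AddSubgroup.pi Set.univ fun i => (nsmulAddMonoidHom (α := ZMod (α i)) p).range := by
    ext x
    simp only [AddSubgroup.mem_map, AddSubgroup.mem_pi, Set.mem_univ, true_imp_iff,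
      AddMonoidHom.mem_range]
    constructor
    · rintro ⟨y, hy, rfl⟩ i
      obtain ⟨z, rfl⟩ := mem_dilate_top.1 hy
      exact ⟨ψ z i, by rw [map_nsmul]; rfl⟩
    · intro h
      choose y hy using h
      obtain ⟨z, hz⟩ := hψ y
      refine ⟨p • z, mem_dilate_top.2 ⟨z, rfl⟩, ?_⟩
      rw [map_nsmul, hz]
      ext i
      exact hy i
  have : ∀ i, NeZero (α i) := fun i => ⟨(hα i).ne'⟩
  rw [h1, AddSubgroup.index_comap_of_surjective _ hψ, h2, index_pi_of_finite]
  exact Finset.prod_congr rfl fun i _ => index_range_nsmul_zmod (hα i) p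

theorem gcd_prime (a : ℕ) {p : ℕ} (hp : p.Prime) : a.gcd p = if p ∣ a then p else 1 := by
  split_ifs with h
  · exact Nat.gcd_eq_right h
  · exact ((hp.coprime_iff_not_dvd.2 h).symm : a.Coprime p)

/-- The index of `Λ + p ℤ³` is `p` to the number of `i` with `p ∣ α i`, and by the divisibility
chain these `i` form an initial segment. So `α j ≠ 1` exactly when some prime has rank at least `j +
1`. -/
theorem corankLE_iff_of_cotype {Λ : AddSubgroup Vec} {α : Fin 3 → ℕ} (hα : ∀ i, 0 < α i)
    (h10 : α 1 ∣ α 0) (h21 : α 2 ∣ α 1) {ψ : Vec →+ ∀ i, ZMod (α i)}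
    (hψ : Function.Surjective ψ) (hker : ψ.ker = Λ) (m : ℕ) :
    CorankLE m Λ ↔ ∀ j : Fin 3, m ≤ j → α j = 1 := by
  have hidx : ∀ p : ℕ, p.Prime → (Λ ⊔ dilate p ⊤).index =
      (if p ∣ α 0 then p else 1) * (if p ∣ α 1 then p else 1) * (if p ∣ α 2 then p else 1) :=
    fun p hp => by
      rw [index_sup_dilate_top_of_cotype hα hψ hker, Fin.prod_univ_three, gcd_prime _ hp,
        gcd_prime _ hp, gcd_prime _ hp]
  constructor
  · intro h j hj
    by_contra hne
    obtain ⟨p, hp, hpj⟩ := Nat.exists_prime_and_dvd hne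
    have hle := h p hp
    rw [hidx p hp] at hle
    have key : p ^ ((j : ℕ) + 1) ≤ p ^ m := by
      refine le_trans ?_ hle
      have hp1 := hp.one_le
      fin_cases j
      · have : p ∣ α 0 := hpj
        rw [if_pos this]
        split_ifs <;> simp <;> nlinarith
      · have h1 : p ∣ α 1 := hpj
        rw [if_pos h1, if_pos (h1.trans h10)]
        split_ifs <;> simp <;> nlinarith
      · have h2 : p ∣ α 2 := hpj
        rw [if_pos h2, if_pos (h2.trans h21), if_pos ((h2.trans h21).trans h10)]
        exact le_of_eq (by simp; ring)
    have := (Nat.pow_le_pow_iff_right hp.one_lt).1 key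
    omega
  · intro h p hp
    rw [hidx p hp]
    have hle : ∀ j : Fin 3, m ≤ j → (if p ∣ α j then p else 1) = 1 := fun j hj => by
      rw [if_neg]
      rw [h j hj]
      exact hp.one_lt.ne' ∘ Nat.dvd_one.1
    have hle' : ∀ j : Fin 3, (if p ∣ α j then p else 1) ≤ p := fun j => by
      split_ifs
      exacts [le_rfl, hp.one_le]
    have b0 := hle' 0
    have b1 := hle' 1
    have b2 := hle' 2
    rcases m with _ | _ | _ | m
    · rw [hle 0 (by simp), hle 1 (by simp), hle 2 (by simp)]
      simp
    · rw [hle 1 (by simp), hle 2 (by simp)]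
      simpa using b0
    · rw [hle 2 (by simp)]
      rw [mul_one, zero_add, sq]
      exact Nat.mul_le_mul b0 b1
    · calc _ ≤ p * p * p := Nat.mul_le_mul (Nat.mul_le_mul b0 b1) b2
        _ = p ^ 3 := by ring
        _ ≤ _ := Nat.pow_le_pow_right hp.pos (by omega)

theorem corankLE_three (Λ : AddSubgroup Vec) : CorankLE 3 Λ := fun p hp => by
  have h := AddSubgroup.index_dvd_of_le (le_sup_right : dilate p ⊤ ≤ Λ ⊔ dilate p ⊤)
  rw [index_dilate_top] at h
  exact Nat.le_of_dvd (pow_pos hp.pos 3) h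

/-! ### From subalgebras to closed sublattices -/

section Transfer

variable {L : Type*} [LieRing L] {M : Matrix (Fin 3) (Fin 3) ℤ}

/-- The sublattice of `ℤ³` that corresponds to a subalgebra. -/
def toLattice (e : L ≃+ Vec) (Λ : LieSubalgebra ℤ L) : AddSubgroup Vec :=
  Λ.toSubmodule.toAddSubgroup.map (e : L →+ Vec)

theorem mem_toLattice (e : L ≃+ Vec) (Λ : LieSubalgebra ℤ L) (x : Vec) :
    x ∈ toLattice e Λ ↔ e.symm x ∈ Λ := by
  constructor
  · rintro ⟨y, hy, rfl⟩
    simpa using hy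
  · intro h
    exact ⟨_, h, by simp⟩

theorem index_toLattice (e : L ≃+ Vec) (Λ : LieSubalgebra ℤ L) :
    (toLattice e Λ).index = index Λ := AddSubgroup.index_map_equiv _ e

theorem toLattice_injective (e : L ≃+ Vec) : Function.Injective (toLattice e) := fun Λ Λ' h => by
  ext x
  have := mem_toLattice e Λ (e x)
  rw [h, mem_toLattice] at this
  simpa using this.symm

theorem range_toLattice (e : L ≃+ Vec) (he : ∀ x y, e ⁅x, y⁆ = M *ᵥ (e x ⨯₃ e y)) :
    Set.range (toLattice e) = {Λ | IsClosedUnder M Λ} := by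
  ext Λ
  constructor
  · rintro ⟨Λ, rfl⟩ x hx y hy
    rw [mem_toLattice] at hx hy ⊢
    have := Λ.lie_mem hx hy
    rwa [← e.symm_apply_apply ⁅e.symm x, e.symm y⁆, he, e.apply_symm_apply,
      e.apply_symm_apply] at this
  · intro hΛ
    refine ⟨{ AddSubgroup.toIntSubmodule (Λ.comap (e : L →+ Vec)) with
      lie_mem' := fun {x y} hx hy => ?_ }, ?_⟩
    · have : e ⁅x, y⁆ ∈ Λ := by
        rw [he]
        exact hΛ _ hx _ hy
      exact this
    · ext x
      rw [mem_toLattice]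
      change e (e.symm x) ∈ Λ ↔ _
      rw [e.apply_symm_apply]

/-- Smith normal form splits the quotient into three cyclic groups; their orders are then sorted
into a divisor chain. -/
theorem exists_hasCotype (e : L ≃+ Vec) {Λ : LieSubalgebra ℤ L} (hΛ : index Λ ≠ 0) :
    ∃ α, HasCotype Λ α := by
  let b : Module.Basis (Fin 3) ℤ L := Module.Basis.ofEquivFun e.toIntLinearEquiv
  have : Module.Free ℤ L := Module.Free.of_basis b
  have : Module.Finite ℤ L := Module.Finite.of_basis b
  have hfin : Finite (L ⧸ Λ.toSubmodule) := AddSubgroup.index_ne_zero_iff_finite.1 hΛ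
  have hrank := (Submodule.finiteQuotient_iff Λ.toSubmodule).1 hfin
  let f := Submodule.quotientEquivPiZMod Λ.toSubmodule b hrank
  obtain ⟨α, h0, h1, h2, ⟨g⟩⟩ := exists_divisor_chain
    (a := fun i => (Submodule.smithNormalFormCoeffs b hrank i).natAbs)
    fun i => Int.natAbs_pos.2 (Submodule.smithNormalFormCoeffs_ne_zero b hrank i)
  exact ⟨α, h0, h1, h2, ⟨f.trans g⟩⟩

theorem corankLE_toLattice_iff (e : L ≃+ Vec) {Λ : LieSubalgebra ℤ L} {α : Fin 3 → ℕ}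
    (hα : HasCotype Λ α) (m : ℕ) :
    CorankLE m (toLattice e Λ) ↔ ∀ j : Fin 3, m ≤ j → α j = 1 := by
  obtain ⟨h0, h1, h2, ⟨f⟩⟩ := hα
  let ψ : Vec →+ ∀ i, ZMod (α i) := ((f : _ →+ _).comp
    (Submodule.mkQ Λ.toSubmodule).toAddMonoidHom).comp (e.symm : Vec →+ L)
  refine corankLE_iff_of_cotype h0 h1 h2 (ψ := ψ) ?_ ?_ m
  · exact f.surjective.comp ((Submodule.mkQ_surjective _).comp e.symm.surjective)
  · ext x
    rw [mem_toLattice, AddMonoidHom.mem_ker]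
    change f (Submodule.Quotient.mk (e.symm x)) = 0 ↔ _
    rw [map_eq_zero_iff f f.injective, Submodule.Quotient.mk_eq_zero]
    rfl

theorem corank_le_iff (e : L ≃+ Vec) {Λ : LieSubalgebra ℤ L} (hΛ : index Λ ≠ 0) (m : ℕ) :
    corank Λ ≤ m ↔ CorankLE m (toLattice e Λ) := by
  obtain ⟨α, hα⟩ := exists_hasCotype e hΛ
  have hbdd : BddAbove {i : ℕ | ∃ α, HasCotype Λ α ∧ ∃ j : Fin 3, (j : ℕ) + 1 = i ∧ α j ≠ 1} := by
    refine ⟨3, ?_⟩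
    rintro i ⟨-, -, j, rfl, -⟩
    omega
  rw [corankLE_toLattice_iff e hα]
  constructor
  · intro h j hj
    by_contra hne
    have : (j : ℕ) + 1 ≤ corank Λ := le_csSup hbdd ⟨α, hα, j, rfl, hne⟩
    omega
  · intro h
    rcases Set.eq_empty_or_nonempty
      {i : ℕ | ∃ α, HasCotype Λ α ∧ ∃ j : Fin 3, (j : ℕ) + 1 = i ∧ α j ≠ 1} with h0 | h0
    -- For `Λ = L` the set is empty, and the supremum of the empty set of naturals is `0`, as the
    -- definition of corank requires.
    · rw [corank, h0, csSup_empty]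
      exact Nat.zero_le m
    · refine csSup_le h0 ?_
      rintro i ⟨β, hβ, j, rfl, hne⟩
      by_contra hlt
      -- The supremum ranges over all cotypes of `Λ`; the lattice condition does not depend on the
      -- cotype, so it transfers from `α` to `β`.
      refine hne ((corankLE_toLattice_iff e hβ m).1 ((corankLE_toLattice_iff e hα m).2 h) j ?_)
      omega

theorem ncard_closed_le (M : Matrix (Fin 3) (Fin 3) ℤ) (m N : ℕ) :
    {Λ : AddSubgroup Vec | Λ.index ∈ Finset.Ioc 0 N ∧ IsClosedUnder M Λ ∧ CorankLE m Λ}.Finite ∧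
    ({Λ : AddSubgroup Vec | Λ.index ∈ Finset.Ioc 0 N ∧ IsClosedUnder M Λ ∧
      CorankLE m Λ}.ncard : ℝ) = summatory (countFun M m) N := by
  induction N with
  | zero => simp [summatory]
  | succ N ih =>
    have hunion : {Λ : AddSubgroup Vec | Λ.index ∈ Finset.Ioc 0 (N + 1) ∧ IsClosedUnder M Λ ∧
        CorankLE m Λ} = {Λ : AddSubgroup Vec | Λ.index ∈ Finset.Ioc 0 N ∧ IsClosedUnder M Λ ∧
        CorankLE m Λ} ∪ closedSet M m (N + 1) := by
      ext Λ
      simp only [closedSet, Set.mem_union, Set.mem_ofPred_eq, Finset.mem_Ioc]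
      constructor
      · rintro ⟨⟨h1, h2⟩, h3⟩
        rcases h2.lt_or_eq with h | h
        · exact Or.inl ⟨⟨h1, by omega⟩, h3⟩
        · exact Or.inr ⟨h, h3⟩
      · rintro (⟨⟨h1, h2⟩, h3⟩ | ⟨h1, h2⟩)
        · exact ⟨⟨h1, by omega⟩, h3⟩
        · exact ⟨⟨by omega, by omega⟩, h2⟩
    have hfin := closedSet_finite M m (Nat.succ_ne_zero N)
    refine ⟨by rw [hunion]; exact ih.1.union hfin, ?_⟩
    rw [hunion, Set.ncard_union_eq ?_ ih.1 hfin, Nat.cast_add, ih.2, summatory, summatory,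
      Finset.sum_Ioc_succ_top (Nat.zero_le N), countFun_apply (Nat.succ_ne_zero N)]
    · rfl
    · rw [Set.disjoint_left]
      rintro Λ ⟨h1, -⟩ ⟨h2, -⟩
      rw [Finset.mem_Ioc] at h1
      omega

/-- The strict bound `n < X` means `n < ⌈X⌉`, so the largest admissible index is `⌈X⌉₊ - 1`; for `X
≤ 0` truncated subtraction leaves an empty range. -/
theorem lt_iff_mem_Ioc (n : ℕ) (X : ℝ) :
    n ≠ 0 ∧ (n : ℝ) < X ↔ n ∈ Finset.Ioc 0 (⌈X⌉₊ - 1) := by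
  rw [← Nat.lt_ceil, Finset.mem_Ioc]
  omega

theorem countCorankLE_eq (e : L ≃+ Vec) (he : ∀ x y, e ⁅x, y⁆ = M *ᵥ (e x ⨯₃ e y)) (m : ℕ) (X : ℝ) :
    (countCorankLE L m X : ℝ) = summatory (countFun M m) (⌈X⌉₊ - 1) := by
  rw [← (ncard_closed_le M m _).2, countCorankLE,
    ← Set.ncard_image_of_injective _ (toLattice_injective e)]
  congr 2
  ext Λ
  constructor
  · rintro ⟨Λ, ⟨h1, h2, h3⟩, rfl⟩
    refine ⟨?_, ?_, (corank_le_iff e h1 m).1 h3⟩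
    · rw [index_toLattice]
      exact (lt_iff_mem_Ioc _ _).1 ⟨h1, h2⟩
    · exact (range_toLattice e he).subset ⟨Λ, rfl⟩
  · rintro ⟨h1, h2, h3⟩
    obtain ⟨Λ, rfl⟩ := (range_toLattice e he).superset h2
    rw [index_toLattice, ← lt_iff_mem_Ioc] at h1
    exact ⟨Λ, ⟨h1.1, h1.2, (corank_le_iff e h1.1 m).2 h3⟩, rfl⟩

theorem countAll_eq (e : L ≃+ Vec) (he : ∀ x y, e ⁅x, y⁆ = M *ᵥ (e x ⨯₃ e y)) (X : ℝ) :
    (countAll L X : ℝ) = summatory (countFun M 3) (⌈X⌉₊ - 1) := by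
  rw [← countCorankLE_eq e he, countAll, countCorankLE]
  congr 2
  ext Λ
  exact ⟨fun h => ⟨h.1, h.2, (corank_le_iff e h.1 3).2 (corankLE_three _)⟩, fun h => ⟨h.1, h.2.1⟩⟩

theorem tendsto_proportion (e : L ≃+ Vec) (he : ∀ x y, e ⁅x, y⁆ = M *ᵥ (e x ⨯₃ e y)) {m : ℕ}
    {δ : ℝ} (h : Tendsto (fun N => summatory (countFun M m) N / summatory (countFun M 3) N)
      atTop (𝓝 δ)) : Tendsto (proportion L m) atTop (𝓝 δ) := by
  have hN : Tendsto (fun X : ℝ => ⌈X⌉₊ - 1) atTop atTop :=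
    (tendsto_sub_atTop_nat 1).comp tendsto_nat_ceil_atTop
  refine (h.comp hN).congr fun X => ?_
  rw [proportion, countCorankLE_eq e he, countAll_eq e he]
  rfl

end Transfer

end CotypeDensity

namespace CotypeDensity

/-! ### Enclosures of the Euler products -/

theorem tendsto_prod_one_sub_inv_pow {k : ℕ} (hk : 1 < k) {s : ℝ}
    (hs : HasSum (fun n : ℕ => 1 / (n : ℝ) ^ k) s) :
    Tendsto (fun N : ℕ => ∏ p ∈ N.primesBelow, (1 - ((p : ℝ) ^ k)⁻¹)) atTop (𝓝 s⁻¹) := by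
  let f : ℕ →*₀ ℝ :=
    { toFun := fun n => ((n : ℝ) ^ k)⁻¹
      map_zero' := by simp [show k ≠ 0 by omega]
      map_one' := by simp
      map_mul' := fun m n => by push_cast; rw [mul_pow, mul_inv] }
  have hs' : HasSum (fun n => f n) s := by simpa [f, one_div] using hs
  have hsum : Summable fun n => ‖f n‖ := hs'.summable.norm
  have h := EulerProduct.eulerProduct_completely_multiplicative hsum
  rw [hs'.tsum_eq] at h
  have hs1 : 0 < s := by
    have := le_hasSum hs' 1 fun n _ => by simp only [f]; change 0 ≤ ((n : ℝ) ^ k)⁻¹; positivity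
    rw [map_one] at this
    linarith
  refine (h.inv₀ hs1.ne').congr fun N => ?_
  rw [← Finset.prod_inv_distrib]
  exact Finset.prod_congr rfl fun p _ => inv_inv _

theorem tendsto_prod_one_sub_inv_sq :
    Tendsto (fun N : ℕ => ∏ p ∈ N.primesBelow, (1 - ((p : ℝ) ^ 2)⁻¹)) atTop
      (𝓝 (Real.pi ^ 2 / 6)⁻¹) :=
  tendsto_prod_one_sub_inv_pow one_lt_two hasSum_zeta_two

theorem tendsto_prod_one_sub_inv_pow_four :
    Tendsto (fun N : ℕ => ∏ p ∈ N.primesBelow, (1 - ((p : ℝ) ^ 4)⁻¹)) atTop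
      (𝓝 (Real.pi ^ 4 / 90)⁻¹) :=
  tendsto_prod_one_sub_inv_pow (by norm_num) hasSum_zeta_four

/-- Since `c / N ^ 3 ≤ (c / 2) (1 / (N (N - 1)) - 1 / ((N + 1) N))`, the losses telescope even when
summed over all integers from `P` on instead of primes. -/
theorem prod_primesBelow_bounds {σ : ℕ → ℝ} {c : ℝ} {P : ℕ} (hP : 2 ≤ P) (hc : 0 ≤ c)
    (hσ0 : ∀ p : ℕ, p.Prime → 0 ≤ σ p)
    (hσ : ∀ p : ℕ, p.Prime → P ≤ p → 1 - c / (p : ℝ) ^ 3 ≤ σ p ∧ σ p ≤ 1) {N : ℕ} (hN : P ≤ N) :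
    ∏ p ∈ N.primesBelow, σ p ≤ ∏ p ∈ P.primesBelow, σ p ∧
      (∏ p ∈ P.primesBelow, σ p) *
        (1 - c / 2 * (1 / ((P : ℝ) * (P - 1)) - 1 / ((N : ℝ) * (N - 1)))) ≤
          ∏ p ∈ N.primesBelow, σ p := by
  have hA : 0 ≤ ∏ p ∈ P.primesBelow, σ p :=
    Finset.prod_nonneg fun p hp => hσ0 p (Nat.prime_of_mem_primesBelow hp)
  induction N, hN using Nat.le_induction with
  | base => simp
  | succ N hN ih =>
    have hN2 : (2 : ℝ) ≤ N := by exact_mod_cast hP.trans hN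
    set A := ∏ p ∈ P.primesBelow, σ p
    have hstep : c / (N : ℝ) ^ 3 ≤ c / 2 * (1 / ((N : ℝ) * (N - 1)) - 1 / ((N + 1 : ℝ) * N)) := by
      have h1 : 1 / ((N : ℝ) * (N - 1)) - 1 / ((N + 1 : ℝ) * N) =
          2 / (((N : ℝ) - 1) * N * (N + 1)) := by
        have : (N : ℝ) - 1 ≠ 0 := by linarith
        field_simp
        ring
      rw [h1, div_mul_div_comm, mul_comm 2, mul_div_mul_right _ _ two_ne_zero]
      refine div_le_div_of_nonneg_left hc ?_ ?_
      · have : 0 < (N : ℝ) - 1 := by linarith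
        positivity
      · nlinarith
    have hcN : 0 ≤ c / (N : ℝ) ^ 3 := by positivity
    push_cast
    rw [show ((N : ℝ) + 1) * (N + 1 - 1) = (N + 1) * N by ring]
    rw [Nat.primesBelow_succ]
    split_ifs with hp
    · rw [Finset.prod_insert (Nat.notMem_primesBelow N)]
      obtain ⟨h1, h2⟩ := hσ N hp hN
      have h0 : 0 ≤ ∏ p ∈ N.primesBelow, σ p :=
        Finset.prod_nonneg fun p hp => hσ0 p (Nat.prime_of_mem_primesBelow hp)
      constructor
      · exact (mul_le_of_le_one_left h0 h2).trans ih.1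
      · have h3 := mul_le_mul_of_nonneg_right h1 h0
        have h4 := mul_le_mul_of_nonneg_left ih.1 hcN
        have h5 := mul_le_mul_of_nonneg_left hstep hA
        nlinarith [ih.2]
    · refine ⟨ih.1, le_trans ?_ ih.2⟩
      refine mul_le_mul_of_nonneg_left ?_ hA
      linarith

theorem density_bounds {ρ z σ : ℕ → ℝ} {Z δ c : ℝ} {P : ℕ} (hP : 2 ≤ P) (hc : 0 ≤ c)
    (hZ : Tendsto (fun N : ℕ => ∏ p ∈ N.primesBelow, z p) atTop (𝓝 Z))
    (hρ : Tendsto (fun N : ℕ => ∏ p ∈ N.primesBelow, ρ p) atTop (𝓝 δ))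
    (hz : ∀ p : ℕ, p.Prime → 0 ≤ z p) (h : ∀ p : ℕ, p.Prime → ρ p = z p * σ p)
    (hσ0 : ∀ p : ℕ, p.Prime → 0 ≤ σ p)
    (hσ : ∀ p : ℕ, p.Prime → P ≤ p → 1 - c / (p : ℝ) ^ 3 ≤ σ p ∧ σ p ≤ 1) :
    Z * ((∏ p ∈ P.primesBelow, σ p) * (1 - c / (2 * ((P : ℝ) * (P - 1))))) ≤ δ ∧
      δ ≤ Z * ∏ p ∈ P.primesBelow, σ p := by
  have hA : 0 ≤ ∏ p ∈ P.primesBelow, σ p :=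
    Finset.prod_nonneg fun p hp => hσ0 p (Nat.prime_of_mem_primesBelow hp)
  have hsplit : ∀ N : ℕ, ∏ p ∈ N.primesBelow, ρ p =
      (∏ p ∈ N.primesBelow, z p) * ∏ p ∈ N.primesBelow, σ p := fun N => by
    rw [← Finset.prod_mul_distrib]
    exact Finset.prod_congr rfl fun p hp => h p (Nat.prime_of_mem_primesBelow hp)
  have hz0 : ∀ N : ℕ, 0 ≤ ∏ p ∈ N.primesBelow, z p := fun N =>
    Finset.prod_nonneg fun p hp => hz p (Nat.prime_of_mem_primesBelow hp)
  constructor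
  · refine le_of_tendsto_of_tendsto (hZ.mul_const _) hρ ?_
    filter_upwards [eventually_ge_atTop P] with N hN
    rw [hsplit]
    refine mul_le_mul_of_nonneg_left ?_ (hz0 N)
    refine le_trans (mul_le_mul_of_nonneg_left ?_ hA)
      (prod_primesBelow_bounds hP hc hσ0 hσ hN).2
    have hN2 : (2 : ℝ) ≤ N := by exact_mod_cast hP.trans hN
    have h1 : 0 ≤ 1 / ((N : ℝ) * (N - 1)) := by
      have : 0 < (N : ℝ) - 1 := by linarith
      positivity
    have h2 : c / (2 * ((P : ℝ) * (P - 1))) = c / 2 * (1 / ((P : ℝ) * (P - 1))) := by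
      rw [div_mul_div_comm, mul_one]
    rw [h2]
    nlinarith
  · refine le_of_tendsto_of_tendsto hρ (hZ.mul_const _) ?_
    filter_upwards [eventually_ge_atTop P] with N hN
    rw [hsplit]
    exact mul_le_mul_of_nonneg_left (prod_primesBelow_bounds hP hc hσ0 hσ hN).1 (hz0 N)

/-! ### Elementary bounds for a single Euler factor -/

section LocalBounds

variable {a b e f g s t : ℝ}

/-- In the application `e = τ ^ 3`, `f = p ^ 2 τ ^ 4`, `g = (p + 1) τ ^ 4`, `s = p τ ^ 2` and `t = τ
^ 2`, all small. Only `b ≤ 1 ≤ a` is used of the numerators, so the bounds are uniform over the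
algebras. -/
theorem quotient_bounds_one (ha : 1 ≤ a) (hb : 0 ≤ b) (hb1 : b ≤ 1) (he : 0 ≤ e) (he1 : e ≤ 1)
    (hf : 0 ≤ f) (hf1 : f ≤ 1) (hg : 0 ≤ g) (hs : 0 ≤ s) (hs1 : s ≤ 1) (ht : 0 ≤ t)
    (hR : 0 < (1 + s) * ((1 - e) * a + (e + g) * b) + t * (1 - f) * b) :
    0 ≤ a * ((1 - e) * (1 - f)) / ((1 + s) * ((1 - e) * a + (e + g) * b) + t * (1 - f) * b) ∧
    1 - (e + f + s + 2 * g + t) ≤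
      a * ((1 - e) * (1 - f)) / ((1 + s) * ((1 - e) * a + (e + g) * b) + t * (1 - f) * b) ∧
    a * ((1 - e) * (1 - f)) / ((1 + s) * ((1 - e) * a + (e + g) * b) + t * (1 - f) * b) ≤ 1 := by
  have he' : 0 ≤ 1 - e := by linarith
  have hf' : 0 ≤ 1 - f := by linarith
  have h1 : 0 ≤ a * ((1 - e) * (1 - f)) := by positivity
  refine ⟨div_nonneg h1 hR.le, ?_, ?_⟩
  · rw [le_div_iff₀ hR]
    rcases le_or_gt (1 - (e + f + s + 2 * g + t)) 0 with hS | hS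
    · exact (mul_nonpos_of_nonpos_of_nonneg hS hR.le).trans h1
    -- Using `b ≤ a` the denominator is at most `a` times `1` plus the small terms, after which `a`
    -- cancels.
    · have hW : (1 + s) * ((1 - e) * a + (e + g) * b) + t * (1 - f) * b ≤
          a * (1 + (s + 2 * g + t)) := by
        have i1 : (1 - e) * a + (e + g) * b ≤ a * (1 + g) := by nlinarith
        have i2 : t * (1 - f) * b ≤ a * t := by
          have : (1 - f) * b ≤ a := by nlinarith
          nlinarith
        have i3 : (1 + s) * (a * (1 + g)) ≤ a * (1 + s + 2 * g) := by
          have : (1 + s) * (1 + g) ≤ 1 + s + 2 * g := by nlinarith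
          nlinarith
        nlinarith
      have hprod : (1 - (e + f + s + 2 * g + t)) * (1 + (s + 2 * g + t)) ≤
          (1 - e) * (1 - f) := by
        have hw : 0 ≤ s + 2 * g + t := by positivity
        nlinarith [mul_nonneg he hw, mul_nonneg hf hw, mul_nonneg hw hw, mul_nonneg he hf]
      calc _ ≤ (1 - (e + f + s + 2 * g + t)) * (a * (1 + (s + 2 * g + t))) :=
            mul_le_mul_of_nonneg_left hW hS.le
        _ = a * ((1 - (e + f + s + 2 * g + t)) * (1 + (s + 2 * g + t))) := by ring
        _ ≤ _ := mul_le_mul_of_nonneg_left hprod (by linarith)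
  · rw [div_le_one hR]
    have i1 : 0 ≤ (e + g) * b := by positivity
    have i2 : 0 ≤ t * (1 - f) * b := by positivity
    have i3 : 0 ≤ (1 - e) * a := by positivity
    nlinarith [mul_nonneg hs i3, mul_nonneg hs i1, mul_nonneg hf i3]

theorem quotient_bounds_two (ha : 1 ≤ a) (hb : 0 ≤ b) (hb1 : b ≤ 1) (he : 0 ≤ e) (he1 : e ≤ 1)
    (hf : 0 ≤ f) (hf1 : f ≤ 1) (hg : 0 ≤ g) (hs : 0 ≤ s) (ht : 0 ≤ t)
    (hR : 0 < (1 + s) * ((1 - e) * a + (e + g) * b) + t * (1 - f) * b) :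
    0 ≤ (a * (1 + s) + t * b) * ((1 - e) * (1 - f)) /
      ((1 + s) * ((1 - e) * a + (e + g) * b) + t * (1 - f) * b) ∧
    1 - (e + f + g) ≤ (a * (1 + s) + t * b) * ((1 - e) * (1 - f)) /
      ((1 + s) * ((1 - e) * a + (e + g) * b) + t * (1 - f) * b) ∧
    (a * (1 + s) + t * b) * ((1 - e) * (1 - f)) /
      ((1 + s) * ((1 - e) * a + (e + g) * b) + t * (1 - f) * b) ≤ 1 := by
  have he' : 0 ≤ 1 - e := by linarith
  have hf' : 0 ≤ 1 - f := by linarith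
  have hA : 0 ≤ a * (1 + s) + t * b := by positivity
  have h1 : 0 ≤ (a * (1 + s) + t * b) * ((1 - e) * (1 - f)) := by positivity
  refine ⟨div_nonneg h1 hR.le, ?_, ?_⟩
  · rw [le_div_iff₀ hR]
    rcases le_or_gt (1 - (e + f + g)) 0 with hS | hS
    · exact (mul_nonpos_of_nonpos_of_nonneg hS hR.le).trans h1
    · have hW : (1 + s) * ((1 - e) * a + (e + g) * b) + t * (1 - f) * b ≤
          (a * (1 + s) + t * b) * (1 + g) := by
        have hs1 : 0 ≤ 1 + s := by linarith
        have i0 : (1 - e) * a + (e + g) * b ≤ a * (1 + g) := by nlinarith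
        have i1 := mul_le_mul_of_nonneg_left i0 hs1
        have i2 : t * (1 - f) * b ≤ t * b * (1 + g) := by
          have := mul_nonneg (mul_nonneg ht hb) (add_nonneg hf hg)
          nlinarith
        nlinarith
      have hprod : (1 - (e + f + g)) * (1 + g) ≤ (1 - e) * (1 - f) := by
        nlinarith [mul_nonneg he hg, mul_nonneg hf hg, mul_nonneg hg hg, mul_nonneg he hf]
      calc _ ≤ (1 - (e + f + g)) * ((a * (1 + s) + t * b) * (1 + g)) :=
            mul_le_mul_of_nonneg_left hW hS.le
        _ = (a * (1 + s) + t * b) * ((1 - (e + f + g)) * (1 + g)) := by ring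
        _ ≤ _ := mul_le_mul_of_nonneg_left hprod hA
  · rw [div_le_one hR]
    have i1 : 0 ≤ (1 + s) * ((e + g) * b) := by positivity
    have i2 : 0 ≤ t * b * (1 - f) := by positivity
    have i3 : 0 ≤ a * (1 + s) * (1 - e) := by positivity
    nlinarith [mul_nonneg he i2, mul_nonneg hf i3]

end LocalBounds

/-- The local density of corank at most `1`, without its leading factor. -/
noncomputable def reducedDensityOne (p : ℕ) (τ a b : ℝ) : ℝ :=
  a * ((1 - τ ^ 3) * (1 - (p : ℝ) ^ 2 * τ ^ 4)) / allValue p τ a b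

theorem localDensityOne_eq (p : ℕ) (τ a b : ℝ) :
    localDensityOne p τ a b = (1 - (p : ℝ) ^ 2 * τ ^ 2) * reducedDensityOne p τ a b := by
  rw [localDensityOne, reducedDensityOne, denomValue]
  ring

theorem local_bounds {p r : ℕ} (hp : p.Prime) (hr : 2 ≤ r) {τ a b : ℝ} (hτ : τ = ((p : ℝ) ^ r)⁻¹)
    (ha : 1 ≤ a) (hb : 0 ≤ b) (hb1 : b ≤ 1) :
    (0 ≤ reducedDensityOne p τ a b ∧
      1 - (τ ^ 3 + (p : ℝ) ^ 2 * τ ^ 4 + p * τ ^ 2 + 2 * ((p + 1) * τ ^ 4) + τ ^ 2) ≤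
        reducedDensityOne p τ a b ∧ reducedDensityOne p τ a b ≤ 1) ∧
    (0 ≤ localDensityTwo p τ a b ∧
      1 - (τ ^ 3 + (p : ℝ) ^ 2 * τ ^ 4 + (p + 1) * τ ^ 4) ≤ localDensityTwo p τ a b ∧
        localDensityTwo p τ a b ≤ 1) := by
  have hp1 : (1 : ℝ) < p := by exact_mod_cast hp.one_lt
  have key : ∀ i j, i < r * j → (p : ℝ) ^ i * τ ^ j < 1 := fun i j hij => by
    rw [hτ, inv_pow, ← pow_mul, ← div_eq_mul_inv, div_lt_one (by positivity)]
    exact pow_lt_pow_right₀ hp1 hij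
  have hτ0 : 0 < τ := by rw [hτ]; positivity
  have k1 := key 1 2 (by omega)
  have k2 := key 0 3 (by omega)
  have k3 := key 2 4 (by omega)
  rw [pow_zero, one_mul] at k2
  rw [pow_one] at k1
  have hR : 0 < (1 + p * τ ^ 2) * ((1 - τ ^ 3) * a + (τ ^ 3 + (p + 1) * τ ^ 4) * b) +
      τ ^ 2 * (1 - (p : ℝ) ^ 2 * τ ^ 4) * b := by
    have h1 : 0 < 1 - τ ^ 3 := by linarith
    have h2 : 0 < 1 - (p : ℝ) ^ 2 * τ ^ 4 := by linarith
    positivity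
  exact ⟨quotient_bounds_one ha hb hb1 (by positivity) k2.le (by positivity) k3.le (by positivity)
      (by positivity) k1.le (by positivity) hR,
    quotient_bounds_two ha hb hb1 (by positivity) k2.le (by positivity) k3.le (by positivity)
      (by positivity) (by positivity) hR⟩

end CotypeDensity

namespace CotypeDensity

open scoped Matrix
open PowerSeries (X)

/-! ### Numerical values -/

/-- In terms of `q = 1 / p` the local quantities become polynomials in `q`, and `q ≤ 1 / n` bounds
each power by the previous one. -/
theorem exists_inv_eq {p : ℕ} (hp : p.Prime) (n : ℕ) (hn : 0 < n) (hnp : n ≤ p) :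
    ∃ q : ℝ, 0 < q ∧ q ≤ (n : ℝ)⁻¹ ∧ (p : ℝ) * q = 1 ∧ ∀ r : ℕ, ((p : ℝ) ^ r)⁻¹ = q ^ r := by
  have hp0 : (0 : ℝ) < p := by exact_mod_cast hp.pos
  have hn0 : (0 : ℝ) < n := by exact_mod_cast hn
  refine ⟨(p : ℝ)⁻¹, by positivity, ?_, mul_inv_cancel₀ hp0.ne', fun r => (inv_pow _ _).symm⟩
  exact inv_anti₀ hn0 (by exact_mod_cast hnp)

theorem tail_bounds_two {p : ℕ} (hp : p.Prime) (h : 11 ≤ p) {τ : ℝ} (hτ : τ = ((p : ℝ) ^ 2)⁻¹) :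
    τ ^ 3 + (p : ℝ) ^ 2 * τ ^ 4 + p * τ ^ 2 + 2 * ((p + 1) * τ ^ 4) + τ ^ 2 ≤
      (6 / 5) / (p : ℝ) ^ 3 ∧
    τ ^ 3 + (p : ℝ) ^ 2 * τ ^ 4 + (p + 1) * τ ^ 4 ≤ (1 / 500) / (p : ℝ) ^ 3 := by
  obtain ⟨q, hq, hq1, hpq, hr⟩ := exists_inv_eq hp 11 (by norm_num) h
  rw [hr] at hτ
  rw [div_eq_mul_inv _ ((p : ℝ) ^ 3), div_eq_mul_inv _ ((p : ℝ) ^ 3), hr]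
  have e1 : (p : ℝ) ^ 2 * τ ^ 4 = q ^ 6 := by
    rw [hτ]; linear_combination (q ^ 6 * (p * q + 1)) * hpq
  have e2 : (p : ℝ) * τ ^ 2 = q ^ 3 := by rw [hτ]; linear_combination q ^ 3 * hpq
  have e3 : ((p : ℝ) + 1) * τ ^ 4 = q ^ 7 + q ^ 8 := by
    rw [hτ]; linear_combination q ^ 7 * hpq
  have e4 : τ ^ 3 = q ^ 6 := by rw [hτ]; ring
  have e5 : τ ^ 2 = q ^ 4 := by rw [hτ]; ring
  rw [e1, e2, e3, e4, e5]
  norm_num at hq1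
  have step : ∀ k, q ^ (k + 1) ≤ q ^ k / 11 := fun k => by
    rw [pow_succ, div_eq_mul_inv]
    exact mul_le_mul_of_nonneg_left (by linarith) (by positivity)
  have s3 := step 3
  have s4 := step 4
  have s5 := step 5
  have s6 := step 6
  have s7 := step 7
  have : 0 < q ^ 3 := by positivity
  constructor <;> linarith

theorem tail_bounds_three {p : ℕ} (hp : p.Prime) {τ : ℝ} (hτ : τ = ((p : ℝ) ^ 3)⁻¹) :
    (30 ≤ p → τ ^ 3 + (p : ℝ) ^ 2 * τ ^ 4 + p * τ ^ 2 + 2 * ((p + 1) * τ ^ 4) + τ ^ 2 ≤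
      (1 / 800) / (p : ℝ) ^ 3) ∧
    (11 ≤ p → τ ^ 3 + (p : ℝ) ^ 2 * τ ^ 4 + (p + 1) * τ ^ 4 ≤ (1 / 500) / (p : ℝ) ^ 3) := by
  have main : ∀ n : ℕ, 11 ≤ n → n ≤ p → ∃ q : ℝ, 0 < q ∧ q ≤ (n : ℝ)⁻¹ ∧
      τ ^ 3 = q ^ 9 ∧ (p : ℝ) ^ 2 * τ ^ 4 = q ^ 10 ∧ p * τ ^ 2 = q ^ 5 ∧
      (p + 1) * τ ^ 4 = q ^ 11 + q ^ 12 ∧ τ ^ 2 = q ^ 6 ∧ ((p : ℝ) ^ 3)⁻¹ = q ^ 3 := by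
    intro n hn hnp
    obtain ⟨q, hq, hq1, hpq, hr⟩ := exists_inv_eq hp n (by omega) hnp
    rw [hr] at hτ
    refine ⟨q, hq, hq1, ?_, ?_, ?_, ?_, ?_, hr 3⟩
    · rw [hτ]; ring
    · rw [hτ]; linear_combination (q ^ 10 * (p * q + 1)) * hpq
    · rw [hτ]; linear_combination q ^ 5 * hpq
    · rw [hτ]; linear_combination q ^ 11 * hpq
    · rw [hτ]; ring
  constructor
  · intro h
    obtain ⟨q, hq, hq1, e1, e2, e3, e4, e5, e6⟩ := main 30 (by norm_num) h
    rw [div_eq_mul_inv, e1, e2, e3, e4, e5, e6]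
    norm_num at hq1
    have step : ∀ k, q ^ (k + 1) ≤ q ^ k / 30 := fun k => by
      rw [pow_succ, div_eq_mul_inv]
      exact mul_le_mul_of_nonneg_left (by linarith) (by positivity)
    have s3 := step 3
    have s4 := step 4
    have s5 := step 5
    have s6 := step 6
    have s7 := step 7
    have s8 := step 8
    have s9 := step 9
    have s10 := step 10
    have s11 := step 11
    have : 0 < q ^ 3 := by positivity
    linarith
  · intro h
    obtain ⟨q, hq, hq1, e1, e2, -, e4, -, e6⟩ := main 11 le_rfl h
    rw [div_eq_mul_inv, e1, e2, e4, e6]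
    norm_num at hq1
    have step : ∀ k, q ^ (k + 1) ≤ q ^ k / 11 := fun k => by
      rw [pow_succ, div_eq_mul_inv]
      exact mul_le_mul_of_nonneg_left (by linarith) (by positivity)
    have s3 := step 3
    have s4 := step 4
    have s5 := step 5
    have s6 := step 6
    have s7 := step 7
    have s8 := step 8
    have s9 := step 9
    have s10 := step 10
    have s11 := step 11
    have : 0 < q ^ 3 := by positivity
    linarith

/-! ### Enclosing the limits by finite products -/

section Enclosures

variable {a b : ℕ → ℝ} {δ : ℝ}

theorem density_two_bounds {r : ℕ} (hr : r = 2 ∨ r = 3) (ha : ∀ p : ℕ, p.Prime → 1 ≤ a p)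
    (hb : ∀ p : ℕ, p.Prime → 0 ≤ b p ∧ b p ≤ 1)
    (hδ : Tendsto (fun N : ℕ => ∏ p ∈ N.primesBelow,
      localDensityTwo p (((p : ℝ) ^ r)⁻¹) (a p) (b p)) atTop (𝓝 δ)) :
    (∏ p ∈ Nat.primesBelow 11, localDensityTwo p (((p : ℝ) ^ r)⁻¹) (a p) (b p)) *
      (1 - 1 / 110000) ≤ δ ∧
    δ ≤ ∏ p ∈ Nat.primesBelow 11, localDensityTwo p (((p : ℝ) ^ r)⁻¹) (a p) (b p) := by
  have hr2 : 2 ≤ r := by omega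
  have hB := fun p (hp : Nat.Prime p) =>
    (local_bounds hp hr2 rfl (ha p hp) (hb p hp).1 (hb p hp).2).2
  -- The tail factor is `1 - c / (2 P (P - 1))` with `c = 1 / 500` and `P = 11`, that is `1 - 1 /
  -- 110000`; no zeta factor is split off here.
  have h := density_bounds (P := 11) (c := 1 / 500) (Z := 1) (z := fun _ => 1) (by norm_num)
    (by norm_num) (by simp) hδ (fun _ _ => zero_le_one) (fun p _ => (one_mul _).symm)
    (fun p hp => (hB p hp).1) fun p hp h11 => by
      refine ⟨le_trans ?_ (hB p hp).2.1, (hB p hp).2.2⟩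
      have : (((p : ℝ) ^ r)⁻¹) ^ 3 + (p : ℝ) ^ 2 * (((p : ℝ) ^ r)⁻¹) ^ 4 +
          (p + 1) * (((p : ℝ) ^ r)⁻¹) ^ 4 ≤ 1 / 500 / (p : ℝ) ^ 3 := by
        rcases hr with rfl | rfl
        · exact (tail_bounds_two hp h11 rfl).2
        · exact (tail_bounds_three hp rfl).2 h11
      linarith
  norm_num at h ⊢
  exact h

theorem density_one_bounds_two (ha : ∀ p : ℕ, p.Prime → 1 ≤ a p)
    (hb : ∀ p : ℕ, p.Prime → 0 ≤ b p ∧ b p ≤ 1)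
    (hδ : Tendsto (fun N : ℕ => ∏ p ∈ N.primesBelow,
      localDensityOne p (((p : ℝ) ^ 2)⁻¹) (a p) (b p)) atTop (𝓝 δ)) :
    (Real.pi ^ 2 / 6)⁻¹ * ((∏ p ∈ Nat.primesBelow 101,
      reducedDensityOne p (((p : ℝ) ^ 2)⁻¹) (a p) (b p)) * (1 - 3 / 50500)) ≤ δ ∧
    δ ≤ (Real.pi ^ 2 / 6)⁻¹ * ∏ p ∈ Nat.primesBelow 101,
      reducedDensityOne p (((p : ℝ) ^ 2)⁻¹) (a p) (b p) := by
  have hB := fun p (hp : Nat.Prime p) =>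
    (local_bounds hp le_rfl rfl (ha p hp) (hb p hp).1 (hb p hp).2).1
  -- The leading factor `1 - p ^ 2 τ ^ 2` is `1 - p ^ (-2)`, with product `1 / ζ(2)`; the rest has
  -- `c = 6 / 5`, and `c / (2 * 101 * 100) = 3 / 50500`.
  have h := density_bounds (P := 101) (c := 6 / 5) (by norm_num)
    (by norm_num) tendsto_prod_one_sub_inv_sq hδ (fun p hp => by
      have : (1 : ℝ) ≤ p := by exact_mod_cast hp.one_le
      exact sub_nonneg.2 (inv_le_one_of_one_le₀ (one_le_pow₀ this)))
    (fun p hp => by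
      rw [localDensityOne_eq]
      congr 2
      obtain ⟨q, -, -, hpq, hq⟩ := exists_inv_eq hp 1 one_pos hp.one_le
      rw [hq]
      linear_combination (q ^ 2 * (p * q + 1)) * hpq)
    (fun p hp => (hB p hp).1) fun p hp h101 => by
      refine ⟨le_trans ?_ (hB p hp).2.1, (hB p hp).2.2⟩
      linarith [(tail_bounds_two hp (by omega : 11 ≤ p) rfl).1]
  norm_num at h ⊢
  exact h

theorem density_one_bounds_three (ha : ∀ p : ℕ, p.Prime → 1 ≤ a p)
    (hb : ∀ p : ℕ, p.Prime → 0 ≤ b p ∧ b p ≤ 1)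
    (hδ : Tendsto (fun N : ℕ => ∏ p ∈ N.primesBelow,
      localDensityOne p (((p : ℝ) ^ 3)⁻¹) (a p) (b p)) atTop (𝓝 δ)) :
    (Real.pi ^ 4 / 90)⁻¹ * ((∏ p ∈ Nat.primesBelow 30,
      reducedDensityOne p (((p : ℝ) ^ 3)⁻¹) (a p) (b p)) * (1 - 1 / 1392000)) ≤ δ ∧
    δ ≤ (Real.pi ^ 4 / 90)⁻¹ * ∏ p ∈ Nat.primesBelow 30,
      reducedDensityOne p (((p : ℝ) ^ 3)⁻¹) (a p) (b p) := by
  have hB := fun p (hp : Nat.Prime p) =>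
    (local_bounds hp (by norm_num : 2 ≤ 3) rfl (ha p hp) (hb p hp).1 (hb p hp).2).1
  -- With `τ = p ^ (-3)` the leading factor is `1 - p ^ (-4)`, with product `1 / ζ(4)`, and `(1 /
  -- 800) / (2 * 30 * 29) = 1 / 1392000`.
  have h := density_bounds (P := 30) (c := 1 / 800) (by norm_num)
    (by norm_num) tendsto_prod_one_sub_inv_pow_four hδ (fun p hp => by
      have : (1 : ℝ) ≤ p := by exact_mod_cast hp.one_le
      exact sub_nonneg.2 (inv_le_one_of_one_le₀ (one_le_pow₀ this)))
    (fun p hp => by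
      rw [localDensityOne_eq]
      congr 2
      obtain ⟨q, -, -, hpq, hq⟩ := exists_inv_eq hp 1 one_pos hp.one_le
      rw [hq, hq]
      linear_combination (q ^ 4 * (p * q + 1)) * hpq)
    (fun p hp => (hB p hp).1) fun p hp h30 => by
      refine ⟨le_trans ?_ (hB p hp).2.1, (hB p hp).2.2⟩
      linarith [(tail_bounds_three hp rfl).1 h30]
  norm_num at h ⊢
  exact h

theorem abs_sub_lt_of_inv_bounds {z A c lo hi x zlo zhi : ℝ} (hz : zlo ≤ z) (hz' : z ≤ zhi)
    (hzlo : 0 < zlo) (hc : 0 ≤ 1 - c) (hlo : lo ≤ A) (hhi : A ≤ hi)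
    (h : z⁻¹ * (A * (1 - c)) ≤ δ ∧ δ ≤ z⁻¹ * A)
    (h1 : (x - 0.0005) * zhi < lo * (1 - c)) (h1' : 0 ≤ x - 0.0005)
    (h2 : hi < (x + 0.0005) * zlo) : |δ - x| < 0.0005 := by
  have hz0 : 0 < z := hzlo.trans_le hz
  rw [inv_mul_eq_div, inv_mul_eq_div, div_le_iff₀ hz0, le_div_iff₀ hz0] at h
  have e1 : lo * (1 - c) ≤ A * (1 - c) := mul_le_mul_of_nonneg_right hlo hc
  have e2 : (x - 0.0005) * z ≤ (x - 0.0005) * zhi := mul_le_mul_of_nonneg_left hz' h1'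
  have e3 : (x + 0.0005) * zlo ≤ (x + 0.0005) * z :=
    mul_le_mul_of_nonneg_left hz (by linarith)
  rw [abs_lt]
  constructor
  · have : (x - 0.0005) * z < δ * z := by linarith
    linarith [lt_of_mul_lt_mul_right this hz0.le]
  · have : δ * z < (x + 0.0005) * z := by linarith
    linarith [lt_of_mul_lt_mul_right this hz0.le]

theorem pi_pow_two_bounds : (1.64493 : ℝ) ≤ Real.pi ^ 2 / 6 ∧ Real.pi ^ 2 / 6 ≤ 1.644935 := by
  have h1 := Real.pi_gt_d6
  have h2 := Real.pi_lt_d6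
  constructor <;> nlinarith

theorem pi_pow_four_bounds :
    (1.082322 : ℝ) ≤ Real.pi ^ 4 / 90 ∧ Real.pi ^ 4 / 90 ≤ 1.0823238 := by
  have h1 := Real.pi_gt_d6
  have h2 := Real.pi_lt_d6
  have h3 : (9.8696 : ℝ) ≤ Real.pi ^ 2 := by nlinarith
  have h4 : Real.pi ^ 2 ≤ 9.869607 := by nlinarith
  have h5 : Real.pi ^ 4 = Real.pi ^ 2 * Real.pi ^ 2 := by ring
  rw [h5]
  constructor <;> nlinarith

end Enclosures

theorem prod_primesBelow_eleven (f : ℕ → ℝ) :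
    ∏ p ∈ Nat.primesBelow 11, f p = f 2 * f 3 * f 5 * f 7 := by
  have : Nat.primesBelow 11 = {2, 3, 5, 7} := by decide +kernel
  rw [this]
  simp [mul_assoc]

theorem prod_primesBelow_thirty (f : ℕ → ℝ) : ∏ p ∈ Nat.primesBelow 30, f p =
    f 2 * f 3 * f 5 * f 7 * f 11 * f 13 * f 17 * f 19 * f 23 * f 29 := by
  have : Nat.primesBelow 30 = {2, 3, 5, 7, 11, 13, 17, 19, 23, 29} := by decide +kernel
  rw [this]
  simp [mul_assoc]

theorem prod_primesBelow_hundred_one (f : ℕ → ℝ) : ∏ p ∈ Nat.primesBelow 101, f p =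
    f 2 * f 3 * f 5 * f 7 * f 11 * f 13 * f 17 * f 19 * f 23 * f 29 * f 31 * f 37 * f 41 * f 43 *
      f 47 * f 53 * f 59 * f 61 * f 67 * f 71 * f 73 * f 79 * f 83 * f 89 * f 97 := by
  have : Nat.primesBelow 101 = {2, 3, 5, 7, 11, 13, 17, 19, 23, 29, 31, 37, 41, 43, 47, 53, 59, 61,
    67, 71, 73, 79, 83, 89, 97} := by decide +kernel
  rw [this]
  simp [mul_assoc]

theorem HasValue.ofNat (τ : ℝ) (n : ℕ) [n.AtLeastTwo] :
    HasValue τ (OfNat.ofNat n : PowerSeries ℝ) (OfNat.ofNat n : ℝ) := by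
  have h := HasValue.natCast τ (OfNat.ofNat n)
  rwa [Nat.cast_ofNat, Nat.cast_ofNat] at h

end CotypeDensity

namespace CotypeDensity

open scoped Matrix
open PowerSeries (X)

/-! ### The densities of the five algebras -/

theorem Ab.density :
    TendstoRounded (proportion Ab 1) 0.885 ∧ TendstoRounded (proportion Ab 2) 0.998 := by
  let a : ℕ → ℝ := fun p => 1 + ((p : ℝ) + 1) * ((p : ℝ) ^ 3)⁻¹
  let b : ℕ → ℝ := fun p => 1 - (p : ℝ) ^ 2 * ((p : ℝ) ^ 3)⁻¹
  have hab : ∀ p : ℕ, p.Prime → 1 ≤ a p ∧ 0 ≤ b p ∧ b p ≤ 1 := fun p hp => by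
    obtain ⟨q, hq, hq1, hpq, hr⟩ := exists_inv_eq hp 2 two_pos hp.two_le
    have hb : b p = 1 - q := by
      simp only [b]
      rw [hr]
      linear_combination -(q * (p * q + 1)) * hpq
    rw [hb]
    norm_num at hq1
    exact ⟨by simp only [a, le_add_iff_nonneg_right]; positivity, by linarith, by linarith⟩
  obtain ⟨⟨δ₁, h1, h1'⟩, ⟨δ₂, h2, h2'⟩⟩ := localData_ab.tendsto_density (a := a) (b := b)
    (u := powFun 2) (by norm_num)
    (by norm_num) (isMultiplicative_powFun 2) hasGrowth_powFun_two
    (fun p hp => localSeries_powFun_mul hp 2)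
    (fun p _ => (HasValue.one _).add (((HasValue.natCast _ p).add (HasValue.one _)).mul
      (HasValue.X _)))
    (fun p _ => (HasValue.one _).sub (((HasValue.natCast _ p).pow 2).mul (HasValue.X _)))
    (fun p hp => (hab p hp).1) (fun p hp => (hab p hp).2.1)
  let e : Ab ≃+ Vec := AddEquiv.refl Vec
  have he : ∀ x y : Ab, e ⁅x, y⁆ = (0 : Matrix (Fin 3) (Fin 3) ℤ) *ᵥ (e x ⨯₃ e y) := fun x y => by
    rw [Matrix.zero_mulVec]
    rfl
  refine ⟨⟨δ₁, tendsto_proportion e he h1, ?_⟩, ⟨δ₂, tendsto_proportion e he h2, ?_⟩⟩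
  -- The limit exceeds `0.8845`, the lower end of the rounding interval, by less than `10 ^ (-5)`;
  -- hence the many digits of `π` and of the finite product.
  · refine abs_sub_lt_of_inv_bounds pi_pow_four_bounds.1 pi_pow_four_bounds.2 (by norm_num)
      (by norm_num) (lo := 0.9573189) (hi := 0.957319) ?_ ?_
      (density_one_bounds_three (fun p hp => (hab p hp).1) (fun p hp => (hab p hp).2) h1')
      (by norm_num) (by norm_num) (by norm_num)
    all_goals
      rw [prod_primesBelow_thirty]
      norm_num [reducedDensityOne, allValue, a, b]
  · have h := density_two_bounds (Or.inr rfl) (fun p hp => (hab p hp).1)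
      (fun p hp => (hab p hp).2) h2'
    rw [prod_primesBelow_eleven] at h
    norm_num [localDensityTwo, allValue, a, b] at h
    rw [abs_lt]
    constructor <;> linarith [h.1, h.2]

/-- Limits and enclosures for an algebra whose subalgebras are counted by squares. -/
theorem tendstoRounded_of_localData {L : Type*} [LieRing L] {M : Matrix (Fin 3) (Fin 3) ℤ}
    {h V : ℕ → PowerSeries ℝ} {u : ArithmeticFunction ℝ} {ℓ : ℕ → ℝ} {κ : ℝ} {a b : ℕ → ℝ}
    (e : L ≃+ Vec) (he : ∀ x y, e ⁅x, y⁆ = M *ᵥ (e x ⨯₃ e y))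
    (H : LocalData M 2 h V) (hκ : κ ≠ 0)
    (hu : u.IsMultiplicative) (hgrowth : HasGrowth u 2 ℓ κ)
    (huV : ∀ p : ℕ, p.Prime → localSeries u p * V p = 1)
    (ha : ∀ p : ℕ, p.Prime → HasValue (((p : ℝ) ^ 2)⁻¹) (h p) (a p))
    (hb : ∀ p : ℕ, p.Prime → HasValue (((p : ℝ) ^ 2)⁻¹) (V p) (b p))
    (hab : ∀ p : ℕ, p.Prime → 1 ≤ a p ∧ 0 ≤ b p ∧ b p ≤ 1) {x₁ x₂ lo hi : ℝ}
    (hlo : lo ≤ ∏ p ∈ Nat.primesBelow 101, reducedDensityOne p (((p : ℝ) ^ 2)⁻¹) (a p) (b p))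
    (hhi : ∏ p ∈ Nat.primesBelow 101, reducedDensityOne p (((p : ℝ) ^ 2)⁻¹) (a p) (b p) ≤ hi)
    (h1 : (x₁ - 0.0005) * 1.644935 < lo * (1 - 3 / 50500)) (h1' : 0 ≤ x₁ - 0.0005)
    (h2 : hi < (x₁ + 0.0005) * 1.64493)
    (h3 : x₂ - 0.0005 <
      (∏ p ∈ Nat.primesBelow 11, localDensityTwo p (((p : ℝ) ^ 2)⁻¹) (a p) (b p)) *
        (1 - 1 / 110000))
    (h4 : ∏ p ∈ Nat.primesBelow 11, localDensityTwo p (((p : ℝ) ^ 2)⁻¹) (a p) (b p) <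
      x₂ + 0.0005) :
    TendstoRounded (proportion L 1) x₁ ∧ TendstoRounded (proportion L 2) x₂ := by
  obtain ⟨⟨δ₁, k1, k1'⟩, ⟨δ₂, k2, k2'⟩⟩ := H.tendsto_density le_rfl hκ hu hgrowth huV ha hb
    (fun p hp => (hab p hp).1) (fun p hp => (hab p hp).2.1)
  refine ⟨⟨δ₁, tendsto_proportion _ he k1, ?_⟩, ⟨δ₂, tendsto_proportion _ he k2, ?_⟩⟩
  · exact abs_sub_lt_of_inv_bounds pi_pow_two_bounds.1 pi_pow_two_bounds.2 (by norm_num)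
      (by norm_num) hlo hhi (density_one_bounds_two (fun p hp => (hab p hp).1)
        (fun p hp => (hab p hp).2) k1') h1 h1' h2
  · have h := density_two_bounds (Or.inl rfl) (fun p hp => (hab p hp).1)
      (fun p hp => (hab p hp).2) k2'
    rw [abs_lt]
    constructor <;> linarith [h.1, h.2]

theorem hasValue_one_sub (p : ℕ) (τ : ℝ) : HasValue τ (1 - (p : PowerSeries ℝ) * X) (1 - p * τ) :=
  (HasValue.one _).sub ((HasValue.natCast _ p).mul (HasValue.X _))

/-- The value of the numerator of `sl₂`. -/
noncomputable def numSl2Value (p : ℕ) : ℝ :=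
  if p = 2 then 1 + ((p : ℝ) ^ 2)⁻¹ + 6 * ((p : ℝ) ^ 2)⁻¹ ^ 2 else 1 + ((p : ℝ) ^ 2)⁻¹

theorem Sl2.density :
    TendstoRounded (proportion Sl2 1) 0.488 ∧ TendstoRounded (proportion Sl2 2) 0.974 := by
  refine tendstoRounded_of_localData (a := numSl2Value)
    (b := fun p => 1 - p * ((p : ℝ) ^ 2)⁻¹) (AddEquiv.refl Vec : Sl2 ≃+ Vec)
    (fun x y => br_eq_mulVec _ _ _ _ _) localData_sl2 (by norm_num : (1 / 2 : ℝ) ≠ 0)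
    (isMultiplicative_powFun 1) hasGrowth_powFun_one
    (fun p hp => by simpa using localSeries_powFun_mul hp 1) (fun p _ => ?_)
    (fun p _ => hasValue_one_sub p _) (fun p hp => ?_) (lo := 0.803) (hi := 0.8031) ?_ ?_
    (by norm_num) (by norm_num) (by norm_num) ?_ ?_
  · have hX := HasValue.X ((p : ℝ) ^ 2)⁻¹
    have h1 := HasValue.one ((p : ℝ) ^ 2)⁻¹
    rw [numSl2, numSl2Value]
    split_ifs
    · exact (h1.add hX).add ((HasValue.ofNat _ 6).mul (hX.pow 2))
    · exact h1.add hX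
  · obtain ⟨q, hq, hq1, hpq, hr⟩ := exists_inv_eq hp 2 two_pos hp.two_le
    have hb : 1 - p * ((p : ℝ) ^ 2)⁻¹ = 1 - q := by rw [hr]; linear_combination -q * hpq
    rw [hb, numSl2Value]
    norm_num at hq1
    refine ⟨?_, by linarith, by linarith⟩
    split_ifs <;> rw [← sub_nonneg] <;> ring_nf <;> positivity
  · rw [prod_primesBelow_hundred_one]
    norm_num [reducedDensityOne, allValue, numSl2Value]
  · rw [prod_primesBelow_hundred_one]
    norm_num [reducedDensityOne, allValue, numSl2Value]
  · rw [prod_primesBelow_eleven]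
    norm_num [localDensityTwo, allValue, numSl2Value]
  · rw [prod_primesBelow_eleven]
    norm_num [localDensityTwo, allValue, numSl2Value]

theorem Heis.density :
    TendstoRounded (proportion Heis 1) 0.492 ∧ TendstoRounded (proportion Heis 2) 0.975 := by
  refine tendstoRounded_of_localData
    (a := fun p => 1 + ((p : ℝ) ^ 2)⁻¹ - p * ((p : ℝ) ^ 2)⁻¹ ^ 2 - p ^ 3 * ((p : ℝ) ^ 2)⁻¹ ^ 3)
    (b := fun p => (1 - p * ((p : ℝ) ^ 2)⁻¹) * (1 - p ^ 3 * ((p : ℝ) ^ 2)⁻¹ ^ 2))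
    (AddEquiv.refl Vec : Heis ≃+ Vec)
    (fun x y => br_eq_mulVec _ _ _ _ _) localData_heis (by norm_num : (1 / 2 / 2 : ℝ) ≠ 0)
    (isMultiplicative_sqFun.mul (isMultiplicative_powFun 1)) hasGrowth_sqFun_mul_powFun_one
    (fun p hp => ?_) (fun p _ => ?_)
    (fun p _ => (hasValue_one_sub p _).mul ((HasValue.one _).sub
      (((HasValue.natCast _ p).pow 3).mul ((HasValue.X _).pow 2)))) (fun p hp => ?_)
    (lo := 0.8089) (hi := 0.809) ?_ ?_
    (by norm_num) (by norm_num) (by norm_num) ?_ ?_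
  · have h1 := localSeries_powFun_mul hp 1
    have h2 := localSeries_sqFun_mul hp
    rw [pow_one] at h1
    rw [localSeries_mul hp]
    linear_combination
      (localSeries sqFun p * (1 - (p : PowerSeries ℝ) ^ 3 * X ^ 2)) * h1 + h2
  · have hX := HasValue.X ((p : ℝ) ^ 2)⁻¹
    have h1 := HasValue.one ((p : ℝ) ^ 2)⁻¹
    have hP := HasValue.natCast ((p : ℝ) ^ 2)⁻¹ p
    exact ((h1.add hX).sub (hP.mul (hX.pow 2))).sub ((hP.pow 3).mul (hX.pow 3))
  · obtain ⟨q, hq, hq1, hpq, hr⟩ := exists_inv_eq hp 2 two_pos hp.two_le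
    have e1 : (p : ℝ) * (q ^ 2) ^ 2 = q ^ 3 := by linear_combination q ^ 3 * hpq
    have e2 : (p : ℝ) ^ 3 * (q ^ 2) ^ 3 = q ^ 3 := by
      linear_combination q ^ 3 * ((p * q) ^ 2 + p * q + 1) * hpq
    have e3 : (p : ℝ) * q ^ 2 = q := by linear_combination q * hpq
    have e4 : (p : ℝ) ^ 3 * (q ^ 2) ^ 2 = q := by
      linear_combination q * ((p * q) ^ 2 + p * q + 1) * hpq
    rw [hr, e1, e2, e3, e4]
    norm_num at hq1
    refine ⟨?_, ?_, ?_⟩ <;> nlinarith [sq_nonneg q]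
  all_goals first
    | rw [prod_primesBelow_hundred_one]; norm_num [reducedDensityOne, allValue]
    | rw [prod_primesBelow_eleven]; norm_num [localDensityTwo, allValue]

/-- The value of the numerator of `L₁`. -/
noncomputable def numL1Value (p : ℕ) : ℝ :=
  if p = 2 then 1 - ((p : ℝ) ^ 2)⁻¹ + 4 * ((p : ℝ) ^ 2)⁻¹ ^ 2 + 4 * ((p : ℝ) ^ 2)⁻¹ ^ 3 -
    16 * ((p : ℝ) ^ 2)⁻¹ ^ 4 else 1 + ((p : ℝ) ^ 2)⁻¹ - 2 * p * ((p : ℝ) ^ 2)⁻¹ ^ 2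

theorem L1.density :
    TendstoRounded (proportion L1 1) 0.492 ∧ TendstoRounded (proportion L1 2) 0.975 := by
  refine tendstoRounded_of_localData (a := numL1Value)
    (b := fun p => (1 - p * ((p : ℝ) ^ 2)⁻¹) * (1 - p * ((p : ℝ) ^ 2)⁻¹))
    (AddEquiv.refl Vec : L1 ≃+ Vec)
    (fun x y => br_eq_mulVec _ _ _ _ _) localData_l1 (by norm_num : (1 / 2 : ℝ) ≠ 0)
    ((isMultiplicative_powFun 1).mul (isMultiplicative_powFun 1))
    hasGrowth_powFun_one_mul_powFun_one (fun p hp => ?_) (fun p _ => ?_)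
    (fun p _ => (hasValue_one_sub p _).mul (hasValue_one_sub p _)) (fun p hp => ?_)
    (lo := 0.8089) (hi := 0.809) ?_ ?_
    (by norm_num) (by norm_num) (by norm_num) ?_ ?_
  · have h1 := localSeries_powFun_mul hp 1
    rw [pow_one] at h1
    rw [localSeries_mul hp, mul_mul_mul_comm, h1, mul_one]
  · have hX := HasValue.X ((p : ℝ) ^ 2)⁻¹
    have h1 := HasValue.one ((p : ℝ) ^ 2)⁻¹
    have hP := HasValue.natCast ((p : ℝ) ^ 2)⁻¹ p
    rw [numL1, numL1Value]
    split_ifs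
    · exact (((h1.sub hX).add ((HasValue.ofNat _ 4).mul (hX.pow 2))).add
        ((HasValue.ofNat _ 4).mul (hX.pow 3))).sub ((HasValue.ofNat _ 16).mul (hX.pow 4))
    · exact (h1.add hX).sub (((HasValue.ofNat _ 2).mul hP).mul (hX.pow 2))
  · obtain ⟨q, hq, hq1, hpq, hr⟩ := exists_inv_eq hp 2 two_pos hp.two_le
    have e1 : 2 * (p : ℝ) * (q ^ 2) ^ 2 = 2 * q ^ 3 := by linear_combination 2 * q ^ 3 * hpq
    have e3 : (p : ℝ) * q ^ 2 = q := by linear_combination q * hpq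
    norm_num at hq1
    refine ⟨?_, ?_, ?_⟩
    · rw [numL1Value]
      split_ifs with h
      · subst h
        norm_num
      · rw [hr, e1]
        nlinarith [sq_nonneg q]
    · rw [hr, e3]
      nlinarith
    · rw [hr, e3]
      nlinarith
  all_goals first
    | rw [prod_primesBelow_hundred_one]; norm_num [reducedDensityOne, allValue, numL1Value]
    | rw [prod_primesBelow_eleven]; norm_num [localDensityTwo, allValue, numL1Value]

/-- The value of the numerator of `L₂`. -/
noncomputable def numL2Value (p : ℕ) : ℝ :=
  if p = 2 then 1 + ((p : ℝ) ^ 2)⁻¹ - 2 * ((p : ℝ) ^ 2)⁻¹ ^ 2 else if p % 4 = 1 then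
    1 + ((p : ℝ) ^ 2)⁻¹ - 2 * p * ((p : ℝ) ^ 2)⁻¹ ^ 2 else 1 + ((p : ℝ) ^ 2)⁻¹

/-- The value of `chiFactor`. -/
noncomputable def chiFactorValue (p : ℕ) : ℝ :=
  if p = 2 then 1 else if p % 4 = 1 then 1 - p * ((p : ℝ) ^ 2)⁻¹ else 1 + p * ((p : ℝ) ^ 2)⁻¹

theorem L2.density :
    TendstoRounded (proportion L2 1) 0.482 ∧ TendstoRounded (proportion L2 2) 0.970 := by
  refine tendstoRounded_of_localData (a := numL2Value)
    (b := fun p => (1 - p * ((p : ℝ) ^ 2)⁻¹) * chiFactorValue p)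
    (AddEquiv.refl Vec : L2 ≃+ Vec)
    (fun x y => br_eq_mulVec _ _ _ _ _) localData_l2
    (by positivity : (1 / 2 * (Real.pi / 4) : ℝ) ≠ 0)
    ((isMultiplicative_powFun 1).mul isMultiplicative_chiFun)
    hasGrowth_powFun_one_mul_chiFun (fun p hp => ?_) (fun p _ => ?_)
    (fun p _ => (hasValue_one_sub p _).mul ?_) (fun p hp => ?_)
    -- The limit lies less than `10 ^ (-4)` above `0.4815`, the lower end of the rounding interval,
    -- so five digits of the product over `p ≤ 97` are used.
    (lo := 0.79214) (hi := 0.79215) ?_ ?_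
    (by norm_num) (by norm_num) (by norm_num) ?_ ?_
  · have h1 := localSeries_powFun_mul hp 1
    rw [pow_one] at h1
    rw [localSeries_mul hp, mul_mul_mul_comm, h1, localSeries_chiFun_mul_chiFactor hp, mul_one]
  · have hX := HasValue.X ((p : ℝ) ^ 2)⁻¹
    have h1 := HasValue.one ((p : ℝ) ^ 2)⁻¹
    have hP := HasValue.natCast ((p : ℝ) ^ 2)⁻¹ p
    rw [numL2, numL2Value]
    split_ifs
    · exact (h1.add hX).sub ((HasValue.ofNat _ 2).mul (hX.pow 2))
    · exact (h1.add hX).sub (((HasValue.ofNat _ 2).mul hP).mul (hX.pow 2))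
    · exact h1.add hX
  · have h1 := HasValue.one ((p : ℝ) ^ 2)⁻¹
    rw [chiFactor, chiFactorValue]
    split_ifs
    · exact h1
    · exact hasValue_one_sub p _
    · exact h1.add ((HasValue.natCast _ p).mul (HasValue.X _))
  · obtain ⟨q, hq, hq1, hpq, hr⟩ := exists_inv_eq hp 2 two_pos hp.two_le
    have e1 : 2 * (p : ℝ) * (q ^ 2) ^ 2 = 2 * q ^ 3 := by linear_combination 2 * q ^ 3 * hpq
    have e3 : (p : ℝ) * q ^ 2 = q := by linear_combination q * hpq
    norm_num at hq1
    refine ⟨?_, ?_⟩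
    · rw [numL2Value]
      split_ifs with h h4
      · subst h
        norm_num
      · rw [hr, e1]
        nlinarith [sq_nonneg q]
      · rw [hr]
        nlinarith [sq_nonneg q]
    · rw [chiFactorValue, hr, e3]
      split_ifs <;> constructor <;> nlinarith
  all_goals first
    | rw [prod_primesBelow_hundred_one]
      norm_num [reducedDensityOne, allValue, numL2Value, chiFactorValue]
    | rw [prod_primesBelow_eleven]
      norm_num [localDensityTwo, allValue, numL2Value, chiFactorValue]

end CotypeDensity

theorem theorem1p9 :
    (CotypeDensity.TendstoRounded (CotypeDensity.proportion CotypeDensity.Ab 1) 0.885 ∧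
      CotypeDensity.TendstoRounded (CotypeDensity.proportion CotypeDensity.Ab 2) 0.998) ∧
    (CotypeDensity.TendstoRounded (CotypeDensity.proportion CotypeDensity.Heis 1) 0.492 ∧
      CotypeDensity.TendstoRounded (CotypeDensity.proportion CotypeDensity.Heis 2) 0.975) ∧
    (CotypeDensity.TendstoRounded (CotypeDensity.proportion CotypeDensity.Sl2 1) 0.488 ∧
      CotypeDensity.TendstoRounded (CotypeDensity.proportion CotypeDensity.Sl2 2) 0.974) ∧
    (CotypeDensity.TendstoRounded (CotypeDensity.proportion CotypeDensity.L1 1) 0.492 ∧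
      CotypeDensity.TendstoRounded (CotypeDensity.proportion CotypeDensity.L1 2) 0.975) ∧
    (CotypeDensity.TendstoRounded (CotypeDensity.proportion CotypeDensity.L2 1) 0.482 ∧
      CotypeDensity.TendstoRounded (CotypeDensity.proportion CotypeDensity.L2 2) 0.970)  :=
  ⟨CotypeDensity.Ab.density, CotypeDensity.Heis.density, CotypeDensity.Sl2.density,
    CotypeDensity.L1.density, CotypeDensity.L2.density⟩
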